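/- Let $n\ge 0$, let $T\subset SU(n)$ be the maximal torus of diagonal matrices and let $p_i:T\to U(1)$ be the $i$-th diagonal entry. Let $SU(n)$ act on $T\times SU(n)/T$ by left multiplication on the second factor. Order $Z=U(1)\setminus\{1\}$ anti-clockwise, i.e. by the angle in $(0,2\pi)$, and put $$Y_T=\{(z,t)\in Z\times T \mid z\neq p_i(t)\text{ for all } i\},\qquad Y_T^{[2]}=\{(z_1,z_2,t)\mid (z_1,t),(z_2,t)\in Y_T\}.$$ For $(z_1,z_2,t)\in Y_T^{[2]}$ let $L_{(z_1,z_2,t)}\subset\mathbb C^n$ be the sum of the eigenspaces of $t$ for the eigenvalues $\lambda\in Z$ with $z_1>\lambda>z_2$ (zero if there are none), and let $$(P_{b,T})_{(z_1,z_2,t)}=\operatorname{Hom}\big(\det L_{(z_2,z_1,t)},\det L_{(z_1,z_2,t)}\big),$$ that is $\det L_{(z_1,z_2,t)}$, $\mathbb C$, or $(\det L_{(z_2,z_1,t)})^*$ according as there are eigenvalues of $t$ between $z_1>z_2$, none between $z_1$ and $z_2$, or some between $z_1<z_2$. With the metric induced from $\mathbb C^n$, this is the restriction to $T$ of the basic bundle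 gerbe of $SU(n)$; its multiplication $(P_{b,T})_{(z_1,z_2,t)}\otimes(P_{b,T})_{(z_2,z_3,t)}\to(P_{b,T})_{(z_1,z_3,t)}$ is the wedge product for $z_1\ge z_2\ge z_3$, and is obtained from it by contraction with dual lines in the other cases. The torus $T$ acts on $P_{b,T}$ by $v_1\wedge\dots\wedge v_k\mapsto sv_1\wedge\dots\wedge sv_k$. Let $P_{b,T}\times_T SU(n)\to Y_T^{[2]}\times SU(n)/T$ be the quotient of $P_{b,T}\times SU(n)$ by $(f,g)\sim(sf,gs^{-1})$, $s\in T$, with multiplication $[f,g]\cdot[f',g]=[ff',g]$ and $SU(n)$-action $h[f,g]=[f,hg]$. Let $\mathbb C_{p_i}$ be the line $\mathbb C$ on which $s\in T$ acts by $p_i(s)$, let $J_i=\mathbb C_{p_i}\times_T SU(n)\to SU(n)/T$ be the quotient of $\mathbb C\times SU(n)$ by $(z,g)\sim(p_i(s)z,gs^{-1})$, with the action $h[z,g]=[z,hg]$, and let $\varepsilon_i(z_1,z_2,t)$ be $1$ if $z_1>p_i(t)>z_2$, $-1$ if $z_2>p_i(t)>z_1$, and $0$ otherwise. Let $\bigotimes_{i=1}^n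 J_i^{\varepsilon_i}\to Y_T^{[2]}\times SU(n)/T$ have the multiplication given by the canonical maps $J_i^{a}\otimes J_i^{b}\to J_i^{a+b}$, which applies since $\varepsilon_i(z_1,z_3,t)=\varepsilon_i(z_1,z_2,t)+\varepsilon_i(z_2,z_3,t)$, and the $SU(n)$-action induced by those on the $J_i$. Then $(P_{b,T}\times_T SU(n),\,Y_T\times SU(n)/T)$ and $(\bigotimes_{i=1}^n J_i^{\varepsilon_i},\,Y_T\times SU(n)/T)$ are $SU(n)$-equivariant bundle gerbes over $T\times SU(n)/T$, and there is an $SU(n)$-equivariant isomorphism of bundle gerbes over $T\times SU(n)/T$ $$\Phi:\big(P_{b,T}\times_T SU(n),\,Y_T\times SU(n)/T\big)\;\cong_{SU(n)}\;\Big(\bigotimes_{i=1}^n J_i^{\varepsilon_i},\,Y_T\times SU(n)/T\Big)$$ covering the identity of $Y_T\times SU(n)/T$; that is, $\Phi$ is a smooth isometric isomorphism of Hermitian line bundles over $Y_T^{[2]}\times SU(n)/T$, with smooth inverse, which respects the bundle gerbe multiplications and commutes with the actions of $SU(n)$. Moreover $\Phi$ can be chosen to be induced by a decomposition of the determinant lines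 into weight lines: there are $T$-equivariant isometric isomorphisms $$\Psi_{(z_1,z_2,t)}:(P_{b,T})_{(z_1,z_2,t)}\to\bigotimes_{i=1}^n\mathbb C_{p_i}^{\varepsilon_i(z_1,z_2,t)},\qquad (z_1,z_2,t)\in Y_T^{[2]},$$ such that $\Phi([f,g])$ is the image of $\Psi_{(z_1,z_2,t)}(f)$ under the isomorphism $\bigotimes_i\mathbb C_{p_i}^{\varepsilon_i}\to\bigotimes_i J_i^{\varepsilon_i}|_{gT}$ induced by the maps $z\mapsto[z,g]$, for all $f\in(P_{b,T})_{(z_1,z_2,t)}$ and $g\in SU(n)$. -/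

import Mathlib

open Filter Topology
open scoped ContDiff TensorProduct

noncomputable section

namespace WeylGerbe

/-! ### Smooth structures

All spaces carry their smooth structure as a diffeology (Mathlib's `DiffeologicalSpace`): the
smooth maps `ℝᵏ → X` (plots) are recorded.  Embedded submanifolds of a vector space get the subset
diffeology, quotients such as `SU(n)/T` the quotient diffeology, and `⊓` (where the smooth maps are those
which are smooth for both diffeologies) is used for products; on manifolds `Diffeology.DSmooth`
is ordinary smoothness. -/

/-- The Euclidean spaces that serve as domains of plots. -/
abbrev Eu (k : ℕ) : Type := EuclideanSpace ℝ (Fin k)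

/-- `p` is smooth as a map from `ℝᵏ` to `X`. -/
abbrev SmoothMap {X : Type} (d : DiffeologicalSpace X) {k : ℕ} (p : Eu k → X) : Prop :=
  p ∈ d.plots k

/-- There is a smooth self-map of `ℝᵏ` with values in a given neighbourhood of `x` which is the
identity near `x`. -/
theorem exists_retract {k : ℕ} (x : Eu k) {u : Set (Eu k)} (hu : u ∈ 𝓝 x) :
    ∃ χ : Eu k → Eu k, ContDiff ℝ ∞ χ ∧ (∀ y, χ y ∈ u) ∧ χ =ᶠ[𝓝 x] id := by
  obtain ⟨ε, hε, hb⟩ := Metric.mem_nhds_iff.1 hu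
  let f : ContDiffBump x := ⟨ε / 4, ε / 2, by positivity, by linarith⟩
  refine ⟨fun y => x + f y • (y - x), ?_, fun y => hb ?_, ?_⟩
  · exact contDiff_const.add (f.contDiff.smul (contDiff_id.sub contDiff_const))
  · by_cases hy : y ∈ Metric.ball x (ε / 2)
    · rw [Metric.mem_ball, dist_eq_norm] at hy ⊢
      rw [add_sub_cancel_left, norm_smul, Real.norm_of_nonneg f.nonneg]
      calc f y * ‖y - x‖ ≤ 1 * ‖y - x‖ := by gcongr; exact f.le_one
        _ < ε := by linarith
    · have : f y = 0 := f.zero_of_le_dist (by simpa using hy)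
      simpa [this] using hε
  · filter_upwards [Metric.closedBall_mem_nhds x (show 0 < ε / 4 by positivity)] with y hy
    have : f y = 1 := f.one_of_mem_closedBall hy
    simp [this]

/-- The diffeology on `X` induced by a map `f : X → Y`: a map into `X` is smooth iff its composite
with `f` is. -/
@[reducible]
def inducedD {X Y : Type} (d : DiffeologicalSpace Y) (f : X → Y) : DiffeologicalSpace X where
  plots k := {p | SmoothMap d (f ∘ p)}
  constant_plots x := d.constant_plots (f x)
  plot_reparam {n m p g} hp hg := d.plot_reparam (p := f ∘ p) hp hg
  locality hp := d.locality (p := f ∘ _) fun r => by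
    obtain ⟨u, hu, hr, h⟩ := hp r
    exact ⟨u, hu, hr, fun {m g} hg hgs => h hg hgs⟩

/-- The diffeology on `Y` coinduced by a surjection `f : X → Y` (quotient diffeology): the smooth maps
into `Y` are those which locally lift to smooth maps into `X`. -/
@[reducible]
def coinducedD {X Y : Type} (d : DiffeologicalSpace X) (f : X → Y) (hf : Function.Surjective f) :
    DiffeologicalSpace Y where
  plots k := {p | ∀ r, ∃ q : Eu k → X, SmoothMap d q ∧ p =ᶠ[𝓝 r] f ∘ q}
  constant_plots y r := by
    obtain ⟨x, rfl⟩ := hf y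
    exact ⟨fun _ => x, d.constant_plots x, Eventually.of_forall fun _ => rfl⟩
  plot_reparam := by
    intro n m p g hp hg r
    obtain ⟨q, hq, hpq⟩ := hp (g r)
    exact ⟨q ∘ g, d.plot_reparam hq hg, hg.continuous.continuousAt.eventually hpq⟩
  locality := by
    intro n p hp r
    obtain ⟨u, hu, hr, h⟩ := hp r
    obtain ⟨χ, hχ, hχu, hχe⟩ := exists_retract r (hu.mem_nhds hr)
    obtain ⟨q, hq, hpq⟩ := h hχu hχ r
    refine ⟨q, hq, ?_⟩
    filter_upwards [hpq, hχe] with y h1 h2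
    rw [← h1, Function.comp_apply, h2, id]

/-- The product diffeology. -/
@[reducible]
def prodD {X Y : Type} (d : DiffeologicalSpace X) (e : DiffeologicalSpace Y) :
    DiffeologicalSpace (X × Y) :=
  inducedD d Prod.fst ⊓ inducedD e Prod.snd

/-- The standard smooth structure of a (finite-dimensional) complex vector space: a map into it is
smooth iff its composite with every linear functional is a smooth complex function. -/
@[reducible]
def vecD (W : Type) [AddCommGroup W] [Module ℂ W] : DiffeologicalSpace W where
  plots k := {p | ∀ φ : W →ₗ[ℂ] ℂ, ContDiff ℝ ∞ fun r => φ (p r)}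
  constant_plots x φ := contDiff_const
  plot_reparam hp hf φ := (hp φ).comp hf
  locality := by
    intro k p hp φ
    rw [contDiff_iff_contDiffAt]
    intro r
    obtain ⟨u, hu, hr, h⟩ := hp r
    obtain ⟨χ, hχ, hχu, hχe⟩ := exists_retract r (hu.mem_nhds hr)
    refine (h hχu hχ φ).contDiffAt.congr_of_eventuallyEq ?_
    filter_upwards [hχe] with y hy
    simp [hy]

/-! ### Hermitian lines -/

/-- A Hermitian line: a one-dimensional complex vector space `V` with a Hermitian inner product.  The
inner product is recorded by its set `U` of unit vectors. -/
structure HLine where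
  V : Type
  [grp : AddCommGroup V]
  [mod : Module ℂ V]
  U : Set V
  line : ∃ e : V ≃ₗ[ℂ] ℂ, ∀ v, v ∈ U ↔ ‖e v‖ = 1

attribute [instance] HLine.grp HLine.mod

instance : CoeSort HLine Type := ⟨HLine.V⟩

/-- Isometric isomorphisms of Hermitian lines. -/
structure HIso (A B : HLine) where
  e : A ≃ₗ[ℂ] B
  unit : ∀ a, e a ∈ B.U ↔ a ∈ A.U

namespace HLine

/-- An auxiliary choice of coordinate on a Hermitian line. -/
def chart (A : HLine) : A ≃ₗ[ℂ] ℂ := A.line.choose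

theorem mem_U (A : HLine) (v : A) : v ∈ A.U ↔ ‖A.chart v‖ = 1 := A.line.choose_spec v

/-- An auxiliary choice of unit vector. -/
def u₀ (A : HLine) : A := A.chart.symm 1

theorem u₀_mem (A : HLine) : A.u₀ ∈ A.U := by simp [mem_U, u₀]

theorem ne_zero {A : HLine} {v : A} (h : v ∈ A.U) : v ≠ 0 := by
  rintro rfl; simp [mem_U] at h

/-- The coordinate of `v` with respect to the nonzero vector `u`, as a linear functional of `v`;
`v = coord u v • u`. -/
def coord (A : HLine) (u : A) : A →ₗ[ℂ] ℂ := (A.chart u)⁻¹ • A.chart.toLinearMap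

theorem chart_ne {A : HLine} {u : A} (h : u ≠ 0) : A.chart u ≠ 0 := by simpa using h

theorem coord_smul {A : HLine} {u : A} (h : u ≠ 0) (v : A) : A.coord u v • u = v := by
  apply A.chart.injective
  simp [coord, mul_comm, chart_ne h]

@[simp] theorem coord_self {A : HLine} {u : A} (h : u ≠ 0) : A.coord u u = 1 := by
  simp [coord, chart_ne h]

theorem exists_smul {A : HLine} {u : A} (h : u ≠ 0) (v : A) : ∃ c : ℂ, v = c • u :=
  ⟨_, (coord_smul h v).symm⟩

theorem smul_mem_U {A : HLine} {u : A} (h : u ∈ A.U) (c : ℂ) : c • u ∈ A.U ↔ ‖c‖ = 1 := by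
  rw [mem_U] at *; simp [h]

theorem u₀_ne (A : HLine) : A.u₀ ≠ 0 := ne_zero A.u₀_mem

/-- Two linear maps out of a line agree if they agree on a nonzero vector. -/
theorem hom_ext {A : HLine} {B : Type} [AddCommGroup B] [Module ℂ B] {u : A} (h : u ≠ 0)
    {f g : A →ₗ[ℂ] B} (hfg : f u = g u) : f = g := by
  ext v; obtain ⟨c, rfl⟩ := exists_smul h v; simp [hfg]

/-- To prove that a subset of a vector space spanned by `u` defines a Hermitian line. -/
theorem line_of_gen {V : Type} [AddCommGroup V] [Module ℂ V] {U : Set V} {u : V} (hu : u ≠ 0)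
    (hs : ∀ v, ∃ c : ℂ, v = c • u) (hU : ∀ c : ℂ, c • u ∈ U ↔ ‖c‖ = 1) :
    ∃ e : V ≃ₗ[ℂ] ℂ, ∀ v, v ∈ U ↔ ‖e v‖ = 1 := by
  let f : ℂ →ₗ[ℂ] V := LinearMap.toSpanSingleton ℂ V u
  have hf : Function.Bijective f :=
    ⟨fun a b h => by
      have : (a - b) • u = 0 := by rw [sub_smul, sub_eq_zero]; exact h
      simpa [hu, sub_eq_zero] using this, fun v => by
      obtain ⟨c, rfl⟩ := hs v; exact ⟨c, rfl⟩⟩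
  refine ⟨(LinearEquiv.ofBijective f hf).symm, fun v => ?_⟩
  obtain ⟨c, rfl⟩ := hs v
  have : (LinearEquiv.ofBijective f hf).symm (c • u) = c := by
    rw [LinearEquiv.symm_apply_eq]; rfl
  rw [this, hU]

/-- The trivial Hermitian line `ℂ`. -/
def triv : HLine where
  V := ℂ
  U := {z | ‖z‖ = 1}
  line := ⟨LinearEquiv.refl ℂ ℂ, fun _ => Iff.rfl⟩

/-- The Hermitian line of linear maps between two Hermitian lines. -/
def hom (A B : HLine) : HLine where
  V := A →ₗ[ℂ] B
  U := {f | ∀ a ∈ A.U, f a ∈ B.U}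
  line := by
    refine line_of_gen (u := (A.coord A.u₀).smulRight B.u₀) ?_ (fun f => ?_) (fun c => ?_)
    · intro h
      have := congrArg (fun f => f A.u₀) h
      simp [A.u₀_ne, B.u₀_ne] at this
    · obtain ⟨c, hc⟩ := exists_smul B.u₀_ne (f A.u₀)
      exact ⟨c, hom_ext A.u₀_ne (by simp [A.u₀_ne, hc])⟩
    · constructor
      · intro h
        have := h _ A.u₀_mem
        simpa [A.u₀_ne, smul_mem_U B.u₀_mem] using this
      · intro h a ha
        obtain ⟨d, rfl⟩ := exists_smul A.u₀_ne a
        rw [smul_mem_U A.u₀_mem] at ha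
        simp [A.u₀_ne, smul_smul, smul_mem_U B.u₀_mem, h, ha]

/-- The dual Hermitian line. -/
abbrev dual (A : HLine) : HLine := A.hom triv

/-- The dual vector `u⁻¹` of a nonzero vector `u`, with `u⁻¹(u) = 1`. -/
def inv (A : HLine) (u : A) : A.dual := A.coord u

/-- The tensor product of a finite family of Hermitian lines. -/
def tensor {ι : Type} [Fintype ι] (A : ι → HLine) : HLine where
  V := ⨂[ℂ] i, A i
  U := {w | ∃ c : ℂ, ‖c‖ = 1 ∧ ∃ v : ∀ i, A i, (∀ i, v i ∈ (A i).U) ∧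
    w = c • PiTensorProduct.tprod ℂ v}
  line := by
    let φ : (⨂[ℂ] i, A i) →ₗ[ℂ] ℂ := PiTensorProduct.lift
      ((MultilinearMap.mkPiAlgebra ℂ ι ℂ).compLinearMap fun i => (A i).chart.toLinearMap)
    have hφ (v : ∀ i, A i) : φ (PiTensorProduct.tprod ℂ v) = ∏ i, (A i).chart (v i) := by
      simp [φ]
    have hv (v : ∀ i, A i) : PiTensorProduct.tprod ℂ v =
        (∏ i, (A i).coord (A i).u₀ (v i)) • PiTensorProduct.tprod ℂ fun i => (A i).u₀ := by
      rw [← MultilinearMap.map_smul_univ]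
      congr 1; funext i; exact (coord_smul (A i).u₀_ne _).symm
    have hne : PiTensorProduct.tprod ℂ (fun i => (A i).u₀) ≠ 0 := by
      intro h
      have := hφ fun i => (A i).u₀
      simp only [h, map_zero] at this
      simp [u₀] at this
    refine line_of_gen hne (fun w => ?_) (fun c => ⟨?_, fun h => ⟨c, h, _, fun i => (A i).u₀_mem, rfl⟩⟩)
    · induction w using PiTensorProduct.induction_on with
      | smul_tprod r v => exact ⟨r * _, by rw [hv, smul_smul]⟩
      | add x y hx hy =>
        obtain ⟨a, rfl⟩ := hx; obtain ⟨b, rfl⟩ := hy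
        exact ⟨a + b, (add_smul _ _ _).symm⟩
    · rintro ⟨d, hd, v, hv', h⟩
      have := congrArg (fun w => ‖φ w‖) h
      simp only [map_smul, hφ, norm_smul, norm_prod, hd] at this
      simpa [(mem_U _ _).1 (hv' _), (mem_U _ _).1 (A _).u₀_mem] using this

theorem tprod_mem_U {ι : Type} [Fintype ι] {A : ι → HLine} {v : ∀ i, A i}
    (h : ∀ i, v i ∈ (A i).U) : (PiTensorProduct.tprod ℂ v : tensor A) ∈ (tensor A).U :=
  ⟨1, by simp, v, h, by simp⟩

theorem exists_unit_smul {A : HLine} {u : A} (h : u ≠ 0) :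
    ∃ c : ℂ, c ≠ 0 ∧ ∃ v ∈ A.U, u = c • v := by
  obtain ⟨c, hc⟩ := exists_smul A.u₀_ne u
  exact ⟨c, by rintro rfl; simp at hc; exact h hc, _, A.u₀_mem, hc⟩

theorem tprod_ne_zero {ι : Type} [Fintype ι] {A : ι → HLine} {v : ∀ i, A i}
    (h : ∀ i, v i ≠ 0) : (PiTensorProduct.tprod ℂ v : tensor A) ≠ 0 := by
  choose c hc w hw hv using fun i => exists_unit_smul (h i)
  obtain rfl : v = fun i => c i • w i := funext hv
  erw [MultilinearMap.map_smul_univ]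
  exact smul_ne_zero (Finset.prod_ne_zero_iff.2 fun i _ => hc i) (ne_zero (tprod_mem_U hw))

/-- The integer powers of a Hermitian line: `Lᵏ = L ⊗ ⋯ ⊗ L` for `k ≥ 0` (so `L⁰ = ℂ`) and
`L⁻ᵏ = (L*)ᵏ`. -/
def pow (A : HLine) : ℤ → HLine
  | .ofNat k => tensor fun _ : Fin k => A
  | .negSucc k => tensor fun _ : Fin (k + 1) => A.dual

/-- The power `uᵏ ∈ Lᵏ` of a nonzero vector `u ∈ L`: `u ⊗ ⋯ ⊗ u` for `k ≥ 0`, and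
`u⁻¹ ⊗ ⋯ ⊗ u⁻¹` with the dual vector `u⁻¹ ∈ L*` for `k < 0`. -/
def gen {A : HLine} (u : A) : ∀ k : ℤ, A.pow k
  | .ofNat k => PiTensorProduct.tprod ℂ fun _ : Fin k => u
  | .negSucc k => PiTensorProduct.tprod ℂ fun _ : Fin (k + 1) => A.inv u

theorem inv_mem_U {A : HLine} {u : A} (h : u ∈ A.U) : A.inv u ∈ A.dual.U := by
  intro a ha
  obtain ⟨c, rfl⟩ := exists_smul (ne_zero h) a
  rw [smul_mem_U h] at ha
  show ‖A.coord u (c • u)‖ = 1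
  simp [coord_self (ne_zero h), ha]

theorem inv_ne {A : HLine} {u : A} (h : u ≠ 0) : A.inv u ≠ 0 := by
  intro h0
  have : A.coord u u = 0 := congrArg (fun f : A →ₗ[ℂ] ℂ => f u) h0
  rw [coord_self h] at this
  exact one_ne_zero this

theorem gen_mem_U {A : HLine} {u : A} (h : u ∈ A.U) (k : ℤ) : gen u k ∈ (A.pow k).U := by
  cases k with
  | ofNat k => exact tprod_mem_U fun _ => h
  | negSucc k => exact tprod_mem_U fun _ => inv_mem_U h

theorem gen_ne {A : HLine} {u : A} (h : u ≠ 0) (k : ℤ) : gen u k ≠ 0 := by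
  cases k with
  | ofNat k => exact tprod_ne_zero fun _ => h
  | negSucc k => exact tprod_ne_zero fun _ => inv_ne h

theorem inv_smul {A : HLine} {u : A} (c : ℂ) : A.inv (c • u) = c⁻¹ • A.inv u := by
  refine LinearMap.ext fun v => ?_
  show (A.chart (c • u))⁻¹ * A.chart v = c⁻¹ * ((A.chart u)⁻¹ * A.chart v)
  rw [map_smul, smul_eq_mul, mul_inv, mul_assoc]

theorem gen_smul {A : HLine} (u : A) (c : ℂ) (k : ℤ) :
    gen (c • u) k = c ^ k • gen u k := by
  cases k with
  | ofNat k =>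
    have := (PiTensorProduct.tprod ℂ (s := fun _ : Fin k => (A : Type))).map_smul_univ
      (fun _ => c) (fun _ => u)
    refine this.trans ?_
    simp only [Finset.prod_const, Finset.card_univ, Fintype.card_fin, Int.ofNat_eq_natCast,
      zpow_natCast]
    rfl
  | negSucc k =>
    have := (PiTensorProduct.tprod ℂ (s := fun _ : Fin (k + 1) => (A.dual : Type))).map_smul_univ
      (fun _ => c⁻¹) (fun _ => A.inv u)
    simp only [gen, inv_smul, zpow_negSucc]
    refine this.trans ?_
    simp only [Finset.prod_const, Finset.card_univ, Fintype.card_fin, inv_pow]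
    rfl

/-- The canonical multiplication `Lᵃ ⊗ Lᵇ → Lᶜ`, `c = a + b` (tensor multiplication and contraction
of `L` with `L*`): the bilinear map with `uᵃ ⊗ uᵇ ↦ uᵃ⁺ᵇ` for all `u ≠ 0`, see `powMul_gen`. -/
def powMul (A : HLine) (a b c : ℤ) : A.pow a →ₗ[ℂ] A.pow b →ₗ[ℂ] A.pow c :=
  ((A.pow a).coord (gen A.u₀ a)).smulRight
    (((A.pow b).coord (gen A.u₀ b)).smulRight (gen A.u₀ c))

theorem powMul_gen {A : HLine} {u : A} (h : u ≠ 0) {a b c : ℤ} (hc : c = a + b) :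
    powMul A a b c (gen u a) (gen u b) = gen u c := by
  obtain ⟨d, rfl⟩ := exists_smul A.u₀_ne u
  have hd : d ≠ 0 := by rintro rfl; simp at h
  simp [gen_smul, powMul, coord_self (gen_ne A.u₀_ne _), smul_smul, hc, zpow_add₀ hd, mul_comm]

/-- If all the bilinear maps `mᵢ : Aᵢ ⊗ Bᵢ → Cᵢ` are given, the tensor product bilinear map. -/
def tensorMul {ι : Type} [Fintype ι] {A B C : ι → HLine}
    (m : ∀ i, A i →ₗ[ℂ] B i →ₗ[ℂ] C i) :
    tensor A →ₗ[ℂ] tensor B →ₗ[ℂ] tensor C :=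
  PiTensorProduct.map₂ m

end HLine

open HLine

namespace HIso

variable {A B C : HLine}

theorem ne_zero (f : HIso A B) {u : A} (h : u ≠ 0) : f.e u ≠ 0 := by simpa using h

theorem unit_of_gen (e : A ≃ₗ[ℂ] B) {u : A} (hu : u ∈ A.U) (he : e u ∈ B.U) (a : A) :
    e a ∈ B.U ↔ a ∈ A.U := by
  obtain ⟨c, rfl⟩ := exists_smul (HLine.ne_zero hu) a
  rw [map_smul, smul_mem_U he, smul_mem_U hu]

/-- Composition. -/
def trans (f : HIso A B) (g : HIso B C) : HIso A C :=
  ⟨f.e.trans g.e, fun a => (g.unit _).trans (f.unit a)⟩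

/-- Inverse. -/
def symm (f : HIso A B) : HIso B A :=
  ⟨f.e.symm, fun b => by rw [← f.unit, LinearEquiv.apply_symm_apply]⟩

/-- The isomorphism of dual lines induced by an isomorphism of lines. -/
def dual (f : HIso A B) : HIso A.dual B.dual :=
  ⟨f.e.symm.dualMap, fun φ => by
    constructor
    · intro h a ha
      have : (show A →ₗ[ℂ] ℂ from φ) (f.e.symm (f.e a)) ∈ triv.U := h _ ((f.unit a).2 ha)
      rwa [LinearEquiv.symm_apply_apply] at this
    · intro h b hb
      exact h _ ((f.symm.unit b).2 hb)⟩

/-- The isomorphism of tensor products induced by isomorphisms of lines. -/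
def tensor {ι : Type} [Fintype ι] {A B : ι → HLine} (f : ∀ i, HIso (A i) (B i)) :
    HIso (HLine.tensor A) (HLine.tensor B) :=
  ⟨PiTensorProduct.congr fun i => (f i).e,
    unit_of_gen (u := PiTensorProduct.tprod ℂ fun i => (A i).u₀) _
      (tprod_mem_U fun i => (A i).u₀_mem) (by
        erw [PiTensorProduct.congr_tprod]
        exact tprod_mem_U fun i => ((f i).unit _).2 (A i).u₀_mem)⟩

theorem tensor_tprod {ι : Type} [Fintype ι] {A B : ι → HLine} (f : ∀ i, HIso (A i) (B i))
    (v : ∀ i, A i) : (tensor f).e (PiTensorProduct.tprod ℂ v) =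
      PiTensorProduct.tprod ℂ fun i => (f i).e (v i) :=
  PiTensorProduct.congr_tprod _ _

/-- The isomorphism of powers induced by an isomorphism of lines. -/
def pow (f : HIso A B) : ∀ k : ℤ, HIso (A.pow k) (B.pow k)
  | .ofNat k => tensor fun _ : Fin k => f
  | .negSucc k => tensor fun _ : Fin (k + 1) => f.dual

theorem dual_inv (f : HIso A B) {u : A} (h : u ≠ 0) : f.dual.e (A.inv u) = B.inv (f.e u) := by
  refine hom_ext (u := f.e u) (f.ne_zero h) ?_
  show A.coord u (f.e.symm (f.e u)) = B.coord (f.e u) (f.e u)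
  simp [coord_self h, coord_self (f.ne_zero h)]

theorem pow_gen (f : HIso A B) {u : A} (h : u ≠ 0) (k : ℤ) :
    (f.pow k).e (gen u k) = gen (f.e u) k := by
  cases k with
  | ofNat k => exact tensor_tprod _ _
  | negSucc k =>
    refine (tensor_tprod _ _).trans ?_
    simp only [dual_inv f h]; rfl

end HIso

/-! ### Associated line bundles over a homogeneous space `G/T` -/

/-- A one-dimensional unitary representation of a group. -/
structure TLine (T : Type) [Group T] where
  L : HLine
  act : Representation ℂ T L
  unit : ∀ t v, v ∈ L.U → act t v ∈ L.U

section Assoc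

variable {G : Type} [Group G] {T : Subgroup G} (E : TLine T)

/-- The relation `(v, g) ∼ (t v, g t⁻¹)`, `t ∈ T`, on `E × G`. -/
def assocSetoid : Setoid (E.L × G) where
  r a b := ∃ t : T, b = (E.act t a.1, a.2 * (t : G)⁻¹)
  iseqv :=
    { refl := fun a => ⟨1, by simp⟩
      symm := by
        rintro ⟨v, g⟩ _ ⟨t, rfl⟩
        refine ⟨t⁻¹, ?_⟩
        simp
      trans := by
        rintro ⟨v, g⟩ _ _ ⟨t, rfl⟩ ⟨s, rfl⟩
        exact ⟨s * t, by simp [mul_assoc]⟩ }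

/-- The total space `E ×_T G` of the associated line bundle. -/
def Assoc : Type := Quotient (assocSetoid E)

/-- The class `[v, g]`. -/
def Assoc.mk (v : E.L) (g : G) : Assoc E := Quotient.mk (assocSetoid E) (v, g)

theorem Assoc.mk_eq (v : E.L) (g : G) (t : T) :
    Assoc.mk E v g = Assoc.mk E (E.act t v) (g * (t : G)⁻¹) :=
  Quotient.sound ⟨t, rfl⟩

/-- The bundle projection `[v, g] ↦ gT`. -/
def Assoc.proj : Assoc E → G ⧸ T :=
  Quotient.lift (fun a => (a.2 : G ⧸ T)) (by
    rintro ⟨v, g⟩ _ ⟨t, rfl⟩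
    exact (QuotientGroup.mk_mul_of_mem g (inv_mem t.2)).symm)

/-- For `g` in the coset `x`, the bijection `v ↦ [v, g]` of `E` with the fibre over `x`. -/
def assocEquiv {x : G ⧸ T} (g : G) (hg : (g : G ⧸ T) = x) :
    E.L ≃ {q : Assoc E // Assoc.proj E q = x} :=
  Equiv.ofBijective (fun v => ⟨Assoc.mk E v g, hg⟩) (by
    constructor
    · intro v w h
      obtain ⟨t, ht⟩ := Quotient.exact (congrArg Subtype.val h)
      have h1 : t = 1 := by
        have := (Prod.ext_iff.1 ht).2
        simpa using this
      have := (Prod.ext_iff.1 ht).1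
      simpa [h1] using this.symm
    · rintro ⟨q, hq⟩
      induction q using Quotient.inductionOn with
      | _ a =>
        obtain ⟨v, g'⟩ := a
        have : (g : G ⧸ T) = g' := hg.trans hq.symm
        have hm : g⁻¹ * g' ∈ T := QuotientGroup.eq.1 this
        refine ⟨E.act ⟨_, hm⟩ v, Subtype.ext ?_⟩
        have := Assoc.mk_eq E v g' ⟨_, hm⟩
        simp only [mul_inv_rev, inv_inv, mul_inv_cancel_left] at this
        exact this.symm)

/-- The fibre of `E ×_T G` over `x ∈ G/T`, with the vector space structure and Hermitian inner product
for which all the maps `v ↦ [v, g]`, `g ∈ x`, are isometric isomorphisms (see `assocFrame`). -/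
def assocFib (x : G ⧸ T) : HLine where
  V := {q : Assoc E // Assoc.proj E q = x}
  grp := (assocEquiv E x.out x.out_eq').symm.addCommGroup
  mod := letI := (assocEquiv E x.out x.out_eq').symm.addCommGroup
    (assocEquiv E x.out x.out_eq').symm.module ℂ
  U := {q | ∃ v ∈ E.L.U, ∃ g : G, q.1 = Assoc.mk E v g}
  line := by
    let _ := (assocEquiv E x.out x.out_eq').symm.addCommGroup
    let _ := (assocEquiv E x.out x.out_eq').symm.module ℂ
    refine ⟨((assocEquiv E x.out x.out_eq').symm.linearEquiv ℂ).trans E.L.chart, fun q => ?_⟩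
    show _ ↔ ‖E.L.chart ((assocEquiv E x.out x.out_eq').symm q)‖ = 1
    rw [← mem_U]
    obtain ⟨v, rfl⟩ := (assocEquiv E x.out x.out_eq').surjective q
    rw [Equiv.symm_apply_apply]
    constructor
    · rintro ⟨w, hw, g, h⟩
      obtain ⟨t, ht⟩ := Quotient.exact h.symm
      have : v = E.act t w := (Prod.ext_iff.1 ht).1
      exact this ▸ E.unit t w hw
    · intro h
      exact ⟨v, h, _, rfl⟩

theorem assocFib_ext {x : G ⧸ T} {p q : assocFib E x} (h : p.1 = q.1) : p = q := Subtype.ext h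

theorem act_unit (t : T) (v : E.L) : E.act t v ∈ E.L.U ↔ v ∈ E.L.U :=
  ⟨fun h => by
    simpa using E.unit t⁻¹ _ h, E.unit t v⟩

/-- The isometric isomorphism `v ↦ [v, g]` of `E` with the fibre over `x = gT`. -/
def assocFrame {x : G ⧸ T} (g : G) (hg : (g : G ⧸ T) = x) : HIso E.L (assocFib E x) := by
  have key : ∃ t : T, ∀ v, Assoc.mk E v g = Assoc.mk E (E.act t v) x.out := by
    have h0 : ((x.out : G) : G ⧸ T) = x := x.out_eq'
    have hm : (x.out : G)⁻¹ * g ∈ T := QuotientGroup.eq.1 (h0.trans hg.symm)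
    refine ⟨⟨_, hm⟩, fun v => ?_⟩
    have := Assoc.mk_eq E v g ⟨_, hm⟩
    simpa only [mul_inv_rev, inv_inv, mul_inv_cancel_left] using this
  have key2 : ∃ t : T, ∀ v, assocEquiv E g hg v =
      assocEquiv E x.out x.out_eq' (E.act t v) :=
    key.imp fun t h v => Subtype.ext (h v)
  letI := (assocEquiv E x.out x.out_eq').symm.addCommGroup
  letI := (assocEquiv E x.out x.out_eq').symm.module ℂ
  refine ⟨{ assocEquiv E g hg with map_add' := ?_, map_smul' := ?_ }, ?_⟩
  · intro v w
    obtain ⟨t, ht⟩ := key2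
    show assocEquiv E g hg (v + w) = assocEquiv E g hg v + assocEquiv E g hg w
    rw [ht, ht, ht, map_add]
    exact map_add (((assocEquiv E x.out x.out_eq').symm.linearEquiv ℂ).symm) _ _
  · intro c v
    obtain ⟨t, ht⟩ := key2
    show assocEquiv E g hg (c • v) = c • assocEquiv E g hg v
    rw [ht, ht, map_smul]
    exact map_smul (((assocEquiv E x.out x.out_eq').symm.linearEquiv ℂ).symm) _ _
  · intro v
    constructor
    · rintro ⟨w, hw, g', h⟩
      have h : Assoc.mk E v g = Assoc.mk E w g' := h
      obtain ⟨t, ht⟩ := Quotient.exact h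
      have : w = E.act t v := (Prod.ext_iff.1 ht).1
      rw [this, act_unit] at hw
      exact hw
    · intro h
      exact ⟨v, h, g, rfl⟩

theorem assocFrame_val {x : G ⧸ T} (g : G) (hg : (g : G ⧸ T) = x) (v : E.L) :
    ((assocFrame E g hg).e v).1 = Assoc.mk E v g := rfl

/-- `[v, g t] = [t v, g]`. -/
theorem assocFrame_mul {x : G ⧸ T} (g : G) (hg : (g : G ⧸ T) = x) (t : T)
    (hgt : ((g * t : G) : G ⧸ T) = x) (v : E.L) :
    (assocFrame E (g * t) hgt).e v = (assocFrame E g hg).e (E.act t v) := by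
  apply assocFib_ext
  rw [assocFrame_val, assocFrame_val, Assoc.mk_eq E v (g * t) t, mul_inv_cancel_right]

/-- The left action `h • [v, g] = [v, h g]` of `G` on the associated bundle. -/
def assocAct {x : G ⧸ T} (h : G) : HIso (assocFib E x) (assocFib E (h • x)) :=
  (assocFrame E x.out x.out_eq').symm.trans (assocFrame E (h * x.out) (by
    conv_rhs => rw [← x.out_eq']
    rfl))

theorem assocAct_frame {x : G ⧸ T} (h g : G) (hg : (g : G ⧸ T) = x)
    (hg' : ((h * g : G) : G ⧸ T) = h • x) (v : E.L) :
    (assocAct E h).e ((assocFrame E g hg).e v) = (assocFrame E (h * g) hg').e v := by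
  have h0 : ((x.out : G) : G ⧸ T) = x := x.out_eq'
  have hm : (x.out : G)⁻¹ * g ∈ T := QuotientGroup.eq.1 (h0.trans hg.symm)
  obtain ⟨t, rfl⟩ : ∃ t : T, g = x.out * t := ⟨⟨_, hm⟩, by simp⟩
  rw [assocFrame_mul E x.out x.out_eq' t]
  show (assocFrame E (h * x.out) _).e ((assocFrame E x.out _).e.symm _) = _
  rw [LinearEquiv.symm_apply_apply]
  apply assocFib_ext
  rw [assocFrame_val, assocFrame_val, Assoc.mk_eq E v _ t, ← mul_assoc, mul_inv_cancel_right]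

variable {E} {E' E'' : TLine T}

/-- The fibrewise bilinear map `([v, g], [w, g]) ↦ [m(v, w), g]` of associated bundles induced by a
`T`-equivariant bilinear map `m`. -/
def assocMul (m : E.L →ₗ[ℂ] E'.L →ₗ[ℂ] E''.L) (x : G ⧸ T) :
    assocFib E x →ₗ[ℂ] assocFib E' x →ₗ[ℂ] assocFib E'' x :=
  (m.compl₁₂ (assocFrame E x.out x.out_eq').e.symm.toLinearMap
    (assocFrame E' x.out x.out_eq').e.symm.toLinearMap).compr₂
    (assocFrame E'' x.out x.out_eq').e.toLinearMap

theorem assocMul_frame (m : E.L →ₗ[ℂ] E'.L →ₗ[ℂ] E''.L)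
    (hm : ∀ t v w, m (E.act t v) (E'.act t w) = E''.act t (m v w))
    {x : G ⧸ T} (g : G) (hg : (g : G ⧸ T) = x) (v : E.L) (w : E'.L) :
    assocMul m x ((assocFrame E g hg).e v) ((assocFrame E' g hg).e w) =
      (assocFrame E'' g hg).e (m v w) := by
  have h0 : ((x.out : G) : G ⧸ T) = x := x.out_eq'
  have hmm : (x.out : G)⁻¹ * g ∈ T := QuotientGroup.eq.1 (h0.trans hg.symm)
  obtain ⟨t, rfl⟩ : ∃ t : T, g = x.out * t := ⟨⟨_, hmm⟩, by simp⟩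
  rw [assocFrame_mul E x.out x.out_eq' t, assocFrame_mul E' x.out x.out_eq' t,
    assocFrame_mul E'' x.out x.out_eq' t]
  simp [assocMul, hm]

end Assoc

/-! ### The special unitary group, its maximal torus, and eigenspaces -/

variable {n : ℕ}

/-- The group `SU(n)`. -/
abbrev SU (n : ℕ) : Type := Matrix.specialUnitaryGroup (Fin n) ℂ

/-- The maximal torus `T` of diagonal matrices in `SU(n)`. -/
def T (n : ℕ) : Subgroup (SU n) where
  carrier := {g | g.1.IsDiag}
  mul_mem' := by
    intro a b ha hb
    show (a.1 * b.1).IsDiag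
    rw [← (Matrix.isDiag_iff_diagonal_diag _).1 ha, ← (Matrix.isDiag_iff_diagonal_diag _).1 hb,
      Matrix.diagonal_mul_diagonal]
    exact Matrix.isDiag_diagonal _
  one_mem' := Matrix.isDiag_one
  inv_mem' := by
    intro a ha
    exact Matrix.IsDiag.conjTranspose ha

instance : DiffeologicalSpace (SU n) := inducedD (vecD (Matrix (Fin n) (Fin n) ℂ)) Subtype.val

instance : DiffeologicalSpace (T n) := inducedD inferInstance (Subtype.val : T n → SU n)

instance : DiffeologicalSpace (SU n ⧸ T n) :=
  coinducedD inferInstance (fun g : SU n => (g : SU n ⧸ T n)) QuotientGroup.mk_surjective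

/-- The `i`-th diagonal entry `pᵢ(t)` of `t ∈ T`. -/
def p (i : Fin n) (t : T n) : ℂ := t.1.1 i i

/-- The angle `θ ∈ (0, 2π]` with `z = e^{iθ}`, for `z` on the unit circle.  The anti-clockwise order on
`U(1) \ {1}` is the order of these angles. -/
def ang (z : ℂ) : ℝ := Complex.arg (-z) + Real.pi

/-- `ℂⁿ`. -/
abbrev V (n : ℕ) : Type := EuclideanSpace ℂ (Fin n)

/-- The exterior algebra of `ℂⁿ`. -/
abbrev Ext (n : ℕ) : Type := ExteriorAlgebra ℂ (V n)

/-- The sum of the eigenspaces of a matrix for the eigenvalues in a set `S`. -/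
def eigSum (g : Matrix (Fin n) (Fin n) ℂ) (S : Set ℂ) : Submodule ℂ (V n) :=
  ⨆ l ∈ S, Module.End.eigenspace (Matrix.toEuclideanLin g) l

/-- The sum `L_{(z₁, z₂, g)}` of the eigenspaces of `g` for the eigenvalues `λ` with `z₁ > λ > z₂`
in the anti-clockwise order on `U(1) \ {1}` (it is zero if there are none, e.g. if `z₁ ≤ z₂`). -/
def L (g : Matrix (Fin n) (Fin n) ℂ) (z₁ z₂ : ℂ) : Submodule ℂ (V n) :=
  eigSum g {l | ang z₂ < ang l ∧ ang l < ang z₁}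

/-- The standard basis `e_I = e_{i₁} ∧ ⋯ ∧ e_{iₖ}`, `i₁ < ⋯ < iₖ`, of the exterior algebra of `ℂⁿ`. -/
def eB (n : ℕ) : Module.Basis (Finset (Fin n)) ℂ (Ext n) :=
  (EuclideanSpace.basisFun (Fin n) ℂ).toBasis.ExteriorAlgebra

/-- The inclusion of `⋀ᵏ A`, `k = dim A`, in the exterior algebra of `ℂⁿ`. -/
def detIncl (A : Submodule ℂ (V n)) :
    ⋀[ℂ]^(Module.finrank ℂ A) A →ₗ[ℂ] Ext n :=
  (ExteriorAlgebra.map A.subtype).toLinearMap ∘ₗ Submodule.subtype _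

theorem detIncl_injective (A : Submodule ℂ (V n)) : Function.Injective (detIncl A) := by
  obtain ⟨r, hr⟩ := A.subtype.exists_leftInverse_of_injective (by simp)
  have h : Function.LeftInverse (ExteriorAlgebra.map r) (ExteriorAlgebra.map A.subtype) := by
    rw [ExteriorAlgebra.leftInverse_map_iff]
    exact fun x => LinearMap.congr_fun hr x
  exact h.injective.comp Subtype.val_injective

/-- The squared norm of the Hermitian inner product on the exterior algebra of `ℂⁿ` induced by the
standard one of `ℂⁿ`, i.e. the one for which the `e_I` are orthonormal. -/
def extNormSq (w : Ext n) : ℝ := ∑ I, ‖(eB n).repr w I‖ ^ 2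

theorem extNormSq_smul (c : ℂ) (w : Ext n) : extNormSq (c • w) = ‖c‖ ^ 2 * extNormSq w := by
  simp [extNormSq, mul_pow, Finset.mul_sum]

theorem extNormSq_pos {w : Ext n} (h : w ≠ 0) : 0 < extNormSq w := by
  have h' : (eB n).repr w ≠ 0 := by simpa using h
  obtain ⟨I, hI⟩ := Finsupp.ne_iff.1 h'
  refine Finset.sum_pos' (fun _ _ => by positivity) ⟨I, Finset.mem_univ _, ?_⟩
  have : 0 < ‖(eB n).repr w I‖ := norm_pos_iff.2 hI
  positivity

/-- The determinant line `det A = ⋀^{dim A} A` of a subspace `A ⊆ ℂⁿ`, as a subspace of the exterior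
algebra of `ℂⁿ`, with the Hermitian inner product induced by the standard one. -/
def detLine (A : Submodule ℂ (V n)) : HLine where
  V := LinearMap.range (detIncl A)
  U := {w | extNormSq (w : Ext n) = 1}
  line := by
    have h1 : Module.finrank ℂ (LinearMap.range (detIncl A)) = 1 := by
      rw [LinearMap.finrank_range_of_inj (detIncl_injective A), exteriorPower.finrank_eq,
        Nat.choose_self]
    obtain ⟨u, hu, hs⟩ := finrank_eq_one_iff'.1 h1
    have hp : 0 < extNormSq (u : Ext n) := extNormSq_pos (by simpa using hu)
    set d : ℂ := (((Real.sqrt (extNormSq (u : Ext n)))⁻¹ : ℝ) : ℂ) with hd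
    have hd0 : d ≠ 0 := by
      rw [hd]; exact_mod_cast inv_ne_zero (Real.sqrt_pos.2 hp).ne'
    refine line_of_gen (u := d • u) (smul_ne_zero hd0 hu) (fun v => ?_) (fun c => ?_)
    · obtain ⟨c, rfl⟩ := hs v
      exact ⟨c * d⁻¹, by rw [smul_smul, mul_assoc, inv_mul_cancel₀ hd0, mul_one]⟩
    · show extNormSq (c • d • (u : Ext n)) = 1 ↔ _
      have : extNormSq (d • (u : Ext n)) = 1 := by
        rw [extNormSq_smul, hd, Complex.norm_real, Real.norm_of_nonneg (by positivity), inv_pow,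
          Real.sq_sqrt hp.le, inv_mul_cancel₀ hp.ne']
      rw [extNormSq_smul, this, mul_one, pow_eq_one_iff_of_nonneg (norm_nonneg c) two_ne_zero]

/-- The fibre `(P_b)_{(z₁, z₂, g)}` of the basic bundle gerbe.  The line
`Hom(det L_{(z₂, z₁, g)}, det L_{(z₁, z₂, g)})` is
* `det L_{(z₁, z₂, g)}` if there are eigenvalues of `g` between `z₁ > z₂` (then `L_{(z₂, z₁, g)} = 0`);
* `ℂ` if there are no eigenvalues of `g` between `z₁` and `z₂` (then both sums are zero);
* `(det L_{(z₂, z₁, g)})*` if there are eigenvalues between `z₁ < z₂` (then `L_{(z₁, z₂, g)} = 0`),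
since `det 0 = ℂ`. -/
def Pb (g : Matrix (Fin n) (Fin n) ℂ) (z₁ z₂ : ℂ) : HLine :=
  (detLine (L g z₂ z₁)).hom (detLine (L g z₁ z₂))

/-! Eigenspaces and determinants for diagonal matrices. -/

/-- The coordinate subspace spanned by the `eₖ`, `k ∈ I`. -/
def coordSub (I : Finset (Fin n)) : Submodule ℂ (V n) where
  carrier := {v | ∀ k, k ∉ I → v k = 0}
  add_mem' ha hb k hk := by simp [ha k hk, hb k hk]
  zero_mem' k hk := by simp
  smul_mem' c v hv k hk := by simp [hv k hk]

theorem torus_eq (t : T n) : t.1.1 = Matrix.diagonal fun i => p i t :=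
  ((Matrix.isDiag_iff_diagonal_diag _).1 t.2).symm

theorem torus_apply (t : T n) (v : V n) (k : Fin n) :
    Matrix.toEuclideanLin t.1.1 v k = p k t * v k := by
  rw [torus_eq]
  simp [Matrix.toLpLin_apply, Matrix.mulVec_diagonal]

open Classical in
theorem eigSum_torus (t : T n) (S : Set ℂ) :
    eigSum t.1.1 S = coordSub (Finset.univ.filter fun k => p k t ∈ S) := by
  apply le_antisymm
  · refine iSup₂_le fun l hl v hv k hk => ?_
    rw [Module.End.mem_eigenspace_iff] at hv
    have := congrFun (congrArg WithLp.ofLp hv) k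
    rw [torus_apply] at this
    simp only [PiLp.smul_apply, smul_eq_mul] at this
    by_contra h0
    apply hk
    simp only [Finset.mem_filter, Finset.mem_univ, true_and]
    rw [mul_right_cancel₀ h0 this]; exact hl
  · intro v hv
    have : v = ∑ k, v k • EuclideanSpace.single k (1 : ℂ) := by
      ext j; simp [Finset.sum_apply, Pi.single_apply]
    rw [this]
    refine Submodule.sum_mem _ fun k _ => ?_
    by_cases hk : p k t ∈ S
    · refine Submodule.smul_mem _ _ ?_
      refine Submodule.mem_iSup_of_mem (p k t) (Submodule.mem_iSup_of_mem hk ?_)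
      rw [Module.End.mem_eigenspace_iff]
      ext j
      rw [torus_apply]
      by_cases hj : j = k <;> simp [hj, PiLp.single_apply]
    · have : v k = 0 := hv k (by simp [hk])
      simp [this]

theorem finrank_coordSub (I : Finset (Fin n)) : Module.finrank ℂ (coordSub I) = I.card := by
  let f : coordSub I ≃ₗ[ℂ] (I → ℂ) :=
    { toFun := fun v i => v.1 i
      map_add' := fun _ _ => rfl
      map_smul' := fun _ _ => rfl
      invFun := fun w => ⟨WithLp.toLp 2 fun k => if h : k ∈ I then w ⟨k, h⟩ else 0, fun k hk => by
        simp [hk]⟩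
      left_inv := fun v => by
        ext k
        by_cases hk : k ∈ I <;> simp [hk]
        exact (v.2 k hk).symm
      right_inv := fun w => by ext i; simp }
  rw [f.finrank_eq]; simp

theorem eB_apply (I : Finset (Fin n)) : eB n I = ExteriorAlgebra.ιMulti ℂ I.card
    fun i => EuclideanSpace.single (I.orderEmbOfFin rfl i) (1 : ℂ) := by
  rw [eB, ExteriorAlgebra.basis_apply]
  simp only [ExteriorAlgebra.ιMulti_family]
  congr 1
  funext i
  exact EuclideanSpace.basisFun_apply _ _ _

theorem eB_mem (I : Finset (Fin n)) : eB n I ∈ LinearMap.range (detIncl (coordSub I)) := by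
  have hb : ∀ i : Fin I.card, EuclideanSpace.single (I.orderEmbOfFin rfl i) (1 : ℂ) ∈ coordSub I := by
    intro i k hk
    rw [PiLp.single_apply, if_neg]
    rintro rfl
    exact hk (Finset.orderEmbOfFin_mem I rfl i)
  have h : Module.finrank ℂ (coordSub I) = I.card := finrank_coordSub I
  have key : ∀ (m : ℕ) (hm : m = I.card), eB n I ∈ LinearMap.range
      ((ExteriorAlgebra.map (coordSub I).subtype).toLinearMap ∘ₗ
        Submodule.subtype (⋀[ℂ]^m (coordSub I))) := by
    rintro m rfl
    refine ⟨exteriorPower.ιMulti ℂ _ fun i => ⟨_, hb i⟩, ?_⟩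
    show ExteriorAlgebra.map (coordSub I).subtype (ExteriorAlgebra.ιMulti ℂ _ _) = _
    rw [ExteriorAlgebra.map_apply_ιMulti, eB_apply]
    rfl
  exact key _ h

/-- The action of `t ∈ T` on the exterior algebra, `v₁ ∧ ⋯ ∧ vₖ ↦ t v₁ ∧ ⋯ ∧ t vₖ`. -/
def extAct (t : T n) : Ext n →ₗ[ℂ] Ext n :=
  (ExteriorAlgebra.map (Matrix.toEuclideanLin t.1.1)).toLinearMap

theorem extAct_eB (t : T n) (I : Finset (Fin n)) :
    extAct t (eB n I) = (∏ k ∈ I, p k t) • eB n I := by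
  have h : ∀ i : Fin I.card, Matrix.toEuclideanLin t.1.1
      (EuclideanSpace.single (I.orderEmbOfFin rfl i) (1 : ℂ)) =
      p (I.orderEmbOfFin rfl i) t • EuclideanSpace.single (I.orderEmbOfFin rfl i) (1 : ℂ) := by
    intro i
    ext j
    rw [torus_apply]
    by_cases hj : j = I.orderEmbOfFin rfl i <;> simp [hj]
  rw [extAct, eB_apply, AlgHom.toLinearMap_apply, ExteriorAlgebra.map_apply_ιMulti]
  simp only [Function.comp_def, h]
  rw [AlternatingMap.map_smul_univ]
  congr 1
  conv_rhs => rw [← Finset.map_orderEmbOfFin_univ I rfl, Finset.prod_map]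
  rfl

/-- The sign with `e_I ∧ e_J = ± e_{I ∪ J}` for disjoint `I`, `J`. -/
def sgn (I J : Finset (Fin n)) : ℂ := (eB n).repr (eB n I * eB n J) (I ∪ J)

theorem eB_mul {I J : Finset (Fin n)} (h : Disjoint I J) :
    eB n I * eB n J = sgn I J • eB n (I ∪ J) ∧ ‖sgn I J‖ = 1 := by
  have := ExteriorAlgebra.basis_mul_of_disjoint (EuclideanSpace.basisFun (Fin n) ℂ).toBasis
    (Set.powersetCard.ofCard (s := I) rfl) (Set.powersetCard.ofCard (s := J) rfl) h
  set u := (Set.powersetCard.permOfDisjoint (s := Set.powersetCard.ofCard (s := I) rfl)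
    (t := Set.powersetCard.ofCard (s := J) rfl) h).sign with hu
  have h1 : eB n I * eB n J = ((u : ℤ) : ℂ) • eB n (I ∪ J) := by
    refine this.trans ?_
    rw [Units.smul_def, ← Int.cast_smul_eq_zsmul ℂ]
    congr 2
    exact Finset.disjUnion_eq_union I J h
  have h2 : sgn I J = ((u : ℤ) : ℂ) := by simp [sgn, h1]
  refine ⟨h2 ▸ h1, ?_⟩
  rw [h2]
  rcases Int.units_eq_one_or u with h | h <;> simp [h]

/-- The unit vector `e_I` of the determinant line of the coordinate subspace of `I`. -/
def eD {A : Submodule ℂ (V n)} {I : Finset (Fin n)} (h : A = coordSub I) : detLine A :=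
  ⟨eB n I, h ▸ eB_mem I⟩

theorem eD_mem {A : Submodule ℂ (V n)} {I : Finset (Fin n)} (h : A = coordSub I) :
    eD h ∈ (detLine A).U := by
  show extNormSq (eB n I) = 1
  simp [extNormSq, Finsupp.single_apply, apply_ite norm, ite_pow]

theorem detLine_eq {A : Submodule ℂ (V n)} {I : Finset (Fin n)} (h : A = coordSub I)
    (w : detLine A) : ∃ c : ℂ, (w.1 : Ext n) = c • eB n I := by
  obtain ⟨c, rfl⟩ := exists_smul (HLine.ne_zero (eD_mem h)) w
  exact ⟨c, rfl⟩

theorem extAct_mem {A : Submodule ℂ (V n)} {I : Finset (Fin n)} (h : A = coordSub I) (t : T n) :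
    ∀ w ∈ LinearMap.range (detIncl A), extAct t w ∈ LinearMap.range (detIncl A) := by
  intro w hw
  obtain ⟨c, hc⟩ := detLine_eq h ⟨w, hw⟩
  rw [show w = c • eB n I from hc, map_smul, extAct_eB]
  exact Submodule.smul_mem _ _ (Submodule.smul_mem _ _ (h ▸ eB_mem I))

open Classical in
/-- The index set of the eigenvalues of `t` in `S`. -/
def idx (t : T n) (S : Set ℂ) : Finset (Fin n) := Finset.univ.filter fun k => p k t ∈ S

theorem eigSum_eq (t : T n) (S : Set ℂ) : eigSum t.1.1 S = coordSub (idx t S) := eigSum_torus t S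

/-- The action of `T` on the determinant line of a sum of eigenspaces of `t ∈ T`, i.e.
`v₁ ∧ ⋯ ∧ vₖ ↦ s v₁ ∧ ⋯ ∧ s vₖ` for `s ∈ T`. -/
def detRep (t : T n) (S : Set ℂ) : Representation ℂ (T n) (detLine (eigSum t.1.1 S)) where
  toFun s := (extAct s).restrict (extAct_mem (eigSum_eq t S) s)
  map_one' := by
    apply LinearMap.ext
    intro w
    apply Subtype.ext
    show extAct 1 w.1 = w.1
    have : Matrix.toEuclideanLin (1 : T n).1.1 = LinearMap.id := by
      ext v k; simp
    rw [extAct, this]; simp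
  map_mul' s s' := by
    apply LinearMap.ext
    intro w
    apply Subtype.ext
    show extAct (s * s') w.1 = extAct s (extAct s' w.1)
    have : Matrix.toEuclideanLin (s * s').1.1 =
        (Matrix.toEuclideanLin s.1.1).comp (Matrix.toEuclideanLin s'.1.1) := by
      ext v k; simp [Matrix.toLpLin_apply]
    rw [extAct, this, ← ExteriorAlgebra.map_comp_map]; rfl

theorem detRep_eD (t : T n) (S : Set ℂ) (s : T n) :
    detRep t S s (eD (eigSum_eq t S)) = (∏ k ∈ idx t S, p k s) • eD (eigSum_eq t S) :=
  Subtype.ext (extAct_eB s _)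

theorem norm_p (k : Fin n) (t : T n) : ‖p k t‖ = 1 := by
  have h : star t.1.1 * t.1.1 = 1 := (Matrix.mem_unitaryGroup_iff').1
    (Matrix.mem_specialUnitaryGroup_iff.1 t.1.2).1
  have := congrFun (congrFun h k) k
  rw [torus_eq] at this
  simp [Matrix.star_eq_conjTranspose, Matrix.diagonal_conjTranspose] at this
  have h2 : ‖p k t‖ ^ 2 = 1 := by
    have h3 := congrArg (fun z => ‖z‖) this
    simp at h3
    nlinarith [norm_nonneg (p k t)]
  nlinarith [norm_nonneg (p k t)]

/-! ### The restriction of the basic bundle gerbe to the torus -/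

/-- A linear map of Hermitian lines that preserves unit vectors is an isometric isomorphism. -/
def HIso.ofUnit {A B : HLine} (f : A →ₗ[ℂ] B) (h : ∀ u ∈ A.U, f u ∈ B.U) : HIso A B := by
  have h0 : f A.u₀ ≠ 0 := HLine.ne_zero (h _ A.u₀_mem)
  let e : A ≃ₗ[ℂ] B := LinearEquiv.ofLinearMap f ((B.coord (f A.u₀)).smulRight A.u₀)
    (hom_ext h0 (by simp [coord_self h0])) (hom_ext A.u₀_ne (by simp [coord_self h0]))
  exact ⟨e, HIso.unit_of_gen e A.u₀_mem (h _ A.u₀_mem)⟩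

/-- Given unit-preserving bilinear maps `μ : A ⊗ C → A'` and `ν : B ⊗ C → B'`, the isomorphism
`Hom(A, B) ≅ Hom(A', B')`, `f ↦ f'`, with `f'(μ(a, c)) = ν(f(a), c)`. -/
def homTwist {A B C A' B' : HLine} (μ : A →ₗ[ℂ] C →ₗ[ℂ] A') (ν : B →ₗ[ℂ] C →ₗ[ℂ] B')
    (hμ : ∀ a ∈ A.U, ∀ c ∈ C.U, μ a c ∈ A'.U) (hν : ∀ b ∈ B.U, ∀ c ∈ C.U, ν b c ∈ B'.U) :
    HIso (A.hom B) (A'.hom B') :=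
  HIso.ofUnit (A := A.hom B) (B := A'.hom B')
    (LinearMap.smulRightₗ (A'.coord (μ A.u₀ C.u₀)) ∘ₗ ν.flip C.u₀ ∘ₗ LinearMap.applyₗ A.u₀)
    (by
      intro f hf a ha
      have hu := hμ _ A.u₀_mem _ C.u₀_mem
      obtain ⟨d, rfl⟩ := exists_smul (HLine.ne_zero hu) a
      rw [smul_mem_U hu] at ha
      show (A'.coord (μ A.u₀ C.u₀)) (d • μ A.u₀ C.u₀) • ν ((show A →ₗ[ℂ] B from f) A.u₀) C.u₀ ∈ _
      rw [map_smul, coord_self (HLine.ne_zero hu), smul_eq_mul, mul_one,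
        smul_mem_U (hν _ (hf _ A.u₀_mem) _ C.u₀_mem)]
      exact ha)

theorem homTwist_apply {A B C A' B' : HLine} (μ : A →ₗ[ℂ] C →ₗ[ℂ] A') (ν : B →ₗ[ℂ] C →ₗ[ℂ] B')
    (hμ : ∀ a ∈ A.U, ∀ c ∈ C.U, μ a c ∈ A'.U) (hν : ∀ b ∈ B.U, ∀ c ∈ C.U, ν b c ∈ B'.U)
    (f : A →ₗ[ℂ] B) (a : A) (c : C) :
    (show A' →ₗ[ℂ] B' from (homTwist μ ν hμ hν).e f) (μ a c) = ν (f a) c := by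
  obtain ⟨x, rfl⟩ := exists_smul A.u₀_ne a
  obtain ⟨y, rfl⟩ := exists_smul C.u₀_ne c
  show (A'.coord (μ A.u₀ C.u₀)) (μ (x • A.u₀) (y • C.u₀)) • ν (f A.u₀) C.u₀ = _
  simp [coord_self (HLine.ne_zero (hμ _ A.u₀_mem _ C.u₀_mem)), smul_smul, mul_comm]

/-- The wedge product `det A ⊗ det B → det C`, `(a, b) ↦ a ∧ b`, for coordinate subspaces with
`C = A ⊕ B`. -/
def wedge {A B C : Submodule ℂ (V n)} {I J : Finset (Fin n)} (hA : A = coordSub I)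
    (hB : B = coordSub J) (hC : C = coordSub (I ∪ J)) (hd : Disjoint I J) :
    detLine A →ₗ[ℂ] detLine B →ₗ[ℂ] detLine C :=
  LinearMap.mk₂ ℂ (fun a b => (⟨a.1 * b.1, by
      obtain ⟨x, hx⟩ := detLine_eq hA a
      obtain ⟨y, hy⟩ := detLine_eq hB b
      rw [hx, hy, smul_mul_smul_comm, (eB_mul hd).1]
      exact Submodule.smul_mem _ _ (Submodule.smul_mem _ _ (hC ▸ eB_mem _))⟩ : detLine C))
    (fun _ _ _ => Subtype.ext (add_mul _ _ _)) (fun _ _ _ => Subtype.ext (smul_mul_assoc _ _ _))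
    (fun _ _ _ => Subtype.ext (mul_add _ _ _)) (fun _ _ _ => Subtype.ext (mul_smul_comm _ _ _))

theorem wedge_eD {A B C : Submodule ℂ (V n)} {I J : Finset (Fin n)} (hA : A = coordSub I)
    (hB : B = coordSub J) (hC : C = coordSub (I ∪ J)) (hd : Disjoint I J) :
    wedge hA hB hC hd (eD hA) (eD hB) = sgn I J • eD hC :=
  Subtype.ext (eB_mul hd).1

theorem wedge_unit {A B C : Submodule ℂ (V n)} {I J : Finset (Fin n)} (hA : A = coordSub I)
    (hB : B = coordSub J) (hC : C = coordSub (I ∪ J)) (hd : Disjoint I J)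
    (a : detLine A) (ha : a ∈ (detLine A).U) (b : detLine B) (hb : b ∈ (detLine B).U) :
    wedge hA hB hC hd a b ∈ (detLine C).U := by
  obtain ⟨x, rfl⟩ := exists_smul (HLine.ne_zero (eD_mem hA)) a
  obtain ⟨y, rfl⟩ := exists_smul (HLine.ne_zero (eD_mem hB)) b
  rw [smul_mem_U (eD_mem hA)] at ha
  rw [smul_mem_U (eD_mem hB)] at hb
  rw [map_smul, map_smul, LinearMap.smul_apply, wedge_eD, smul_smul, smul_smul,
    smul_mem_U (eD_mem hC)]
  simp [ha, hb, (eB_mul hd).2]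

/-- The fibre over `t ∈ T` of the submersion `Y_T → T`: the points `z ∈ U(1)`, `z ≠ 1`, which are not
eigenvalues of `t`. -/
structure FibT (t : T n) where
  z : ℂ
  norm_z : ‖z‖ = 1
  ne_one : z ≠ 1
  ne_p : ∀ i, z ≠ p i t

theorem ang_injective {z w : ℂ} (hz : ‖z‖ = 1) (hw : ‖w‖ = 1) (h : ang z = ang w) : z = w := by
  have h1 : Complex.arg (-z) = Complex.arg (-w) := by simpa [ang] using h
  have := Complex.ext_norm_arg (x := -z) (y := -w) (by simp [hz, hw]) h1
  simpa using this

/-- The indices of the eigenvalues `pₖ(t) < z` in the anti-clockwise order on `U(1) \ {1}`. -/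
def below (t : T n) (z : ℂ) : Finset (Fin n) := idx t {l | ang l < ang z}

theorem mem_idx (t : T n) (S : Set ℂ) (k : Fin n) : k ∈ idx t S ↔ p k t ∈ S := by
  simp [idx]

theorem ang_ne {t : T n} (z : FibT t) (k : Fin n) : ang (p k t) ≠ ang z.z := fun h =>
  z.ne_p k (ang_injective z.norm_z (norm_p k t) h.symm)

theorem L_eq {t : T n} (z₁ z₂ : FibT t) :
    L t.1.1 z₁.z z₂.z = coordSub (below t z₁.z \ below t z₂.z) := by
  rw [L, eigSum_eq]
  congr 1
  ext k
  simp only [below, mem_idx, Finset.mem_sdiff, Set.mem_ofPred_eq, not_lt]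
  have := ang_ne z₂ k
  constructor
  · rintro ⟨h1, h2⟩; exact ⟨h2, h1.le⟩
  · rintro ⟨h1, h2⟩; exact ⟨lt_of_le_of_ne h2 this.symm, h1⟩

/-- The sum of the eigenspaces of `t` for the eigenvalues `λ < z`. -/
def K (t : T n) (z : ℂ) : Submodule ℂ (V n) := eigSum t.1.1 {l | ang l < ang z}

/-- The sum of the eigenspaces of `t` for the eigenvalues `λ` with `λ < z₁` and `λ < z₂`. -/
def K₂ (t : T n) (z₁ z₂ : ℂ) : Submodule ℂ (V n) :=
  eigSum t.1.1 {l | ang l < ang z₁ ∧ ang l < ang z₂}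

theorem K_eq (t : T n) (z : ℂ) : K t z = coordSub (below t z) := eigSum_eq _ _

theorem K₂_eq (t : T n) (z₁ z₂ : ℂ) : K₂ t z₁ z₂ = coordSub (below t z₁ ∩ below t z₂) := by
  rw [K₂, eigSum_eq]; congr 1; ext k; simp [below, mem_idx]

theorem K_eq₁ (t : T n) (z₁ z₂ : ℂ) :
    K t z₁ = coordSub ((below t z₁ \ below t z₂) ∪ (below t z₁ ∩ below t z₂)) := by
  rw [K_eq, Finset.sdiff_union_inter]

theorem K_eq₂ (t : T n) (z₁ z₂ : ℂ) :
    K t z₂ = coordSub ((below t z₂ \ below t z₁) ∪ (below t z₁ ∩ below t z₂)) := by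
  rw [K_eq, Finset.inter_comm, Finset.sdiff_union_inter]

theorem disj₁ (I J : Finset (Fin n)) : Disjoint (I \ J) (I ∩ J) :=
  Finset.disjoint_sdiff_inter I J

theorem disj₂ (I J : Finset (Fin n)) : Disjoint (J \ I) (I ∩ J) := by
  rw [Finset.inter_comm]; exact Finset.disjoint_sdiff_inter J I

/-- The isomorphism `f ↦ f̂` of `(P_b)_{(z₁, z₂, t)} = Hom(det L_{(z₂, z₁, t)}, det L_{(z₁, z₂, t)})`
with `Hom(det K(z₂), det K(z₁))` given by `f̂(a ∧ c) = f(a) ∧ c` for `a ∈ det L_{(z₂, z₁, t)}` and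
`c ∈ det K(z₁, z₂)`; here `K(z)` is the sum of the eigenspaces of `t` for the eigenvalues below `z`,
and `K(z₁, z₂)` that for the eigenvalues below both `z₁` and `z₂`, so that
`K(z₂) = L_{(z₂, z₁, t)} ⊕ K(z₁, z₂)` and `K(z₁) = L_{(z₁, z₂, t)} ⊕ K(z₁, z₂)`. -/
def hat {t : T n} (z₁ z₂ : FibT t) :
    HIso (Pb t.1.1 z₁.z z₂.z) ((detLine (K t z₂.z)).hom (detLine (K t z₁.z))) :=
  homTwist
    (wedge (L_eq z₂ z₁) (K₂_eq t z₁.z z₂.z) (K_eq₂ t z₁.z z₂.z) (disj₂ _ _))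
    (wedge (L_eq z₁ z₂) (K₂_eq t z₁.z z₂.z) (K_eq₁ t z₁.z z₂.z) (disj₁ _ _))
    (wedge_unit _ _ _ _) (wedge_unit _ _ _ _)

/-- Composition of linear maps between Hermitian lines. -/
def homComp (A B C : HLine) : B.hom C →ₗ[ℂ] A.hom B →ₗ[ℂ] A.hom C :=
  LinearMap.llcomp ℂ A B C

/-- The multiplication `(P_b)_{(z₁, z₂, t)} ⊗ (P_b)_{(z₂, z₃, t)} → (P_b)_{(z₁, z₃, t)}` of the basic
bundle gerbe, `(f ⬝ g)^ = f̂ ∘ ĝ`.  For `z₁ ≥ z₂ ≥ z₃` it is the wedge product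
`det L_{(z₁, z₂, t)} ⊗ det L_{(z₂, z₃, t)} → det L_{(z₁, z₃, t)}` (both sides become
`c ↦ f ∧ g ∧ c`, `c ∈ det K(z₃)`; see `mulPb_wedge`); in the other cases it is the map obtained from the wedge product by
contraction with the dual lines. -/
def mulPb {t : T n} (z₁ z₂ z₃ : FibT t) :
    Pb t.1.1 z₁.z z₂.z →ₗ[ℂ] Pb t.1.1 z₂.z z₃.z →ₗ[ℂ] Pb t.1.1 z₁.z z₃.z :=
  ((homComp _ _ _).compl₁₂ (hat z₁ z₂).e.toLinearMap (hat z₂ z₃).e.toLinearMap).compr₂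
    (hat z₁ z₃).e.symm.toLinearMap

theorem detRep_unit (t : T n) (S : Set ℂ) (s : T n) (v : detLine (eigSum t.1.1 S))
    (hv : v ∈ (detLine (eigSum t.1.1 S)).U) : detRep t S s v ∈ (detLine (eigSum t.1.1 S)).U := by
  have he := eD_mem (eigSum_eq t S)
  obtain ⟨c, rfl⟩ := exists_smul (HLine.ne_zero he) v
  rw [smul_mem_U he] at hv
  rw [map_smul, detRep_eD, smul_smul, smul_mem_U he]
  simp [hv, norm_p]

/-- `(P_b)_{(z₁, z₂, t)}` as a representation of `T`: `s ∈ T` acts by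
`v₁ ∧ ⋯ ∧ vₖ ↦ s v₁ ∧ ⋯ ∧ s vₖ` on the determinant lines, and by conjugation on `Hom`. -/
def PbT {t : T n} (z₁ z₂ : FibT t) : TLine (T n) where
  L := Pb t.1.1 z₁.z z₂.z
  act := Representation.linHom
    (detRep t {l | ang z₁.z < ang l ∧ ang l < ang z₂.z})
    (detRep t {l | ang z₂.z < ang l ∧ ang l < ang z₁.z})
  unit _ _ hf _ ha := detRep_unit _ _ _ _ (hf _ (detRep_unit _ _ _ _ ha))

/-- `f̂(a ∧ c) = f(a) ∧ c`. -/
theorem hat_apply {t : T n} (z₁ z₂ : FibT t)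
    (f : detLine (L t.1.1 z₂.z z₁.z) →ₗ[ℂ] detLine (L t.1.1 z₁.z z₂.z))
    (a : detLine (L t.1.1 z₂.z z₁.z)) (c : detLine (K₂ t z₁.z z₂.z)) (w : detLine (K t z₂.z))
    (hw : w.1 = a.1 * c.1) :
    ((show detLine (K t z₂.z) →ₗ[ℂ] detLine (K t z₁.z) from (hat z₁ z₂).e f) w).1 =
      (f a).1 * c.1 := by
  have h := homTwist_apply
    (wedge (L_eq z₂ z₁) (K₂_eq t z₁.z z₂.z) (K_eq₂ t z₁.z z₂.z) (disj₂ _ _))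
    (wedge (L_eq z₁ z₂) (K₂_eq t z₁.z z₂.z) (K_eq₁ t z₁.z z₂.z) (disj₁ _ _))
    (wedge_unit _ _ _ _) (wedge_unit _ _ _ _) f a c
  have hw' : w = wedge (L_eq z₂ z₁) (K₂_eq t z₁.z z₂.z) (K_eq₂ t z₁.z z₂.z) (disj₂ _ _) a c :=
    Subtype.ext hw
  rw [hw']
  exact congrArg Subtype.val h

theorem K₂_of_le {t : T n} {z w : ℂ} (h : ang z ≤ ang w) : K₂ t w z = K t z := by
  rw [K₂, K]
  congr 1
  ext l
  exact ⟨fun h' => h'.2, fun h' => ⟨lt_of_lt_of_le h' h, h'⟩⟩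

theorem wedge_aux {t : T n} (z₁ z₂ z₃ : FibT t) (h₁ : ang z₂.z ≤ ang z₁.z)
    (h₂ : ang z₃.z ≤ ang z₂.z) (f : detLine (L t.1.1 z₂.z z₁.z) →ₗ[ℂ] detLine (L t.1.1 z₁.z z₂.z))
    (g : detLine (L t.1.1 z₃.z z₂.z) →ₗ[ℂ] detLine (L t.1.1 z₂.z z₃.z))
    (a : detLine (L t.1.1 z₂.z z₁.z)) (b : detLine (L t.1.1 z₃.z z₂.z))
    (c : detLine (L t.1.1 z₃.z z₁.z)) (ha : a.1 = 1) (hb : b.1 = 1) (hc : c.1 = 1)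
    (H : detLine (L t.1.1 z₃.z z₁.z) →ₗ[ℂ] detLine (L t.1.1 z₁.z z₃.z))
    (h13 : detLine (K t z₃.z) →ₗ[ℂ] detLine (K t z₁.z))
    (h12 : detLine (K t z₂.z) →ₗ[ℂ] detLine (K t z₁.z))
    (h23 : detLine (K t z₃.z) →ₗ[ℂ] detLine (K t z₂.z))
    (H13 : (hat z₁ z₃).e H = h13) (H12 : (hat z₁ z₂).e f = h12) (H23 : (hat z₂ z₃).e g = h23)
    (hcomp : h13 = h12 ∘ₗ h23) : (H c).1 = (f a).1 * (g b).1 := by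
  let w : detLine (K t z₃.z) := eD (K_eq t z₃.z)
  have hh : ∀ {A B : Submodule ℂ (V n)} (h : B = A) (w : detLine A),
      ∃ w' : detLine B, w'.1 = w.1 := by
    rintro A _ rfl w; exact ⟨w, rfl⟩
  obtain ⟨w1, hw1⟩ := hh (K₂_of_le (t := t) (h₂.trans h₁)) w
  obtain ⟨w2, hw2⟩ := hh (K₂_of_le (t := t) h₂) w
  obtain ⟨w3, hw3⟩ := hh (K₂_of_le (t := t) h₁) (h23 w)
  have e1 : (h13 w).1 = (H c).1 * w1.1 := by
    have := hat_apply z₁ z₃ H c w1 w (by rw [hc, one_mul, hw1])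
    rwa [H13] at this
  have e2 : (h23 w).1 = (g b).1 * w2.1 := by
    have := hat_apply z₂ z₃ g b w2 w (by rw [hb, one_mul, hw2])
    rwa [H23] at this
  have e3 : (h12 (h23 w)).1 = (f a).1 * w3.1 := by
    have := hat_apply z₁ z₂ f a w3 (h23 w) (by rw [ha, one_mul, hw3])
    rwa [H12] at this
  rw [hw3, e2, hw2] at e3
  rw [hw1, hcomp, LinearMap.comp_apply, e3] at e1
  have key : (H c).1 * eB n (below t z₃.z) = ((f a).1 * (g b).1) * eB n (below t z₃.z) := by
    rw [mul_assoc]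
    exact e1.symm
  have hs12 : below t z₂.z ⊆ below t z₁.z := by
    intro k hk; simp only [below, mem_idx, Set.mem_ofPred_eq] at *; linarith
  have hs23 : below t z₃.z ⊆ below t z₂.z := by
    intro k hk; simp only [below, mem_idx, Set.mem_ofPred_eq] at *; linarith
  obtain ⟨x, hx⟩ := detLine_eq (L_eq z₁ z₃) (H c)
  obtain ⟨y, hy⟩ := detLine_eq (L_eq z₁ z₂) (f a)
  obtain ⟨u, hu⟩ := detLine_eq (L_eq z₂ z₃) (g b)
  have hd : Disjoint (below t z₁.z \ below t z₂.z) (below t z₂.z \ below t z₃.z) :=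
    Finset.disjoint_left.2 fun k h h' => by simp at h h'; exact h.2 h'.1
  have hun : (below t z₁.z \ below t z₂.z) ∪ (below t z₂.z \ below t z₃.z) =
      below t z₁.z \ below t z₃.z := by
    ext k; have := @hs12 k; have := @hs23 k
    simp only [Finset.mem_union, Finset.mem_sdiff]; tauto
  have hd' : Disjoint (below t z₁.z \ below t z₃.z) (below t z₃.z) := Finset.sdiff_disjoint
  have hp : (f a).1 * (g b).1 = (y * u * sgn (below t z₁.z \ below t z₂.z)
      (below t z₂.z \ below t z₃.z)) • eB n (below t z₁.z \ below t z₃.z) := by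
    rw [hy, hu, smul_mul_smul_comm, (eB_mul hd).1, hun, smul_smul]
  rw [hx, hp] at key ⊢
  rw [smul_mul_assoc, smul_mul_assoc, (eB_mul hd').1, smul_smul, smul_smul] at key
  have hs : sgn (below t z₁.z \ below t z₃.z) (below t z₃.z) ≠ 0 := by
    rw [← norm_pos_iff, (eB_mul hd').2]; exact one_pos
  have := sub_eq_zero.2 key
  rw [← sub_smul, ← sub_mul] at this
  rcases smul_eq_zero.1 this with h | h
  · rw [sub_eq_zero.1 ((mul_eq_zero.1 h).resolve_right hs)]
  · exact absurd h ((eB n).ne_zero _)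

/-- For `z₁ ≥ z₂ ≥ z₃`, where all the lines `det L_{(z_j, z_i, t)}`, `i ≤ j`, are `ℂ = ℂ ⬝ 1`, the
multiplication is the wedge product. -/
theorem mulPb_wedge {t : T n} (z₁ z₂ z₃ : FibT t) (h₁ : ang z₂.z ≤ ang z₁.z)
    (h₂ : ang z₃.z ≤ ang z₂.z) (f : detLine (L t.1.1 z₂.z z₁.z) →ₗ[ℂ] detLine (L t.1.1 z₁.z z₂.z))
    (g : detLine (L t.1.1 z₃.z z₂.z) →ₗ[ℂ] detLine (L t.1.1 z₂.z z₃.z))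
    (a : detLine (L t.1.1 z₂.z z₁.z)) (b : detLine (L t.1.1 z₃.z z₂.z))
    (c : detLine (L t.1.1 z₃.z z₁.z)) (ha : a.1 = 1) (hb : b.1 = 1) (hc : c.1 = 1) :
    (((show detLine (L t.1.1 z₃.z z₁.z) →ₗ[ℂ] detLine (L t.1.1 z₁.z z₃.z) from
      mulPb z₁ z₂ z₃ f g) c).1 : Ext n) = (f a).1 * (g b).1 := by
  refine wedge_aux z₁ z₂ z₃ h₁ h₂ f g a b c ha hb hc _ _ _ _ rfl rfl rfl ?_
  exact LinearEquiv.apply_symm_apply (hat z₁ z₃).e _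

/-! ### Equivariant bundle gerbes -/

/-- Data for a surjective submersion `Y → M` with a lift of the action of `G` on `M` to `Y`: the
submersion is given by its fibres `Y m`, `m ∈ M`, and the smooth structure of the total space
`Σ m, Y m`. -/
structure SubmersionData (G M : Type) [Group G] [MulAction G M] where
  Y : M → Type
  dY : DiffeologicalSpace (Σ m, Y m)
  act : ∀ (g : G) {m : M}, Y m → Y (g • m)

/-- The fibre product `B^{[2]}` of a family of sets `B m`. -/
abbrev Sq {M : Type} (B : M → Type) : Type := Σ m, B m × B m

/-- The smooth structure of the fibre product. -/
@[reducible]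
def sqD {M : Type} {B : M → Type} (d : DiffeologicalSpace (Σ m, B m)) : DiffeologicalSpace (Sq B) :=
  (inducedD d fun q => ⟨q.1, q.2.1⟩) ⊓ (inducedD d fun q => ⟨q.1, q.2.2⟩)

section Gerbe

variable {G M : Type} [Group G] [MulAction G M]

/-- `Y → M` is a `G`-equivariant surjective submersion: `Y → M` is onto and smooth and has smooth local
sections through every point, and `G` acts smoothly. -/
structure SubmersionData.IsEquivariantSubmersion (S : SubmersionData G M)
    (dG : DiffeologicalSpace G) (dM : DiffeologicalSpace M) : Prop where
  nonempty : ∀ m, Nonempty (S.Y m)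
  smooth_proj : ∀ (k : ℕ) (y : Eu k → Σ m, S.Y m), SmoothMap S.dY y → SmoothMap dM fun r => (y r).1
  local_section : ∀ (k : ℕ) (b : Eu k → M), SmoothMap dM b → ∀ (r₀ : Eu k) (y₀ : S.Y (b r₀)),
    ∃ s : Eu k → Σ m, S.Y m, SmoothMap S.dY s ∧ s r₀ = ⟨b r₀, y₀⟩ ∧ ∀ᶠ r in 𝓝 r₀, (s r).1 = b r
  smooth_act_base : ∀ (k : ℕ) (g : Eu k → G) (b : Eu k → M), SmoothMap dG g → SmoothMap dM b →
    SmoothMap dM fun r => g r • b r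
  smooth_act : ∀ (k : ℕ) (g : Eu k → G) (y : Eu k → Σ m, S.Y m), SmoothMap dG g →
    SmoothMap S.dY y → SmoothMap S.dY fun r => ⟨g r • (y r).1, S.act (g r) (y r).2⟩
  act_one : ∀ (m : M) (y : S.Y m),
    (⟨(1 : G) • m, S.act 1 y⟩ : Σ m, S.Y m) = ⟨m, y⟩
  act_mul : ∀ (g h : G) (m : M) (y : S.Y m),
    (⟨(g * h) • m, S.act (g * h) y⟩ : Σ m, S.Y m) = ⟨g • h • m, S.act g (S.act h y)⟩

/-- Data for a `G`-equivariant bundle gerbe `(P, Y)` over `M`: the fibres of `P → Y^{[2]}`, the smooth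
structure of the total space of `P`, the bundle gerbe multiplication, and the action of `G` on `P`
by isometric isomorphisms of the fibres which cover the action on `Y^{[2]}`. -/
structure GerbeData (S : SubmersionData G M) where
  P : ∀ {m : M}, S.Y m → S.Y m → HLine
  dP : DiffeologicalSpace (Σ q : Sq S.Y, P q.2.1 q.2.2)
  mul : ∀ {m : M} (y₁ y₂ y₃ : S.Y m), P y₁ y₂ →ₗ[ℂ] P y₂ y₃ →ₗ[ℂ] P y₁ y₃
  act : ∀ (g : G) {m : M} (y₁ y₂ : S.Y m), HIso (P y₁ y₂) (P (S.act g y₁) (S.act g y₂))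

/-- The total space of the line bundle `P → Y^{[2]}`. -/
abbrev GerbeData.Total {S : SubmersionData G M} (A : GerbeData S) : Type :=
  Σ q : Sq S.Y, A.P q.2.1 q.2.2

/-- A point of the total space of `P → Y^{[2]}`. -/
abbrev GerbeData.pt {S : SubmersionData G M} (A : GerbeData S) {m : M} (y₁ y₂ : S.Y m)
    (v : A.P y₁ y₂) : A.Total := ⟨⟨m, y₁, y₂⟩, v⟩

/-- `(P, Y)` is a `G`-equivariant bundle gerbe over `M`: `Y → M` is a `G`-equivariant surjective
submersion, `P → Y^{[2]}` is a smooth, locally trivial Hermitian line bundle, the multiplication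
`P_{(y₁, y₂)} ⊗ P_{(y₂, y₃)} → P_{(y₁, y₃)}` is smooth, isometric and associative, and `G` acts smoothly on
`P`, compatibly with the multiplication. -/
structure GerbeData.IsEquivariantBundleGerbe {S : SubmersionData G M} (A : GerbeData S)
    (dG : DiffeologicalSpace G) (dM : DiffeologicalSpace M) : Prop where
  submersion : S.IsEquivariantSubmersion dG dM
  smooth_proj : ∀ (k : ℕ) (v : Eu k → A.Total), SmoothMap A.dP v →
    SmoothMap (sqD S.dY) fun r => (v r).1
  /-- Local triviality: along any smooth `q : ℝᵏ → Y^{[2]}` there are local sections `s` of unit vectors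
  such that the sections `c s` of `P` are smooth precisely for the smooth functions `c`. -/
  locally_trivial : ∀ (k : ℕ) (q : Eu k → Sq S.Y), SmoothMap (sqD S.dY) q → ∀ r₀ : Eu k,
    ∃ W ∈ 𝓝 r₀, ∃ s : ∀ r, A.P (q r).2.1 (q r).2.2, (∀ r, s r ∈ (A.P (q r).2.1 (q r).2.2).U) ∧
      ∀ (l : ℕ) (φ : Eu l → Eu k) (c : Eu l → ℂ), ContDiff ℝ ∞ φ → (∀ x, φ x ∈ W) →
        (SmoothMap A.dP (fun x => ⟨q (φ x), c x • s (φ x)⟩) ↔ ContDiff ℝ ∞ c)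
  mul_unit : ∀ {m : M} (y₁ y₂ y₃ : S.Y m), ∀ v ∈ (A.P y₁ y₂).U, ∀ w ∈ (A.P y₂ y₃).U,
    A.mul y₁ y₂ y₃ v w ∈ (A.P y₁ y₃).U
  mul_assoc : ∀ {m : M} (y₁ y₂ y₃ y₄ : S.Y m) (u : A.P y₁ y₂) (v : A.P y₂ y₃) (w : A.P y₃ y₄),
    A.mul y₁ y₃ y₄ (A.mul y₁ y₂ y₃ u v) w = A.mul y₁ y₂ y₄ u (A.mul y₂ y₃ y₄ v w)
  smooth_mul : ∀ (k : ℕ) (m : Eu k → M) (y₁ y₂ y₃ : ∀ r, S.Y (m r))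
    (v : ∀ r, A.P (y₁ r) (y₂ r)) (w : ∀ r, A.P (y₂ r) (y₃ r)),
    SmoothMap A.dP (fun r => A.pt _ _ (v r)) → SmoothMap A.dP (fun r => A.pt _ _ (w r)) →
      SmoothMap A.dP fun r => A.pt _ _ (A.mul _ _ _ (v r) (w r))
  act_one : ∀ {m : M} (y₁ y₂ : S.Y m) (v : A.P y₁ y₂),
    A.pt _ _ ((A.act 1 y₁ y₂).e v) = A.pt _ _ v
  act_mul : ∀ (g h : G) {m : M} (y₁ y₂ : S.Y m) (v : A.P y₁ y₂),
    A.pt _ _ ((A.act (g * h) y₁ y₂).e v) = A.pt _ _ ((A.act g _ _).e ((A.act h y₁ y₂).e v))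
  smooth_act : ∀ (k : ℕ) (g : Eu k → G) (v : Eu k → A.Total), SmoothMap dG g →
    SmoothMap A.dP v → SmoothMap A.dP fun r => A.pt _ _ ((A.act (g r) _ _).e (v r).2)
  act_mul_compat : ∀ (g : G) {m : M} (y₁ y₂ y₃ : S.Y m) (v : A.P y₁ y₂) (w : A.P y₂ y₃),
    (A.act g y₁ y₃).e (A.mul y₁ y₂ y₃ v w) =
      A.mul _ _ _ ((A.act g y₁ y₂).e v) ((A.act g y₂ y₃).e w)

/-- A `G`-equivariant isomorphism of bundle gerbes `(P, Y) ≅ (Q, Y)` over `M` with the same submersion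
`Y → M`, covering the identity of `Y`: an isometric isomorphism of line bundles `P → Q` over `Y^{[2]}`,
smooth with smooth inverse, which respects the multiplications and the actions of `G`. -/
structure GerbeIso {S : SubmersionData G M} (A B : GerbeData S) where
  iso : ∀ {m : M} (y₁ y₂ : S.Y m), HIso (A.P y₁ y₂) (B.P y₁ y₂)
  smooth : ∀ (k : ℕ) (v : Eu k → A.Total), SmoothMap A.dP v →
    SmoothMap B.dP fun r => B.pt _ _ ((iso _ _).e (v r).2)
  smooth_symm : ∀ (k : ℕ) (w : Eu k → B.Total), SmoothMap B.dP w →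
    SmoothMap A.dP fun r => A.pt _ _ ((iso _ _).e.symm (w r).2)
  mul : ∀ {m : M} (y₁ y₂ y₃ : S.Y m) (v : A.P y₁ y₂) (w : A.P y₂ y₃),
    (iso y₁ y₃).e (A.mul y₁ y₂ y₃ v w) = B.mul y₁ y₂ y₃ ((iso y₁ y₂).e v) ((iso y₂ y₃).e w)
  equivariant : ∀ (g : G) {m : M} (y₁ y₂ : S.Y m) (v : A.P y₁ y₂),
    (iso _ _).e ((A.act g y₁ y₂).e v) = (B.act g y₁ y₂).e ((iso y₁ y₂).e v)

end Gerbe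

/-! ### The submersion `Y_T × SU(n)/T → T × SU(n)/T` -/

/-- The smooth structure of `Y_T = {(t, z)} ⊆ T × U(1)`. -/
instance : DiffeologicalSpace (Σ t : T n, FibT t) :=
  inducedD inferInstance Sigma.fst ⊓ inducedD (vecD ℂ) fun y => y.2.z

/-- The manifold `T × SU(n)/T`. -/
structure Base (n : ℕ) where
  t : T n
  x : SU n ⧸ T n

instance : DiffeologicalSpace (Base n) :=
  inducedD inferInstance Base.t ⊓ inducedD inferInstance Base.x

/-- The action of `SU(n)` on `T × SU(n)/T` by left multiplication on `SU(n)/T`. -/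
instance : MulAction (SU n) (Base n) where
  smul g m := ⟨m.t, g • m.x⟩
  one_smul m := congrArg (Base.mk m.t) (one_smul _ m.x)
  mul_smul g h m := congrArg (Base.mk m.t) (mul_smul g h m.x)

/-- The submersion `Y_T × SU(n)/T → T × SU(n)/T`, with the action of `SU(n)` on the factor `SU(n)/T`. -/
def weylSubmersion (n : ℕ) : SubmersionData (SU n) (Base n) where
  Y m := FibT m.t
  dY := inducedD inferInstance Sigma.fst ⊓ inducedD (vecD ℂ) fun y => y.2.z
  act _ _ z := z

/-! ### The induced bundle gerbe `(P_{b,T} ×_T SU(n), Y_T × SU(n)/T)` -/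

/-- The total space of the line bundle `P_{b,T} → Y_T^{[2]}`. -/
abbrev TotalT (n : ℕ) : Type := Σ u : Sq (fun t : T n => FibT t), (PbT u.2.1 u.2.2).L

/-- The smooth structure of `P_{b,T}`: a family of elements `f(r)` of the lines
`Hom(det L_{(z₂, z₁, t)}, det L_{(z₁, z₂, t)})` over a smooth family of points `(z₁, z₂, t)` of `Y_T^{[2]}` is
smooth iff `f` maps smooth families in the lines `det L_{(z₂, z₁, t)}` to smooth families (in the
exterior algebra of `ℂⁿ`). -/
instance : DiffeologicalSpace (TotalT n) where
  plots k := {v | SmoothMap (sqD inferInstance) (fun r => (v r).1) ∧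
    ∀ (l : ℕ) (φ : Eu l → Eu k), ContDiff ℝ ∞ φ →
      ∀ a : ∀ x, detLine (L (v (φ x)).1.1.1.1 (v (φ x)).1.2.2.z (v (φ x)).1.2.1.z),
        SmoothMap (vecD (Ext n)) (fun x => ((a x).1 : Ext n)) →
          SmoothMap (vecD (Ext n)) (fun x => ((show detLine (L _ _ _) →ₗ[ℂ] detLine (L _ _ _) from
            (v (φ x)).2) (a x)).1)}
  constant_plots v := by
    refine ⟨DiffeologicalSpace.constant_plots (self := sqD inferInstance) _, fun l φ _ a ha ψ => ?_⟩
    obtain ⟨χ, hχ⟩ := LinearMap.exists_extend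
      (p := LinearMap.range (detIncl (L v.1.1.1.1 v.1.2.2.z v.1.2.1.z)))
      (ψ ∘ₗ Submodule.subtype _ ∘ₗ
        (show detLine (L _ _ _) →ₗ[ℂ] LinearMap.range (detIncl (L _ _ _)) from v.2))
    convert ha χ using 2 with x
    exact (LinearMap.congr_fun hχ (a x)).symm
  plot_reparam {k m v φ} hv hφ :=
    ⟨DiffeologicalSpace.plot_reparam (self := sqD inferInstance) hv.1 hφ,
      fun l φ' hφ' a ha => hv.2 l (φ ∘ φ') (hφ.comp hφ') a ha⟩
  locality {k v} hv := by
    refine ⟨DiffeologicalSpace.locality (self := sqD inferInstance) fun r => ?_, fun l φ hφ a ha =>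
      (vecD (Ext n)).locality fun x => ?_⟩
    · obtain ⟨u, hu, hr, h⟩ := hv r
      exact ⟨u, hu, hr, fun {m f} hf hfs => (h hf hfs).1⟩
    · obtain ⟨u, hu, hr, h⟩ := hv (φ x)
      refine ⟨φ ⁻¹' u, hu.preimage hφ.continuous, hr, fun {m f} hf hfs => ?_⟩
      exact (h (f := φ ∘ f) hf (hφ.comp hfs)).2 m id contDiff_id (fun y => a (f y))
        ((vecD (Ext n)).plot_reparam ha hfs)

/-- The smooth structure of an associated bundle `E ×_T SU(n)`, as a quotient of `E × SU(n)`. -/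
instance (E : TLine (T n)) : DiffeologicalSpace (Assoc E) :=
  coinducedD (prodD (vecD E.L) inferInstance) (fun a => Assoc.mk E a.1 a.2) Quotient.mk_surjective

/-- The map `P_{b,T} × SU(n) → P_{b,T} ×_T SU(n)`. -/
def inducedMk (a : TotalT n × SU n) :
    Σ q : Sq (weylSubmersion n).Y, assocFib (PbT q.2.1 q.2.2) q.1.x :=
  ⟨⟨⟨a.1.1.1, a.2⟩, a.1.1.2⟩, (assocFrame (PbT a.1.1.2.1 a.1.1.2.2) a.2 rfl).e a.1.2⟩

theorem inducedMk_surjective : Function.Surjective (inducedMk (n := n)) := by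
  rintro ⟨⟨⟨t, x⟩, z₁, z₂⟩, w⟩
  obtain ⟨g, rfl⟩ := QuotientGroup.mk_surjective x
  obtain ⟨v, rfl⟩ := (assocFrame (PbT z₁ z₂) g rfl).e.surjective w
  exact ⟨(⟨⟨t, z₁, z₂⟩, v⟩, g), rfl⟩

/-- The `SU(n)`-equivariant bundle gerbe `(P_{b,T} ×_T SU(n), Y_T × SU(n)/T)` over `T × SU(n)/T` induced by
the restriction `(P_{b,T}, Y_T)` of the basic bundle gerbe to `T`: `P_{b,T} ×_T SU(n)` is the quotient of
`P_{b,T} × SU(n)` by the relation `(f, g) ∼ (t f, g t⁻¹)`, with the multiplication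
`[f, g] [f', g] = [f f', g]` and the action `h [f, g] = [f, h g]`. -/
def inducedGerbe (n : ℕ) : GerbeData (weylSubmersion n) where
  P {m} z₁ z₂ := assocFib (PbT z₁ z₂) m.x
  dP := coinducedD (prodD inferInstance inferInstance) inducedMk inducedMk_surjective
  mul {m} z₁ z₂ z₃ := assocMul (E := PbT z₁ z₂) (E' := PbT z₂ z₃) (E'' := PbT z₁ z₃)
    (mulPb z₁ z₂ z₃) m.x
  act h {_} z₁ z₂ := assocAct (PbT z₁ z₂) h

/-! ### The cup product bundle gerbe `(⊗ᵢ Jᵢ^{εᵢ}, Y_T × SU(n)/T)` -/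

/-- The function `εᵢ : Y_T^{[2]} → ℤ`. -/
def eps (i : Fin n) {t : T n} (z₁ z₂ : FibT t) : ℤ :=
  if ang z₂.z < ang (p i t) ∧ ang (p i t) < ang z₁.z then 1
  else if ang z₁.z < ang (p i t) ∧ ang (p i t) < ang z₂.z then -1
  else 0

theorem p_mul (i : Fin n) (s t : T n) : p i (s * t) = p i s * p i t := by
  show (s.1.1 * t.1.1) i i = _
  rw [torus_eq s, torus_eq t, Matrix.diagonal_mul_diagonal, Matrix.diagonal_apply_eq]

/-- The representation `ℂ_{pᵢ}` of `T` on `ℂ` of weight `pᵢ`. -/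
def weight (i : Fin n) : TLine (T n) where
  L := triv
  act :=
    { toFun := fun t => (p i t • LinearMap.id : ℂ →ₗ[ℂ] ℂ)
      map_one' := by
        apply LinearMap.ext
        intro v
        show p i 1 * v = v
        simp [p]
      map_mul' := fun s t => by
        apply LinearMap.ext
        intro v
        show p i (s * t) * v = p i s * (p i t * v)
        rw [p_mul, mul_assoc] }
  unit t v hv := by
    have hv : ‖(show ℂ from v)‖ = 1 := hv
    show ‖p i t * (show ℂ from v)‖ = 1
    rw [norm_mul, norm_p, hv, mul_one]

/-- The fibre over `x ∈ SU(n)/T` of the homogeneous line bundle `Jᵢ = ℂ_{pᵢ} ×_T SU(n) → SU(n)/T`. -/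
abbrev J (i : Fin n) (x : SU n ⧸ T n) : HLine := assocFib (weight i) x

/-- The line `⊗ᵢ Jᵢ^{εᵢ}` over `(z₁, z₂, t, x)`. -/
abbrev cupFib {t : T n} (z₁ z₂ : FibT t) (x : SU n ⧸ T n) : HLine :=
  HLine.tensor fun i => (J i x).pow (eps i z₁ z₂)

/-- A point `(z₁, z₂, t, x)` of `Y_T^{[2]} × SU(n)/T`, nonzero elements `ℓᵢ` of the lines `Jᵢ` over `x`,
and a complex number `c`. -/
structure CupPoint (n : ℕ) where
  q : Sq (weylSubmersion n).Y
  l : ∀ i, J i q.1.x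
  l_ne : ∀ i, l i ≠ 0
  c : ℂ

/-- The product smooth structure. -/
instance : DiffeologicalSpace (CupPoint n) :=
  inducedD (sqD (weylSubmersion n).dY) CupPoint.q ⊓ inducedD (vecD ℂ) CupPoint.c ⊓
    (⨅ i, inducedD inferInstance fun a : CupPoint n => ((a.l i).1 : Assoc (weight i)))

/-- The element `c ⊗ᵢ ℓᵢ^{εᵢ}` of `⊗ᵢ Jᵢ^{εᵢ}`. -/
def cupMk (a : CupPoint n) : Σ q : Sq (weylSubmersion n).Y, cupFib q.2.1 q.2.2 q.1.x :=
  ⟨a.q, a.c • PiTensorProduct.tprod ℂ fun i => gen (a.l i) (eps i a.q.2.1 a.q.2.2)⟩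

theorem cupMk_surjective : Function.Surjective (cupMk (n := n)) := by
  rintro ⟨q, w⟩
  have hne : (PiTensorProduct.tprod ℂ fun i => gen (J i q.1.x).u₀ (eps i q.2.1 q.2.2) :
      cupFib q.2.1 q.2.2 q.1.x) ≠ 0 := tprod_ne_zero fun i => gen_ne (HLine.u₀_ne _) _
  obtain ⟨c, rfl⟩ := exists_smul hne w
  exact ⟨⟨q, fun i => (J i q.1.x).u₀, fun i => HLine.u₀_ne _, c⟩, rfl⟩

/-- The reduced product `(⊗ᵢ Jᵢ^{εᵢ}, Y_T × SU(n)/T)` of the cup product bundle gerbes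
`(Jᵢ^{εᵢ}, Y_T × SU(n)/T)` over `T × SU(n)/T`.  The smooth sections of `⊗ᵢ Jᵢ^{εᵢ}` are locally the `c ⊗ᵢ ℓᵢ^{εᵢ}`
with smooth functions `c` and nonvanishing smooth sections `ℓᵢ` of `Jᵢ`; the multiplication is the
tensor product of the canonical maps `Jᵢᵃ ⊗ Jᵢᵇ → Jᵢᵃ⁺ᵇ` (note that `εᵢ(z₁, z₃) = εᵢ(z₁, z₂) + εᵢ(z₂, z₃)`). -/
def cupGerbe (n : ℕ) : GerbeData (weylSubmersion n) where
  P {m} z₁ z₂ := cupFib z₁ z₂ m.x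
  dP := coinducedD inferInstance cupMk cupMk_surjective
  mul {m} z₁ z₂ z₃ := tensorMul fun i =>
    powMul (J i m.x) (eps i z₁ z₂) (eps i z₂ z₃) (eps i z₁ z₃)
  act h {_} z₁ z₂ := HIso.tensor fun i => (assocAct (weight i) h).pow (eps i z₁ z₂)

/-- The action of `s ∈ T` on `⊗ᵢ ℂ_{pᵢ}^{εᵢ}`. -/
def weightAct {t : T n} (z₁ z₂ : FibT t) (s : T n) :
    HIso (HLine.tensor fun i => ((weight i).L.pow (eps i z₁ z₂)))
      (HLine.tensor fun i => ((weight i).L.pow (eps i z₁ z₂))) :=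
  HIso.tensor fun i => (HIso.ofUnit ((weight i).act s) ((weight i).unit s)).pow (eps i z₁ z₂)

/-- For `g` in the coset `x`, the isomorphism `⊗ᵢ ℂ_{pᵢ}^{εᵢ} → ⊗ᵢ Jᵢ^{εᵢ}|ₓ` induced by the isomorphisms
`ℂ_{pᵢ} → Jᵢ|ₓ`, `z ↦ [z, g]`. -/
def weightFrame {t : T n} (z₁ z₂ : FibT t) (g : SU n) :
    HIso (HLine.tensor fun i => ((weight i).L.pow (eps i z₁ z₂))) (cupFib z₁ z₂ (g : SU n ⧸ T n)) :=
  HIso.tensor fun i => (assocFrame (weight i) g rfl).pow (eps i z₁ z₂)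

end WeylGerbe

end

open WeylGerbe

noncomputable section

namespace WeylGerbe

open HLine

/-! ### Signs in the exterior algebra -/

section Signs

variable {n : ℕ}

/-! Both gerbes can be trivialised after a choice of `g` in the coset `x`: each line over `(z₁, z₂,
t, gT)` contains a unit vector that depends smoothly on the data, is multiplicative, is carried by
`h ∈ SU(n)` to the vector belonging to `h g`, and changes by the character `∏ᵢ pᵢ(s)^{εᵢ}` when `g`
becomes `g s`. This is the structure `Framing`. In its coordinates the gerbe multiplication is
multiplication of numbers and the group action leaves coordinates unchanged, so all gerbe axioms
follow (`Framing.isEquivariantBundleGerbe`). Since both framings have the same character, matching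
them does not depend on `g` and gives the isomorphism over `SU(n)/T` (`Framing.iso_σ`,
`Framing.gerbeIso`).

For the cup product gerbe the vectors `⊗ᵢ [1, g]^{εᵢ}` work directly. The substance is a smooth
multiplicative unit vector `pbUnit` of `P_{b,T}`. Through `hat`, the multiplication becomes
composition in `Hom(det K(z₂), det K(z₁))`, so the maps `e_{K(z₂)} ↦ e_{K(z₁)}` are multiplicative.
They need not be smooth: with `I` and `J` the eigenvalue indices between `z₁ > z₂` and `z₂ > z₁`,
the coordinate with respect to the locally constant map `e_J ↦ e_I` is the sign `∏ᵢ crossSign(K,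
i)^{εᵢ}`, where `K` indexes the eigenvalues below both `z₁` and `z₂` (`hat_symm_homUnit`). An
eigenvalue passing through `1` enters or leaves `K` and can flip this sign.

The cure is `phase`, built from `exp(-iθ_k/2)` with `θ_k` the angle of `p_k(t)`. This half-angle
exponential changes sign exactly where `k` enters or leaves `K`, so its product with that sign is
smooth (`contDiff_twist`, `contDiff_pbCoeff`). The correction preserves multiplicativity, because
the quantities raised to the power `εᵢ` depend on `t` alone and `εᵢ` is additive (`phase_mul`). -/

theorem eB_eq_prod (I : Finset (Fin n)) : eB n I =
    (I.sort.map fun k => ExteriorAlgebra.ι ℂ (EuclideanSpace.single k (1 : ℂ))).prod := by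
  rw [eB_apply, ExteriorAlgebra.ιMulti_apply, ← Finset.listMap_orderEmbOfFin_finRange I rfl,
    List.map_map, List.ofFn_eq_map]
  rfl

theorem eB_empty : eB n ∅ = 1 := by
  rw [eB_eq_prod]; simp

/-- A new minimum is prepended to the sorted list, so no sign occurs. -/
theorem eB_insert {i : Fin n} {K : Finset (Fin n)} (h : ∀ k ∈ K, i < k) :
    eB n (insert i K) = ExteriorAlgebra.ι ℂ (EuclideanSpace.single i (1 : ℂ)) * eB n K := by
  have hi : i ∉ K := fun hk => lt_irrefl _ (h i hk)
  rw [eB_eq_prod, eB_eq_prod, Finset.sort_insert _ (fun k hk => (h k hk).le) hi, List.map_cons,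
    List.prod_cons]

/-- The sign picked up by moving `e_i` past all the `e_k`, `k ∈ K`, `k < i`. -/
def crossSign (K : Finset (Fin n)) (i : Fin n) : ℂ :=
  ∏ k ∈ Finset.Iio i, if k ∈ K then -1 else 1

/-- The defining product over `k < i` is the form that combines with `phase`; the product over `K`
is the one suited to induction on `K`. -/
theorem crossSign_eq (K : Finset (Fin n)) (i : Fin n) :
    crossSign K i = ∏ k ∈ K, if k < i then -1 else 1 := by
  rw [crossSign, ← Finset.prod_filter, ← Finset.prod_filter]
  congr 1
  ext k
  simp [and_comm]

theorem crossSign_insert {k : Fin n} {K : Finset (Fin n)} (hk : k ∉ K) (i : Fin n) :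
    crossSign (insert k K) i = (if k < i then -1 else 1) * crossSign K i := by
  rw [crossSign_eq, crossSign_eq, Finset.prod_insert hk]

theorem crossSign_eq_one {K : Finset (Fin n)} {i : Fin n} (h : ∀ k ∈ K, i < k) :
    crossSign K i = 1 := by
  rw [crossSign_eq]
  exact Finset.prod_eq_one fun k hk => if_neg (h k hk).le.not_gt

theorem crossSign_union {I K : Finset (Fin n)} (h : Disjoint I K) (i : Fin n) :
    crossSign (I ∪ K) i = crossSign I i * crossSign K i := by
  rw [crossSign_eq, crossSign_eq, crossSign_eq, Finset.prod_union h]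

theorem crossSign_mul_self (K : Finset (Fin n)) (i : Fin n) :
    crossSign K i * crossSign K i = 1 := by
  rw [crossSign, ← Finset.prod_mul_distrib]
  refine Finset.prod_eq_one fun k _ => ?_
  split_ifs <;> norm_num

/-- Induction adjoining a minimum `k` to `K`. If `i < k` there is nothing to cross. Otherwise `e_i`
anticommutes past `e_k`, and `k` stays the minimum of the enlarged set, so `eB_insert` applies
again. -/
theorem ι_mul_eB {i : Fin n} {K : Finset (Fin n)} (hi : i ∉ K) :
    ExteriorAlgebra.ι ℂ (EuclideanSpace.single i (1 : ℂ)) * eB n K =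
      crossSign K i • eB n (insert i K) := by
  induction K using Finset.induction_on_min with
  | empty => rw [crossSign_eq_one (by simp), one_smul, eB_insert (by simp)]
  | insert k K hk ih =>
    have hkK : k ∉ K := fun h => lt_irrefl _ (hk k h)
    rw [Finset.mem_insert, not_or] at hi
    rcases lt_or_gt_of_ne hi.1 with hik | hik
    · have hlt : ∀ j ∈ insert k K, i < j := by
        intro j hj
        rcases Finset.mem_insert.1 hj with rfl | hj
        · exact hik
        · exact hik.trans (hk j hj)
      rw [crossSign_eq_one hlt, one_smul, eB_insert hlt]
    · have hlt : ∀ j ∈ insert i K, k < j := by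
        intro j hj
        rcases Finset.mem_insert.1 hj with rfl | hj
        · exact hik
        · exact hk j hj
      rw [eB_insert hk, ← mul_assoc, eq_neg_of_add_eq_zero_left (ExteriorAlgebra.ι_add_mul_swap _ _),
        neg_mul, mul_assoc, ih hi.2, Finset.insert_comm, eB_insert hlt, crossSign_insert hkK,
        if_pos hik, mul_smul_comm, neg_one_mul, neg_smul]

/-- Peel off the minimum `i` of the left set: it crosses no other element of that set, so only `K`
contributes a sign. -/
theorem eB_mul_eq {I K : Finset (Fin n)} (h : Disjoint I K) :
    eB n I * eB n K = (∏ i ∈ I, crossSign K i) • eB n (I ∪ K) := by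
  induction I using Finset.induction_on_min with
  | empty => simp [eB_empty]
  | insert i I hi ih =>
    have hiI : i ∉ I := fun h => lt_irrefl _ (hi i h)
    rw [Finset.disjoint_insert_left] at h
    rw [eB_insert hi, mul_assoc, ih h.2, mul_smul_comm, ι_mul_eB (by simp [hiI, h.1]),
      crossSign_union h.2, crossSign_eq_one hi, one_mul, smul_smul, Finset.prod_insert hiI,
      mul_comm, Finset.insert_union]

/-- Splits the sign into one factor per index, which is what allows it to be rewritten with
exponents `εᵢ`. -/
theorem sgn_eq {I K : Finset (Fin n)} (h : Disjoint I K) :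
    sgn I K = ∏ i ∈ I, crossSign K i := by
  rw [sgn, eB_mul_eq h]
  simp

end Signs

/-! ### Smooth maps -/

section Smooth

variable {k : ℕ}

theorem smooth_of_eventuallyEq {X : Type} (d : DiffeologicalSpace X) {f : Eu k → X}
    (h : ∀ r, ∃ g : Eu k → X, SmoothMap d g ∧ f =ᶠ[𝓝 r] g) : SmoothMap d f := by
  refine d.locality fun r => ?_
  obtain ⟨g, hg, hfg⟩ := h r
  obtain ⟨u, hu, huo, hr⟩ := eventually_nhds_iff.1 hfg
  refine ⟨u, huo, hr, fun {m φ} hφu hφ => ?_⟩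
  rw [show f ∘ φ = g ∘ φ from funext fun x => hu _ (hφu x)]
  exact d.plot_reparam hg hφ

/-- Restriction to a neighbourhood is replaced by composition with a self-map `χ` that is the
identity near `r`. Lifts and frames that exist only locally are then defined on all of `ℝᵏ`, which
avoids partially defined dependent families. -/
theorem smooth_of_reparam {X : Type} (d : DiffeologicalSpace X) {f : Eu k → X}
    (h : ∀ r, ∃ χ : Eu k → Eu k, χ =ᶠ[𝓝 r] id ∧ SmoothMap d fun y => f (χ y)) :
    SmoothMap d f := by
  refine smooth_of_eventuallyEq d fun r => ?_
  obtain ⟨χ, hχ, hf⟩ := h r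
  exact ⟨_, hf, hχ.mono fun y hy => by simp only [hy, id]⟩

theorem smooth_inf {X : Type} {d e : DiffeologicalSpace X} {f : Eu k → X} :
    SmoothMap (d ⊓ e) f ↔ SmoothMap d f ∧ SmoothMap e f :=
  DiffeologicalSpace.isPlot_inf_iff

theorem smooth_vecD_iff {ι W : Type} [Fintype ι] [AddCommGroup W] [Module ℂ W]
    (b : Module.Basis ι ℂ W) {f : Eu k → W} :
    SmoothMap (vecD W) f ↔ ∀ i, ContDiff ℝ ∞ fun r => b.repr (f r) i := by
  refine ⟨fun h i => h (b.coord i), fun h φ => ?_⟩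
  have : (fun r => φ (f r)) = fun r => ∑ i, b.repr (f r) i * φ (b i) := by
    funext r
    conv_lhs => rw [← b.sum_repr (f r), map_sum]
    simp only [map_smul, smul_eq_mul]
  rw [this]
  exact ContDiff.sum fun i _ => (h i).mul contDiff_const

theorem smooth_vecD_complex {f : Eu k → ℂ} : SmoothMap (vecD ℂ) f ↔ ContDiff ℝ ∞ f := by
  rw [smooth_vecD_iff (Module.Basis.singleton Unit ℂ)]
  simp

theorem smooth_vecD_matrix {n : ℕ} {f : Eu k → Matrix (Fin n) (Fin n) ℂ} :
    SmoothMap (vecD (Matrix (Fin n) (Fin n) ℂ)) f ↔ ∀ i j, ContDiff ℝ ∞ fun r => f r i j := by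
  rw [smooth_vecD_iff (Matrix.stdBasis ℂ (Fin n) (Fin n))]
  have h (M : Matrix (Fin n) (Fin n) ℂ) (i j : Fin n) :
      (Matrix.stdBasis ℂ (Fin n) (Fin n)).repr M (i, j) = M i j := by
    simp [Matrix.stdBasis, Module.Basis.map_repr]
  exact ⟨fun H i j => by simpa only [h] using H (i, j), fun H ij => by simpa only [h] using H ij.1 ij.2⟩

variable {n : ℕ}

theorem smooth_SU {g : Eu k → SU n} : SmoothMap inferInstance g ↔
    ∀ i j, ContDiff ℝ ∞ fun r => (g r).1 i j :=
  smooth_vecD_matrix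

theorem SU.smooth_mul {g h : Eu k → SU n} (hg : SmoothMap inferInstance g)
    (hh : SmoothMap inferInstance h) : SmoothMap inferInstance fun r => g r * h r := by
  rw [smooth_SU] at *
  intro i j
  show ContDiff ℝ ∞ fun r => ((g r).1 * (h r).1) i j
  simp only [Matrix.mul_apply]
  exact ContDiff.sum fun l _ => (hg i l).mul (hh l j)

theorem SU.smooth_inv {g : Eu k → SU n} (hg : SmoothMap inferInstance g) :
    SmoothMap inferInstance fun r => (g r)⁻¹ := by
  rw [smooth_SU] at *
  intro i j
  exact Complex.conjCLE.contDiff.comp (hg j i)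

theorem smooth_p {t : Eu k → T n} (ht : SmoothMap inferInstance t) (i : Fin n) :
    ContDiff ℝ ∞ fun r => p i (t r) :=
  (smooth_SU (g := fun r => (t r).1)).1 ht i i

end Smooth

/-! ### Angles -/

section Angle

/-- On the unit circle the branch cut of `arg` is met by `-z` only at `z = 1`. -/
theorem neg_mem_slitPlane {z : ℂ} (hz : ‖z‖ = 1) (h1 : z ≠ 1) : -z ∈ Complex.slitPlane := by
  rw [Complex.mem_slitPlane_iff]
  by_contra! h
  simp only [Complex.neg_re, Complex.neg_im, neg_eq_zero, neg_nonpos] at h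
  obtain ⟨x, hx⟩ : ∃ x : ℝ, z = x := ⟨z.re, Complex.ext rfl h.2⟩
  rw [hx, Complex.ofReal_re] at h
  rw [hx, Complex.norm_real, Real.norm_of_nonneg h.1] at hz
  exact h1 (by rw [hx, hz, Complex.ofReal_one])

theorem ang_pos (z : ℂ) : 0 < ang z := by
  have := Complex.neg_pi_lt_arg (-z)
  rw [ang]; linarith

/-- The value `2π` would require `arg (-z) = π`, that is, `-z` on the cut. -/
theorem ang_lt {z : ℂ} (hz : ‖z‖ = 1) (h1 : z ≠ 1) : ang z < 2 * Real.pi := by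
  have := Complex.arg_le_pi (-z)
  have := (Complex.mem_slitPlane_iff_arg.1 (neg_mem_slitPlane hz h1)).1
  rw [ang, two_mul]
  gcongr
  exact lt_of_le_of_ne ‹_› this

/-- The argument is the imaginary part of the logarithm, which is smooth off the cut. -/
theorem contDiffAt_arg {E : Type} [NormedAddCommGroup E] [NormedSpace ℝ E] {f : E → ℂ} {r : E}
    (hf : ContDiffAt ℝ ∞ f r) (h : f r ∈ Complex.slitPlane) :
    ContDiffAt ℝ ∞ (fun x => Complex.arg (f x)) r := by
  have h1 : ContDiffAt ℝ ∞ (fun x => Complex.log (f x)) r :=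
    ((Complex.contDiffAt_log h).restrict_scalars ℝ).comp r hf
  have h2 := Complex.imCLM.contDiff.contDiffAt.comp r h1
  exact h2.congr_of_eventuallyEq (Eventually.of_forall fun x => (Complex.log_im _).symm)

theorem contDiffAt_ang {E : Type} [NormedAddCommGroup E] [NormedSpace ℝ E] {f : E → ℂ} {r : E}
    (hf : ContDiffAt ℝ ∞ f r) (hr : ‖f r‖ = 1) (h : f r ≠ 1) :
    ContDiffAt ℝ ∞ (fun x => ang (f x)) r :=
  (contDiffAt_arg hf.neg (neg_mem_slitPlane hr h)).add contDiffAt_const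

/-- Near `1` the angle is discontinuous but the principal argument is smooth; this expresses the
former by the latter. At `z = 1` itself the second branch applies, with value `2π`. -/
theorem ang_of_re_pos {z : ℂ} (hz : 0 < z.re) :
    ang z = if 0 < Complex.arg z then Complex.arg z else Complex.arg z + 2 * Real.pi := by
  have hz0 : z ≠ 0 := by rintro rfl; simp at hz
  rcases lt_trichotomy z.im 0 with h | h | h
  · rw [if_neg (Complex.arg_neg_iff.2 h).not_gt, ang, Complex.arg_neg_eq_arg_add_pi_of_im_neg h]
    ring
  · obtain ⟨x, rfl⟩ : ∃ x : ℝ, z = x := ⟨z.re, Complex.ext rfl h⟩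
    rw [Complex.ofReal_re] at hz
    rw [Complex.arg_ofReal_of_nonneg hz.le, if_neg (lt_irrefl _), ang, ← Complex.ofReal_neg,
      Complex.arg_ofReal_of_neg (neg_neg_of_pos hz)]
    ring
  · have : 0 < Complex.arg z := lt_of_le_of_ne (Complex.arg_nonneg_iff.2 h.le) fun h0 => by
      have := (Complex.arg_eq_zero_iff.1 h0.symm).2
      exact h.ne' this
    rw [if_pos this, ang, Complex.arg_neg_eq_arg_sub_pi_of_im_pos h]
    ring

/-- A square root of `p_k(t)⁻¹`, which jumps by a sign at `p_k(t) = 1`. -/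
def halfRoot {n : ℕ} (k : Fin n) (t : T n) : ℂ := Complex.exp (-(ang (p k t) / 2 : ℝ) * Complex.I)

theorem norm_halfRoot {n : ℕ} (k : Fin n) (t : T n) : ‖halfRoot k t‖ = 1 := by
  rw [halfRoot, ← Complex.ofReal_neg, Complex.norm_exp_ofReal_mul_I]

end Angle

/-! ### Families of points of `Y_T` -/

section Families

variable {n k : ℕ}

theorem mem_below {t : T n} {z : ℂ} {i : Fin n} : i ∈ below t z ↔ ang (p i t) < ang z := by
  simp [below, mem_idx]

/-- Neither `z₁` nor `z₂` is an eigenvalue, so ties of angles are excluded and `εᵢ` is a difference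
of indicators. Additivity and local constancy of `εᵢ` are read off from this form. -/
theorem eps_eq_sub (i : Fin n) {t : T n} (z₁ z₂ : FibT t) : eps i z₁ z₂ =
    (if i ∈ below t z₁.z then 1 else 0) - (if i ∈ below t z₂.z then 1 else 0) := by
  have h1 := ang_ne z₁ i
  have h2 := ang_ne z₂ i
  simp only [eps, mem_below]
  rcases lt_or_gt_of_ne h1 with h1 | h1 <;> rcases lt_or_gt_of_ne h2 with h2 | h2 <;>
    simp [h1, h2, h1.not_gt, h2.not_gt]

theorem eps_add (i : Fin n) {t : T n} (z₁ z₂ z₃ : FibT t) :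
    eps i z₁ z₃ = eps i z₁ z₂ + eps i z₂ z₃ := by
  simp only [eps_eq_sub]; ring

theorem mem_sdiff_below {i : Fin n} {t : T n} (z₁ z₂ : FibT t) :
    i ∈ below t z₁.z \ below t z₂.z ↔ eps i z₁ z₂ = 1 := by
  rw [eps_eq_sub, Finset.mem_sdiff]
  split_ifs <;> simp_all

/-- The factor by which the `k`-th coordinate direction enters the coordinate of the determinant lines:
smooth on `Y_T^{[2]}`, unlike `halfRoot`. -/
def twist (k : Fin n) {t : T n} (z₁ z₂ : FibT t) : ℂ :=
  (if k ∈ below t z₁.z ∩ below t z₂.z then -1 else 1) * halfRoot k t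

theorem norm_twist (i : Fin n) {t : T n} (z₁ z₂ : FibT t) : ‖twist i z₁ z₂‖ = 1 := by
  rw [twist, norm_mul, norm_halfRoot]
  split_ifs <;> simp

theorem twist_ne (i : Fin n) {t : T n} (z₁ z₂ : FibT t) : twist i z₁ z₂ ≠ 0 :=
  norm_pos_iff.1 (by rw [norm_twist]; exact one_pos)

variable {t : Eu k → T n} (ht : ∀ i, ContDiff ℝ ∞ fun r => p i (t r))

include ht

/-- Away from the eigenvalue `1` both angles are continuous, and they are distinct at `r₀`, so their
order persists. -/
theorem eventually_below_iff (z : ∀ r, FibT (t r)) (hz : ContDiff ℝ ∞ fun r => (z r).z) (r₀ : Eu k)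
    {i : Fin n} (hi : p i (t r₀) ≠ 1) :
    ∀ᶠ r in 𝓝 r₀, (i ∈ below (t r) (z r).z ↔ i ∈ below (t r₀) (z r₀).z) := by
  have h1 := (contDiffAt_ang (ht i).contDiffAt (norm_p i (t r₀)) hi).continuousAt
  have h2 := (contDiffAt_ang hz.contDiffAt (z r₀).norm_z (z r₀).ne_one).continuousAt
  simp only [mem_below]
  rcases lt_or_gt_of_ne (ang_ne (z r₀) i) with h | h
  · filter_upwards [h1.eventually_lt h2 h] with r hr
    exact ⟨fun _ => h, fun _ => hr⟩
  · filter_upwards [h2.eventually_lt h1 h] with r hr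
    exact ⟨fun h' => absurd h' hr.not_gt, fun h' => absurd h' h.not_gt⟩

/-- The angle of `z` lies strictly between `0` and `2π`, while that of an eigenvalue near `1` is
close to one of these ends. Hence membership depends only on the side of `1` on which the eigenvalue
lies, and not on `z`. -/
theorem eventually_below_iff_arg (z : ∀ r, FibT (t r)) (hz : ContDiff ℝ ∞ fun r => (z r).z)
    (r₀ : Eu k) {i : Fin n} (hi : p i (t r₀) = 1) :
    ∀ᶠ r in 𝓝 r₀, (i ∈ below (t r) (z r).z ↔ 0 < Complex.arg (p i (t r))) := by
  have h2 := (contDiffAt_ang hz.contDiffAt (z r₀).norm_z (z r₀).ne_one).continuousAt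
  have h1 := (contDiffAt_arg (ht i).contDiffAt (by rw [hi]; simp)).continuousAt
  have h3 : ∀ᶠ r in 𝓝 r₀, 0 < (p i (t r)).re := by
    have : ContinuousAt (fun r => (p i (t r)).re) r₀ :=
      Complex.continuous_re.continuousAt.comp (ht i).continuous.continuousAt
    exact this.eventually_const_lt (by simp [hi])
  have h4 : ∀ᶠ r in 𝓝 r₀, Complex.arg (p i (t r)) < ang (z r).z :=
    h1.eventually_lt h2 (by rw [hi, Complex.arg_one]; exact ang_pos _)
  have h5 : ∀ᶠ r in 𝓝 r₀, ang (z r).z < Complex.arg (p i (t r)) + 2 * Real.pi :=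
    h2.eventually_lt (h1.add continuousAt_const) (by
      simpa [hi] using ang_lt (z r₀).norm_z (z r₀).ne_one)
  filter_upwards [h3, h4, h5] with r h3 h4 h5
  rw [mem_below, ang_of_re_pos h3]
  split_ifs with h
  · simp [h, h4]
  · simp [h, h5.le]

variable {z₁ z₂ : ∀ r, FibT (t r)} (hz₁ : ContDiff ℝ ∞ fun r => (z₁ r).z)
  (hz₂ : ContDiff ℝ ∞ fun r => (z₂ r).z)

include hz₁ hz₂

/-- At an eigenvalue `1` the two indicators in `eps_eq_sub` may jump, but they jump together, so
their difference stays zero. At the other eigenvalues both are locally constant. -/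
theorem eventually_eps_eq (r₀ : Eu k) :
    ∀ᶠ r in 𝓝 r₀, ∀ i, eps i (z₁ r) (z₂ r) = eps i (z₁ r₀) (z₂ r₀) := by
  rw [eventually_all]
  intro i
  by_cases hi : p i (t r₀) = 1
  · have h1 := eventually_below_iff_arg ht z₁ hz₁ r₀ hi
    have h2 := eventually_below_iff_arg ht z₂ hz₂ r₀ hi
    filter_upwards [h1, h2] with r h1' h2'
    have h3 := h1.self_of_nhds
    have h4 := h2.self_of_nhds
    simp only [eps_eq_sub, h1', h2', h3, h4, sub_self]
  · filter_upwards [eventually_below_iff ht z₁ hz₁ r₀ hi, eventually_below_iff ht z₂ hz₂ r₀ hi]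
      with r h1 h2
    simp only [eps_eq_sub, h1, h2]

/-- The indicator sign and the half-angle exponential have cancelling jumps at the eigenvalue `1`;
elsewhere the sign is locally constant and the angle is smooth. -/
theorem contDiff_twist (i : Fin n) : ContDiff ℝ ∞ fun r => twist i (z₁ r) (z₂ r) := by
  rw [contDiff_iff_contDiffAt]
  intro r₀
  by_cases hi : p i (t r₀) = 1
  · have h0 := contDiffAt_arg (ht i).contDiffAt (by rw [hi]; simp : p i (t r₀) ∈ _)
    have h3 : ∀ᶠ r in 𝓝 r₀, 0 < (p i (t r)).re := by
      have : ContinuousAt (fun r => (p i (t r)).re) r₀ :=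
        Complex.continuous_re.continuousAt.comp (ht i).continuous.continuousAt
      exact this.eventually_const_lt (by simp [hi])
    -- The common smooth expression on both sides of `1`: for positive argument the minus sign comes
    -- from membership in both sets, and otherwise from adding `2π` to the argument, which
    -- multiplies the exponential by `exp(-πi) = -1`.
    have h4 : ContDiffAt ℝ ∞ (fun r =>
        -Complex.exp (-(Complex.arg (p i (t r)) / 2 : ℝ) * Complex.I)) r₀ :=
      (((Complex.ofRealCLM.contDiff.contDiffAt.comp r₀ (h0.div_const 2)).neg.mul
        contDiffAt_const).cexp).neg
    refine h4.congr_of_eventuallyEq ?_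
    filter_upwards [h3, eventually_below_iff_arg ht z₁ hz₁ r₀ hi,
      eventually_below_iff_arg ht z₂ hz₂ r₀ hi] with r h3 h1 h2
    simp only [twist, Finset.mem_inter, h1, h2, and_self, halfRoot, ang_of_re_pos h3]
    split_ifs with h
    · ring
    · have : (-((((p i (t r)).arg + 2 * Real.pi) / 2 : ℝ) : ℂ) * Complex.I) =
          -(((p i (t r)).arg / 2 : ℝ) : ℂ) * Complex.I - Real.pi * Complex.I := by
        push_cast; ring
      rw [this, Complex.exp_sub, Complex.exp_pi_mul_I, div_neg, div_one, one_mul]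
  · have h0 := contDiffAt_ang (ht i).contDiffAt (norm_p i (t r₀)) hi
    have h4 : ContDiffAt ℝ ∞ (fun r => (if i ∈ below (t r₀) (z₁ r₀).z ∩ below (t r₀) (z₂ r₀).z
        then (-1 : ℂ) else 1) * Complex.exp (-(ang (p i (t r)) / 2 : ℝ) * Complex.I)) r₀ :=
      contDiffAt_const.mul ((Complex.ofRealCLM.contDiff.contDiffAt.comp r₀ (h0.div_const 2)).neg.mul
        contDiffAt_const).cexp
    refine h4.congr_of_eventuallyEq ?_
    filter_upwards [eventually_below_iff ht z₁ hz₁ r₀ hi, eventually_below_iff ht z₂ hz₂ r₀ hi]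
      with r h1 h2
    simp only [twist, Finset.mem_inter, h1, h2, halfRoot]

/-- Products of the form `∏ᵢ fᵢ^{εᵢ}` are smooth. -/
theorem contDiffAt_prod_zpow_eps {f : Fin n → Eu k → ℂ} {r₀ : Eu k}
    (hf : ∀ i, ContDiffAt ℝ ∞ (f i) r₀) (h0 : ∀ i, f i r₀ ≠ 0) :
    ContDiffAt ℝ ∞ (fun r => ∏ i, f i r ^ eps i (z₁ r) (z₂ r)) r₀ := by
  have hz : ∀ (e : ℤ) (i : Fin n), ContDiffAt ℝ ∞ (fun r => f i r ^ e) r₀ := by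
    intro e i
    cases e with
    | ofNat m => simpa using (hf i).pow m
    | negSucc m => simpa only [zpow_negSucc] using
        ((hf i).pow (m + 1)).fun_inv (pow_ne_zero _ (h0 i))
  -- The exponents are frozen at their values at `r₀`, which is harmless because they are locally
  -- constant.
  refine (contDiffAt_prod (t := Finset.univ) fun i _ =>
    hz (eps i (z₁ r₀) (z₂ r₀)) i).congr_of_eventuallyEq ?_
  filter_upwards [eventually_eps_eq ht hz₁ hz₂ r₀] with r hr
  simp only [hr]

end Families

/-! ### Hermitian lines with a distinguished unit vector -/

section Lines

theorem coord_smul_self {A : HLine} {u : A} (h : u ≠ 0) (c : ℂ) : A.coord u (c • u) = c := by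
  rw [map_smul, coord_self h, smul_eq_mul, mul_one]

/-- The isometric isomorphism of lines that maps the unit vector `u` to the unit vector `v`. -/
def HIso.ofGen {A B : HLine} {u : A} {v : B} (hu : u ∈ A.U) (hv : v ∈ B.U) : HIso A B :=
  HIso.ofUnit ((A.coord u).smulRight v) fun a ha => by
    obtain ⟨c, rfl⟩ := exists_smul (HLine.ne_zero hu) a
    rw [smul_mem_U hu] at ha
    rw [LinearMap.smulRight_apply, coord_smul_self (HLine.ne_zero hu), smul_mem_U hv]
    exact ha

theorem HIso.ofGen_gen {A B : HLine} {u : A} {v : B} (hu : u ∈ A.U) (hv : v ∈ B.U) :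
    (HIso.ofGen hu hv).e u = v := by
  show A.coord u u • v = v
  rw [coord_self (HLine.ne_zero hu), one_smul]

theorem HIso.coord_apply {A B : HLine} (f : HIso A B) {u : A} (hu : u ≠ 0) (a : A) :
    B.coord (f.e u) (f.e a) = A.coord u a := by
  obtain ⟨c, rfl⟩ := exists_smul hu a
  rw [map_smul, coord_smul_self hu, coord_smul_self (f.ne_zero hu)]

/-- Since coordinates are preserved in both directions, an isomorphism matching two frames and its
inverse are smooth for the same reason. -/
theorem HIso.coord_symm_apply {A B : HLine} (f : HIso A B) {u : A} (hu : u ≠ 0) (b : B) :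
    A.coord u (f.e.symm b) = B.coord (f.e u) b := by
  rw [← f.coord_apply hu, LinearEquiv.apply_symm_apply]

end Lines

/-! ### The submersion -/

section Submersion

variable {n k : ℕ}

theorem smooth_sq {q : Eu k → Sq (fun t : T n => FibT t)} : SmoothMap (sqD inferInstance) q ↔
    SmoothMap inferInstance (fun r => (q r).1) ∧ (ContDiff ℝ ∞ fun r => (q r).2.1.z) ∧
      ContDiff ℝ ∞ fun r => (q r).2.2.z := by
  have h : SmoothMap (sqD inferInstance) q ↔
    (SmoothMap inferInstance (fun r => (q r).1) ∧ SmoothMap (vecD ℂ) fun r => (q r).2.1.z) ∧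
      SmoothMap inferInstance (fun r => (q r).1) ∧ SmoothMap (vecD ℂ) fun r => (q r).2.2.z :=
    smooth_inf.trans (and_congr smooth_inf smooth_inf)
  rw [h, smooth_vecD_complex, smooth_vecD_complex]
  tauto

theorem smooth_base {m : Eu k → Base n} : SmoothMap inferInstance m ↔
    SmoothMap inferInstance (fun r => (m r).t) ∧ SmoothMap inferInstance fun r => (m r).x :=
  smooth_inf

theorem smooth_weyl {y : Eu k → Σ m, (weylSubmersion n).Y m} :
    SmoothMap (weylSubmersion n).dY y ↔ SmoothMap inferInstance (fun r => (y r).1) ∧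
      ContDiff ℝ ∞ fun r => (show FibT _ from (y r).2).z := by
  rw [← smooth_vecD_complex]
  exact smooth_inf

theorem smooth_sq_weyl {q : Eu k → Sq (weylSubmersion n).Y} :
    SmoothMap (sqD (weylSubmersion n).dY) q ↔
      SmoothMap inferInstance (fun r => (q r).1) ∧
      (ContDiff ℝ ∞ fun r => (show FibT _ from (q r).2.1).z) ∧
      ContDiff ℝ ∞ fun r => (show FibT _ from (q r).2.2).z := by
  refine smooth_inf.trans ((and_congr smooth_weyl smooth_weyl).trans ?_)
  tauto

/-- Smooth maps to `SU(n)/T` lift locally to `SU(n)`. -/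
theorem exists_lift {x : Eu k → SU n ⧸ T n} (hx : SmoothMap inferInstance x) (r₀ : Eu k) :
    ∃ χ : Eu k → Eu k, ContDiff ℝ ∞ χ ∧ χ =ᶠ[𝓝 r₀] id ∧ ∃ g : Eu k → SU n,
      SmoothMap inferInstance g ∧ ∀ r, (g r : SU n ⧸ T n) = x (χ r) := by
  obtain ⟨g, hg, hxg⟩ := hx r₀
  obtain ⟨χ, hχ, hu, he⟩ := exists_retract r₀ hxg
  exact ⟨χ, hχ, he, g ∘ χ, DiffeologicalSpace.plot_reparam hg hχ, fun r => (hu r).symm⟩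

theorem smooth_smul {g : Eu k → SU n} {x : Eu k → SU n ⧸ T n} (hg : SmoothMap inferInstance g)
    (hx : SmoothMap inferInstance x) : SmoothMap inferInstance fun r => g r • x r := by
  intro r₀
  obtain ⟨h, hh, hxh⟩ := hx r₀
  refine ⟨fun r => g r * h r, SU.smooth_mul hg hh, hxh.mono fun r hr => ?_⟩
  show g r • x r = _
  rw [hr]
  rfl

/-- The circle is infinite: the points `exp(i/(m+1))` are distinct, since `1/(m+1)` lies in the
range of the principal argument. -/
theorem exists_norm_one_notMem (s : Finset ℂ) : ∃ z : ℂ, ‖z‖ = 1 ∧ z ∉ s := by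
  have h : (Metric.sphere (0 : ℂ) 1).Infinite := by
    refine Set.infinite_of_injective_forall_mem (f := fun m : ℕ =>
      Complex.exp (((1 / (m + 1) : ℝ) : ℂ) * Complex.I)) (fun a b hab => ?_) fun m => ?_
    · have hb (m : ℕ) : Complex.arg (Complex.exp (((1 / (m + 1) : ℝ) : ℂ) * Complex.I)) =
          1 / (m + 1) := by
        rw [Complex.arg_exp_mul_I, toIocMod_eq_self]
        have h1 : (1 : ℝ) / (m + 1) ≤ 1 := by
          rw [div_le_one (by positivity)]; linarith [(Nat.cast_nonneg m : (0 : ℝ) ≤ m)]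
        have h2 : (0 : ℝ) < 1 / (m + 1) := by positivity
        constructor <;> linarith [Real.pi_gt_three]
      have := congrArg Complex.arg hab
      simp only [hb] at this
      field_simp at this
      exact_mod_cast (add_right_cancel this).symm
    · rw [mem_sphere_zero_iff_norm]
      exact Complex.norm_exp_ofReal_mul_I _
  obtain ⟨z, hz, hs⟩ := h.exists_notMem_finset s
  exact ⟨z, mem_sphere_zero_iff_norm.1 hz, hs⟩

theorem FibT.nonempty (t : T n) : Nonempty (FibT t) := by
  classical
  obtain ⟨z, hz, hs⟩ := exists_norm_one_notMem (insert 1 (Finset.univ.image fun i => p i t))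
  simp only [Finset.mem_insert, Finset.mem_image, Finset.mem_univ, true_and, not_or,
    not_exists] at hs
  exact ⟨⟨z, hz, hs.1, fun i h => hs.2 i h.symm⟩⟩

theorem weylSubmersion_isEquivariantSubmersion (n : ℕ) :
    (weylSubmersion n).IsEquivariantSubmersion inferInstance inferInstance where
  nonempty m := FibT.nonempty m.t
  smooth_proj k y hy := (smooth_weyl.1 hy).1
  local_section k b hb r₀ y₀ := by
    let z₀ : FibT (b r₀).t := y₀
    have ht := (smooth_base.1 hb).1
    -- The local section keeps `z` constant. It avoids the eigenvalues only near `r₀`, so the base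
    -- is composed with a retraction into this neighbourhood.
    have h : ∀ᶠ r in 𝓝 r₀, ∀ i, z₀.z ≠ p i (b r).t := by
      rw [eventually_all]
      intro i
      exact ((smooth_p ht i).continuous.continuousAt.eventually_ne (z₀.ne_p i).symm).mono
        fun r hr => hr.symm
    obtain ⟨χ, hχ, hu, he⟩ := exists_retract r₀ h
    let s : ∀ r, FibT (b (χ r)).t := fun r => ⟨z₀.z, z₀.norm_z, z₀.ne_one, hu r⟩
    refine ⟨fun r => ⟨b (χ r), s r⟩, smooth_weyl.2 ⟨DiffeologicalSpace.plot_reparam hb hχ,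
      contDiff_const⟩, ?_, he.mono fun r hr => by simp only [hr, id]⟩
    have h0 : χ r₀ = r₀ := he.self_of_nhds
    -- The fibre type depends on the base point, so `χ r₀` is generalised to a variable that can be
    -- substituted.
    have key : ∀ (r : Eu k) (hr : r = r₀) (y : FibT (b r).t), y.z = z₀.z →
        (⟨b r, y⟩ : Σ m, (weylSubmersion n).Y m) = ⟨b r₀, y₀⟩ := by
      rintro r rfl ⟨z, _, _, _⟩ hz
      obtain rfl : z = z₀.z := hz
      rfl
    exact key _ h0 _ rfl
  smooth_act_base k g b hg hb :=
    smooth_base.2 ⟨(smooth_base.1 hb).1, smooth_smul hg (smooth_base.1 hb).2⟩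
  smooth_act k g y hg hy := by
    have h := smooth_weyl.1 hy
    have hb := smooth_base.1 h.1
    exact smooth_weyl.2 ⟨smooth_base.2 ⟨hb.1, smooth_smul hg hb.2⟩, h.2⟩
  act_one m y := by
    have key : ∀ x : SU n ⧸ T n, x = m.x →
        (⟨⟨m.t, x⟩, y⟩ : Σ m, (weylSubmersion n).Y m) = ⟨m, y⟩ := by
      rintro x rfl; rfl
    exact key _ (one_smul _ _)
  act_mul g h m y := by
    have key : ∀ x x' : SU n ⧸ T n, x = x' →
        (⟨⟨m.t, x⟩, y⟩ : Σ m, (weylSubmersion n).Y m) = ⟨⟨m.t, x'⟩, y⟩ := by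
      rintro x _ rfl; rfl
    exact key _ _ (mul_smul g h m.x)

end Submersion

/-! ### Framed bundle gerbes -/

section Framing

variable {n k : ℕ}

/-- The character by which `s ∈ T` acts on the line over `(z₁, z₂, t)`. -/
def epsChar {t : T n} (z₁ z₂ : FibT t) (s : T n) : ℂ := ∏ i, p i s ^ eps i z₁ z₂

theorem smul_base_x {g : SU n} {m : Base n} (h : SU n) (hg : (g : SU n ⧸ T n) = m.x) :
    ((h * g : SU n) : SU n ⧸ T n) = (h • m).x :=
  congrArg (h • ·) hg

/-- A smooth family of unit vectors `σ_g` in the lines of a bundle gerbe, compatible with all the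
structure, over the points `gT` of `SU(n)/T`, on which `T` acts by `epsChar` from the right. -/
structure Framing (A : GerbeData (weylSubmersion n)) where
  σ : ∀ (m : Base n) (g : SU n), (g : SU n ⧸ T n) = m.x →
    ∀ y₁ y₂ : (weylSubmersion n).Y m, A.P y₁ y₂
  unit : ∀ m g hg y₁ y₂, σ m g hg y₁ y₂ ∈ (A.P y₁ y₂).U
  mul : ∀ m g hg y₁ y₂ y₃, A.mul y₁ y₂ y₃ (σ m g hg y₁ y₂) (σ m g hg y₂ y₃) = σ m g hg y₁ y₃
  act : ∀ (h : SU n) m g hg y₁ y₂, (A.act h y₁ y₂).e (σ m g hg y₁ y₂) =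
    σ (h • m) (h * g) (smul_base_x h hg) ((weylSubmersion n).act h y₁) ((weylSubmersion n).act h y₂)
  weight : ∀ m g hg (s : T n) hgs y₁ y₂, σ m (g * s) hgs y₁ y₂ =
    epsChar (t := m.t) y₁ y₂ s • σ m g hg y₁ y₂
  smooth_proj : ∀ {k : ℕ} {v : Eu k → A.Total}, SmoothMap A.dP v →
    SmoothMap (sqD (weylSubmersion n).dY) fun r => (v r).1
  smooth : ∀ {k : ℕ} (q : Eu k → Sq (weylSubmersion n).Y) (g : Eu k → SU n)
    (hg : ∀ r, (g r : SU n ⧸ T n) = (q r).1.x) (c : Eu k → ℂ),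
    SmoothMap (sqD (weylSubmersion n).dY) q → SmoothMap inferInstance g →
    (SmoothMap A.dP (fun r => (⟨q r, c r • σ _ (g r) (hg r) (q r).2.1 (q r).2.2⟩ : A.Total)) ↔
      ContDiff ℝ ∞ c)

namespace Framing

variable {A B : GerbeData (weylSubmersion n)} (F : Framing A) (F' : Framing B)

theorem ne (m g hg y₁ y₂) : F.σ m g hg y₁ y₂ ≠ 0 := HLine.ne_zero (F.unit m g hg y₁ y₂)

/-- Every family is its coordinate times the frame, so smoothness in the total space becomes
smoothness of one complex function. -/
theorem smooth_iff {v : Eu k → A.Total} {g : Eu k → SU n}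
    (hg : ∀ r, (g r : SU n ⧸ T n) = (v r).1.1.x) (hgs : SmoothMap inferInstance g)
    (hv : SmoothMap (sqD (weylSubmersion n).dY) fun r => (v r).1) :
    SmoothMap A.dP v ↔ ContDiff ℝ ∞ fun r =>
      (A.P _ _).coord (F.σ _ (g r) (hg r) (v r).1.2.1 (v r).1.2.2) (v r).2 := by
  rw [← F.smooth (fun r => (v r).1) g hg _ hv hgs]
  simp only [coord_smul (F.ne _ _ _ _ _)]

/-- A framing needs a representative `g` of the coset; smooth representatives exist locally. -/
theorem exists_frame {q : Eu k → Sq (weylSubmersion n).Y}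
    (hq : SmoothMap (sqD (weylSubmersion n).dY) q) (r₀ : Eu k) :
    ∃ χ : Eu k → Eu k, ContDiff ℝ ∞ χ ∧ χ =ᶠ[𝓝 r₀] id ∧ ∃ g : Eu k → SU n,
      SmoothMap inferInstance g ∧ ∀ r, (g r : SU n ⧸ T n) = (q (χ r)).1.x :=
  exists_lift (smooth_base.1 (smooth_sq_weyl.1 hq).1).2 r₀

theorem coord_mul {m : Base n} {g : SU n} (hg : (g : SU n ⧸ T n) = m.x)
    (y₁ y₂ y₃ : (weylSubmersion n).Y m) (v : A.P y₁ y₂) (w : A.P y₂ y₃) :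
    (A.P y₁ y₃).coord (F.σ m g hg y₁ y₃) (A.mul y₁ y₂ y₃ v w) =
      (A.P y₁ y₂).coord (F.σ m g hg y₁ y₂) v * (A.P y₂ y₃).coord (F.σ m g hg y₂ y₃) w := by
  obtain ⟨a, rfl⟩ := exists_smul (F.ne m g hg y₁ y₂) v
  obtain ⟨b, rfl⟩ := exists_smul (F.ne m g hg y₂ y₃) w
  simp only [map_smul, LinearMap.smul_apply, F.mul, coord_self (F.ne m g hg _ _), smul_eq_mul,
    mul_one, mul_comm]

/-- The base points in the action laws agree only propositionally, so frame vectors are compared in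
the total space. -/
theorem pt_congr {t : T n} {x x' : SU n ⧸ T n} (hx : x = x') {g g' : SU n} (hgg : g = g')
    (hg : (g : SU n ⧸ T n) = x) (hg' : (g' : SU n ⧸ T n) = x') (z₁ z₂ : FibT t) (c : ℂ) :
    A.pt (m := ⟨t, x⟩) z₁ z₂ (c • F.σ ⟨t, x⟩ g hg z₁ z₂) =
      A.pt (m := ⟨t, x'⟩) z₁ z₂ (c • F.σ ⟨t, x'⟩ g' hg' z₁ z₂) := by
  subst hx hgg; rfl

theorem exists_eq_smul {m : Base n} (y₁ y₂ : (weylSubmersion n).Y m) (v : A.P y₁ y₂) :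
    ∃ (g : SU n) (hg : (g : SU n ⧸ T n) = m.x) (c : ℂ), v = c • F.σ m g hg y₁ y₂ := by
  obtain ⟨g, hg⟩ := QuotientGroup.mk_surjective m.x
  exact ⟨g, hg, exists_smul (F.ne m g hg y₁ y₂) v⟩

include F in
-- The algebraic axioms are checked on multiples of frame vectors. For the smoothness axioms, choose
-- a local smooth `g` and pass to coordinates, where multiplication is the product of functions and
-- the action is the identity.
theorem isEquivariantBundleGerbe : A.IsEquivariantBundleGerbe inferInstance inferInstance where
  submersion := weylSubmersion_isEquivariantSubmersion n
  smooth_proj k v hv := F.smooth_proj hv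
  locally_trivial k q hq r₀ := by
    classical
    obtain ⟨g, hg, hxg⟩ := (smooth_base.1 (smooth_sq_weyl.1 hq).1).2 r₀
    -- The local section must be a unit vector at every `r`. Where `g` fails to represent the coset
    -- an arbitrary unit vector is used; the neighbourhood in the statement excludes these points.
    refine ⟨_, hxg, fun r => if h : (g r : SU n ⧸ T n) = (q r).1.x then
      F.σ _ (g r) h (q r).2.1 (q r).2.2 else HLine.u₀ _, fun r => ?_, fun l φ c hφ hW => ?_⟩
    · dsimp only
      split_ifs with h
      · exact F.unit _ _ _ _ _
      · exact HLine.u₀_mem _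
    · have h (x : Eu l) : (g (φ x) : SU n ⧸ T n) = (q (φ x)).1.x := (hW x).symm
      simp only [h, dite_true]
      exact F.smooth (q ∘ φ) (g ∘ φ) h c (DiffeologicalSpace.plot_reparam (self := sqD _) hq hφ)
        (DiffeologicalSpace.plot_reparam hg hφ)
  mul_unit {m} y₁ y₂ y₃ v hv w hw := by
    obtain ⟨g, hg, a, rfl⟩ := F.exists_eq_smul _ _ v
    obtain ⟨b, rfl⟩ := exists_smul (F.ne m g hg y₂ y₃) w
    rw [smul_mem_U (F.unit _ _ _ _ _)] at hv hw
    rw [map_smul, map_smul, LinearMap.smul_apply, F.mul, smul_smul, smul_mem_U (F.unit _ _ _ _ _),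
      norm_mul, hv, hw, one_mul]
  mul_assoc {m} y₁ y₂ y₃ y₄ u v w := by
    obtain ⟨g, hg, a, rfl⟩ := F.exists_eq_smul _ _ u
    obtain ⟨b, rfl⟩ := exists_smul (F.ne m g hg y₂ y₃) v
    obtain ⟨c, rfl⟩ := exists_smul (F.ne m g hg y₃ y₄) w
    simp only [map_smul, LinearMap.smul_apply, F.mul]
  smooth_mul k m y₁ y₂ y₃ v w hv hw := by
    have hqv := F.smooth_proj hv
    have hqw := F.smooth_proj hw
    refine smooth_of_reparam _ fun r₀ => ?_
    obtain ⟨χ, hχ, he, g, hgs, hg⟩ := exists_frame hqv r₀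
    refine ⟨χ, he, ?_⟩
    have hv' := (F.smooth_iff (v := fun x => A.pt _ _ (v (χ x))) hg hgs
      (DiffeologicalSpace.plot_reparam (self := sqD _) hqv hχ)).1
      (DiffeologicalSpace.plot_reparam (self := A.dP) hv hχ)
    have hw' := (F.smooth_iff (v := fun x => A.pt _ _ (w (χ x))) hg hgs
      (DiffeologicalSpace.plot_reparam (self := sqD _) hqw hχ)).1
      (DiffeologicalSpace.plot_reparam (self := A.dP) hw hχ)
    -- Smoothness of `y₁` is read off from `v`, and that of `y₃` from `w`.
    have hq : SmoothMap (sqD (weylSubmersion n).dY) fun r => ⟨m r, y₁ r, y₃ r⟩ :=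
      smooth_sq_weyl.2 ⟨(smooth_sq_weyl.1 hqv).1, (smooth_sq_weyl.1 hqv).2.1,
        (smooth_sq_weyl.1 hqw).2.2⟩
    refine (F.smooth_iff (v := fun x => A.pt _ _ (A.mul _ _ _ (v (χ x)) (w (χ x)))) hg hgs
      (DiffeologicalSpace.plot_reparam (self := sqD _) hq hχ)).2 ?_
    simp only [coord_mul]
    exact hv'.mul hw'
  act_one {m} y₁ y₂ v := by
    obtain ⟨g, hg, c, rfl⟩ := F.exists_eq_smul _ _ v
    rw [map_smul, F.act]
    exact F.pt_congr (one_smul _ m.x) (one_mul g) _ hg _ _ _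
  act_mul g h {m} y₁ y₂ v := by
    obtain ⟨l, hl, c, rfl⟩ := F.exists_eq_smul _ _ v
    rw [map_smul, map_smul, map_smul, F.act, F.act, F.act]
    exact F.pt_congr (mul_smul g h m.x) (mul_assoc g h l) _ _ _ _ _
  smooth_act k h v hh hv := by
    have hqv := F.smooth_proj hv
    refine smooth_of_reparam _ fun r₀ => ?_
    obtain ⟨χ, hχ, he, g, hgs, hg⟩ := exists_frame hqv r₀
    refine ⟨χ, he, ?_⟩
    have hv' := (F.smooth_iff (v := fun x => v (χ x)) hg hgs
      (DiffeologicalSpace.plot_reparam (self := sqD _) hqv hχ)).1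
      (DiffeologicalSpace.plot_reparam (self := A.dP) hv hχ)
    have hhχ : SmoothMap inferInstance fun x => h (χ x) := DiffeologicalSpace.plot_reparam hh hχ
    have hq := smooth_sq_weyl.1 (DiffeologicalSpace.plot_reparam (self := sqD _) hqv hχ)
    have hb := smooth_base.1 hq.1
    refine (F.smooth_iff
      (v := fun x => A.pt _ _ ((A.act (h (χ x)) (v (χ x)).1.2.1 (v (χ x)).1.2.2).e (v (χ x)).2))
      (fun x => smul_base_x (h (χ x)) (hg x)) (SU.smooth_mul hhχ hgs)
      (smooth_sq_weyl.2 ⟨smooth_base.2 ⟨hb.1, smooth_smul hhχ hb.2⟩, hq.2⟩)).2 ?_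
    convert hv' using 2 with x
    -- The action carries the frame of `g` to that of `h g`, so the coordinate is unchanged even
    -- when `h` varies.
    have h1 := (A.act (h (χ x)) (v (χ x)).1.2.1 (v (χ x)).1.2.2).coord_apply
      (F.ne _ (g x) (hg x) _ _) (v (χ x)).2
    rw [F.act] at h1
    exact h1
  act_mul_compat h {m} y₁ y₂ y₃ v w := by
    obtain ⟨g, hg, a, rfl⟩ := F.exists_eq_smul _ _ v
    obtain ⟨b, rfl⟩ := exists_smul (F.ne m g hg y₂ y₃) w
    simp only [map_smul, LinearMap.smul_apply, F.mul, F.act]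

/-- The isomorphism of the lines of two framed bundle gerbes that maps one framing to the other. -/
def iso {m : Base n} (y₁ y₂ : (weylSubmersion n).Y m) : HIso (A.P y₁ y₂) (B.P y₁ y₂) :=
  HIso.ofGen (F.unit m m.x.out m.x.out_eq' y₁ y₂) (F'.unit m m.x.out m.x.out_eq' y₁ y₂)

/-- The isomorphism was built from the arbitrary representative `m.x.out`. Replacing it by `g`
scales both frames by the same value of `epsChar`, so the choice is immaterial. -/
theorem iso_σ {m : Base n} {g : SU n} (hg : (g : SU n ⧸ T n) = m.x)
    (y₁ y₂ : (weylSubmersion n).Y m) :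
    (F.iso F' y₁ y₂).e (F.σ m g hg y₁ y₂) = F'.σ m g hg y₁ y₂ := by
  have h0 : ((m.x.out : SU n) : SU n ⧸ T n) = m.x := m.x.out_eq'
  have hm : m.x.out⁻¹ * g ∈ T n := QuotientGroup.eq.1 (h0.trans hg.symm)
  obtain ⟨s, rfl⟩ : ∃ s : T n, g = m.x.out * s := ⟨⟨_, hm⟩, by simp⟩
  rw [F.weight m m.x.out h0, F'.weight m m.x.out h0, map_smul, iso, HIso.ofGen_gen]

/-- The isomorphism of two framed bundle gerbes that maps one framing to the other. -/
def gerbeIso : GerbeIso A B where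
  iso y₁ y₂ := F.iso F' y₁ y₂
  smooth k v hv := by
    have hqv := F.smooth_proj hv
    refine smooth_of_reparam _ fun r₀ => ?_
    obtain ⟨χ, hχ, he, g, hgs, hg⟩ := exists_frame hqv r₀
    have hq := DiffeologicalSpace.plot_reparam (self := sqD _) hqv hχ
    refine ⟨χ, he, (F'.smooth_iff (v := fun x => B.pt _ _ ((F.iso F' (v (χ x)).1.2.1
      (v (χ x)).1.2.2).e (v (χ x)).2)) hg hgs hq).2 ?_⟩
    convert (F.smooth_iff (v := fun x => v (χ x)) hg hgs hq).1
      (DiffeologicalSpace.plot_reparam (self := A.dP) hv hχ) using 2 with x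
    have h1 := (F.iso F' (v (χ x)).1.2.1 (v (χ x)).1.2.2).coord_apply
      (F.ne _ (g x) (hg x) _ _) (v (χ x)).2
    rwa [F.iso_σ F'] at h1
  smooth_symm k w hw := by
    have hqw := F'.smooth_proj hw
    refine smooth_of_reparam _ fun r₀ => ?_
    obtain ⟨χ, hχ, he, g, hgs, hg⟩ := exists_frame hqw r₀
    have hq := DiffeologicalSpace.plot_reparam (self := sqD _) hqw hχ
    refine ⟨χ, he, (F.smooth_iff (v := fun x => A.pt _ _ ((F.iso F' (w (χ x)).1.2.1
      (w (χ x)).1.2.2).e.symm (w (χ x)).2)) hg hgs hq).2 ?_⟩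
    convert (F'.smooth_iff (v := fun x => w (χ x)) hg hgs hq).1
      (DiffeologicalSpace.plot_reparam (self := B.dP) hw hχ) using 2 with x
    have h1 := (F.iso F' (w (χ x)).1.2.1 (w (χ x)).1.2.2).coord_symm_apply
      (F.ne _ (g x) (hg x) _ _) (w (χ x)).2
    rwa [F.iso_σ F'] at h1
  mul {m} y₁ y₂ y₃ v w := by
    obtain ⟨g, hg, a, rfl⟩ := F.exists_eq_smul _ _ v
    obtain ⟨b, rfl⟩ := exists_smul (F.ne m g hg y₂ y₃) w
    simp only [map_smul, LinearMap.smul_apply, F.mul, F'.mul, F.iso_σ F']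
  equivariant h {m} y₁ y₂ v := by
    obtain ⟨g, hg, a, rfl⟩ := F.exists_eq_smul _ _ v
    simp only [map_smul, F.act, F'.act, F.iso_σ F']

end Framing

end Framing

/-! ### The framing of the cup product bundle gerbe -/

section Cup

variable {n k : ℕ}

/-- With `bᵢ = pᵢ(s)` and `e = ε` the scalar is the character required of a framing. -/
theorem tprod_gen_smul {ι : Type} [Fintype ι] {A : ι → HLine} (b : ι → ℂ) (l : ∀ i, A i)
    (e : ι → ℤ) : (PiTensorProduct.tprod ℂ fun i => gen (b i • l i) (e i) :
      HLine.tensor fun i => (A i).pow (e i)) =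
      (∏ i, b i ^ e i) • PiTensorProduct.tprod ℂ fun i => gen (l i) (e i) := by
  simp only [gen_smul]
  exact MultilinearMap.map_smul_univ _ _ _

/-- The element `c` of the line `ℂ_{pᵢ}`. -/
def wt (i : Fin n) (c : ℂ) : (weight i).L := c

/-- The complex number underlying an element of the line `ℂ_{pᵢ}`. -/
def wtVal {i : Fin n} (c : (weight i).L) : ℂ := c

theorem wt_mem (i : Fin n) : wt i 1 ∈ (weight i).L.U := norm_one

theorem smul_wt_one (i : Fin n) (c : ℂ) : c • wt i 1 = wt i c := mul_one c

theorem weight_act (i : Fin n) (s : T n) (c : (weight i).L) : (weight i).act s c = p i s • c := rfl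

/-- The unit vector `[1, g]` of `Jᵢ`. -/
def jUnit (i : Fin n) {x : SU n ⧸ T n} (g : SU n) (hg : (g : SU n ⧸ T n) = x) : J i x :=
  (assocFrame (weight i) g hg).e (wt i 1)

theorem jUnit_mem (i : Fin n) {x : SU n ⧸ T n} (g : SU n) (hg : (g : SU n ⧸ T n) = x) :
    jUnit i g hg ∈ (J i x).U :=
  ((assocFrame (weight i) g hg).unit _).2 (wt_mem i)

theorem smul_jUnit (i : Fin n) {x : SU n ⧸ T n} (g : SU n) (hg : (g : SU n ⧸ T n) = x) (c : ℂ) :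
    c • jUnit i g hg = (assocFrame (weight i) g hg).e (wt i c) := by
  rw [jUnit, ← map_smul, smul_wt_one]

theorem jUnit_mul (i : Fin n) {x : SU n ⧸ T n} (g : SU n) (hg : (g : SU n ⧸ T n) = x) (s : T n)
    (hgs : ((g * s : SU n) : SU n ⧸ T n) = x) :
    jUnit i (g * s) hgs = p i s • jUnit i g hg := by
  rw [jUnit, jUnit, assocFrame_mul _ g hg, weight_act, map_smul]

/-- The unit vector `⊗ᵢ [1, g]^{εᵢ}`. -/
def cupUnit (m : Base n) (g : SU n) (hg : (g : SU n ⧸ T n) = m.x) (z₁ z₂ : FibT m.t) :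
    cupFib z₁ z₂ m.x :=
  PiTensorProduct.tprod ℂ fun i => gen (jUnit i g hg) (eps i z₁ z₂)

theorem cupUnit_mem (m : Base n) (g : SU n) (hg : (g : SU n ⧸ T n) = m.x) (z₁ z₂ : FibT m.t) :
    cupUnit m g hg z₁ z₂ ∈ (cupFib z₁ z₂ m.x).U :=
  tprod_mem_U fun i => gen_mem_U (jUnit_mem i g hg) _

/-- Here `g' = g s` with `s ∈ T`, so `[b, g'] = [pᵢ(s) b, g]`. Writing `pᵢ(s)` as a diagonal entry
of `g⁻¹ g'` makes sense for arbitrary matrices, hence also along lifts that are valid only locally.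
-/
theorem eq_smul_jUnit {i : Fin n} {x : SU n ⧸ T n} (l : J i x) {g g' : SU n}
    (hg : (g : SU n ⧸ T n) = x) {b : (weight i).L} (hl : l.1 = Assoc.mk (weight i) b g') :
    l = (wtVal b * (g⁻¹ * g').1 i i) • jUnit i g hg := by
  have hx : (g' : SU n ⧸ T n) = x := by
    have h := l.2
    rw [hl] at h
    exact h
  have hm : g⁻¹ * g' ∈ T n := QuotientGroup.eq.1 (hg.trans hx.symm)
  apply assocFib_ext
  rw [hl, smul_jUnit, assocFrame_val, Assoc.mk_eq (weight i) b g' ⟨_, hm⟩]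
  congr 1
  · exact mul_comm (p i ⟨_, hm⟩) (wtVal b)
  · simp

/-- Expresses the frame coordinate through any local presentation `d ⊗ᵢ ℓᵢ^{εᵢ}` with `ℓᵢ = [bᵢ,
g'ᵢ]`. The nonvanishing half comes from `ℓᵢ ≠ 0` and permits negative exponents. -/
theorem coeff_of_cupMk {a : CupPoint n} {q : Sq (weylSubmersion n).Y} {g : SU n}
    {hg : (g : SU n ⧸ T n) = q.1.x} {c : ℂ}
    (h : (⟨q, c • cupUnit q.1 g hg q.2.1 q.2.2⟩ :
      Σ q : Sq (weylSubmersion n).Y, cupFib q.2.1 q.2.2 q.1.x) = cupMk a)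
    {b : ∀ i, (weight i).L} {g' : Fin n → SU n} (hb : ∀ i, (a.l i).1 = Assoc.mk (weight i) (b i) (g' i)) :
    (∀ i, wtVal (b i) * (g⁻¹ * g' i).1 i i ≠ 0) ∧
      c = a.c * ∏ i, (wtVal (b i) * (g⁻¹ * g' i).1 i i) ^ eps i (t := q.1.t) q.2.1 q.2.2 := by
  obtain ⟨q', l, hl, d⟩ := a
  obtain ⟨hq, h⟩ := Sigma.mk.inj h
  dsimp only at hq h hb
  subst hq
  have hl' (i : Fin n) := eq_smul_jUnit (l i) hg (hb i)
  refine ⟨fun i h0 => hl i (by rw [hl' i, h0, zero_smul]), ?_⟩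
  have h := eq_of_heq h
  simp only [hl'] at h
  rw [tprod_gen_smul, smul_smul] at h
  have h1 := congrArg (HLine.coord _ (cupUnit q.1 g hg q.2.1 q.2.2)) h
  have hne := HLine.ne_zero (cupUnit_mem q.1 g hg q.2.1 q.2.2)
  rw [coord_smul_self hne] at h1
  exact h1.trans (coord_smul_self hne _)

theorem smooth_cupPoint {a : Eu k → CupPoint n} : SmoothMap inferInstance a ↔
    SmoothMap (sqD (weylSubmersion n).dY) (fun r => (a r).q) ∧
    (ContDiff ℝ ∞ fun r => (a r).c) ∧
      ∀ i, SmoothMap inferInstance fun r => (((a r).l i).1 : Assoc (weight i)) := by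
  rw [← smooth_vecD_complex, ← and_assoc]
  exact smooth_inf.trans (and_congr smooth_inf DiffeologicalSpace.isPlot_iInf_iff)

/-- The framing of the cup product bundle gerbe by the `⊗ᵢ [1, g]^{εᵢ}`. -/
def cupFraming (n : ℕ) : Framing (cupGerbe n) where
  σ := cupUnit
  unit := cupUnit_mem
  mul m g hg z₁ z₂ z₃ := by
    refine (PiTensorProduct.map₂_tprod_tprod _ _ _).trans ?_
    show PiTensorProduct.tprod ℂ _ = PiTensorProduct.tprod ℂ _
    congr 1
    funext i
    exact powMul_gen (HLine.ne_zero (jUnit_mem i g hg)) (eps_add i z₁ z₂ z₃)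
  act h m g hg z₁ z₂ := by
    refine (HIso.tensor_tprod _ _).trans ?_
    show PiTensorProduct.tprod ℂ _ = PiTensorProduct.tprod ℂ _
    congr 1
    funext i
    refine (HIso.pow_gen _ (HLine.ne_zero (jUnit_mem i g hg)) _).trans ?_
    rw [jUnit, assocAct_frame (weight i) h g hg (smul_base_x h hg)]
    rfl
  weight m g hg s hgs z₁ z₂ := by
    refine Eq.trans ?_ (tprod_gen_smul (fun i => p i s) (fun i => jUnit i g hg) _)
    show PiTensorProduct.tprod ℂ _ = PiTensorProduct.tprod ℂ _
    congr 1
    funext i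
    rw [jUnit_mul i g hg]
  smooth_proj {k v} hv := by
    refine smooth_of_eventuallyEq _ fun r₀ => ?_
    obtain ⟨a, ha, hva⟩ := hv r₀
    exact ⟨_, (smooth_cupPoint.1 ha).1, hva.mono fun r hr => congrArg Sigma.fst hr⟩
  smooth {k} q g hg c hq hgs := by
    constructor
    · intro h
      rw [contDiff_iff_contDiffAt]
      intro r₀
      obtain ⟨a, ha, hva⟩ := h r₀
      obtain ⟨-, hc, hl⟩ := smooth_cupPoint.1 ha
      choose b hb hlb using fun i => hl i r₀
      -- These functions are smooth everywhere, but they are the coordinates of the `ℓᵢ`, and known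
      -- to be nonzero, only near `r₀`; the conclusion is therefore drawn pointwise.
      have hβ (i : Fin n) : ContDiff ℝ ∞ fun r => wtVal (b i r).1 * ((g r)⁻¹ * (b i r).2).1 i i :=
        (smooth_vecD_complex.1 (smooth_inf.1 (hb i)).1).mul
          (smooth_SU.1 (SU.smooth_mul (SU.smooth_inv hgs) (smooth_inf.1 (hb i)).2) i i)
      have hall : ∀ᶠ r in 𝓝 r₀, (∀ i, wtVal (b i r).1 * ((g r)⁻¹ * (b i r).2).1 i i ≠ 0) ∧
          c r = (a r).c * ∏ i, (wtVal (b i r).1 * ((g r)⁻¹ * (b i r).2).1 i i) ^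
            eps i (t := (q r).1.t) (q r).2.1 (q r).2.2 := by
        filter_upwards [hva, eventually_all.2 hlb] with r h1 h2
        exact coeff_of_cupMk h1 h2
      obtain ⟨hqb, hz₁, hz₂⟩ := smooth_sq_weyl.1 hq
      refine ContDiffAt.congr_of_eventuallyEq (hc.contDiffAt.mul (contDiffAt_prod_zpow_eps
        (smooth_p (smooth_base.1 hqb).1) hz₁ hz₂ (fun i => (hβ i).contDiffAt)
        hall.self_of_nhds.1)) (hall.mono fun r hr => hr.2)
    · intro hc r₀
      -- The family has the explicit presentation with `ℓᵢ = [1, g]`.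
      refine ⟨fun r => ⟨q r, fun i => jUnit i (g r) (hg r), fun i =>
        HLine.ne_zero (jUnit_mem i _ _), c r⟩, smooth_cupPoint.2 ⟨hq, hc, fun i r₁ => ?_⟩,
        Eventually.of_forall fun r => rfl⟩
      exact ⟨fun r => (wt i 1, g r), smooth_inf.2 ⟨DiffeologicalSpace.constant_plots
        (self := vecD _) _, hgs⟩, Eventually.of_forall fun r => rfl⟩

end Cup

/-! ### The framing of the induced bundle gerbe -/

section Induced

variable {n k : ℕ}

theorem prod_zpow_eps (f : Fin n → ℂ) {t : T n} (z₁ z₂ : FibT t) : ∏ i, f i ^ eps i z₁ z₂ =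
    (∏ i ∈ below t z₁.z \ below t z₂.z, f i) * (∏ i ∈ below t z₂.z \ below t z₁.z, f i)⁻¹ := by
  rw [← Finset.prod_inv_distrib, ← Fintype.prod_ite_mem (below t z₁.z \ below t z₂.z),
    ← Fintype.prod_ite_mem (below t z₂.z \ below t z₁.z), ← Finset.prod_mul_distrib]
  refine Finset.prod_congr rfl fun i _ => ?_
  simp only [eps_eq_sub, Finset.mem_sdiff]
  split_ifs <;> simp_all

theorem idx_eq {t : T n} (z₁ z₂ : FibT t) :
    idx t {l | ang z₂.z < ang l ∧ ang l < ang z₁.z} = below t z₁.z \ below t z₂.z := by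
  ext i
  have := ang_ne z₂ i
  simp only [mem_below, mem_idx, Finset.mem_sdiff, not_lt, Set.mem_ofPred_eq]
  exact ⟨fun h => ⟨h.2, h.1.le⟩, fun h => ⟨lt_of_le_of_ne h.2 this.symm, h.1⟩⟩

theorem detRep_apply (t : T n) (S : Set ℂ) (s : T n) (w : detLine (eigSum t.1.1 S)) :
    detRep t S s w = (∏ i ∈ idx t S, p i s) • w := by
  obtain ⟨c, rfl⟩ := exists_smul (HLine.ne_zero (eD_mem (eigSum_eq t S))) w
  rw [map_smul, detRep_eD, smul_comm]

theorem p_inv (i : Fin n) (s : T n) : p i s⁻¹ = (p i s)⁻¹ := by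
  refine eq_inv_of_mul_eq_one_left ?_
  rw [← p_mul, inv_mul_cancel]
  simp [p]

/-- Conjugation on `Hom` multiplies by the target weight and the inverse of the source weight. The
two index sets are those where `εᵢ` is `1` and `-1`. -/
theorem pbT_act {t : T n} (z₁ z₂ : FibT t) (s : T n) (f : (PbT z₁ z₂).L) :
    (PbT z₁ z₂).act s f = epsChar z₁ z₂ s • f := by
  refine LinearMap.ext fun w => ?_
  refine (detRep_apply _ _ s _).trans ?_
  refine (congrArg (fun w' => (∏ i ∈ idx t {l | ang z₂.z < ang l ∧ ang l < ang z₁.z}, p i s) •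
    (show detLine _ →ₗ[ℂ] detLine _ from f) w') (detRep_apply _ _ s⁻¹ w)).trans ?_
  refine (congrArg _ (map_smul (show detLine _ →ₗ[ℂ] detLine _ from f) _ w)).trans ?_
  rw [idx_eq, idx_eq, smul_smul, epsChar, prod_zpow_eps]
  simp only [p_inv, Finset.prod_inv_distrib]
  rfl

theorem eD_congr {A : Submodule ℂ (V n)} {I J : Finset (Fin n)} (h : A = coordSub I)
    (h' : A = coordSub J) (hIJ : I = J) : eD h = eD h' := by
  subst hIJ; rfl

/-- The unit vector of `Hom(det K(z₂), det K(z₁))` that maps `e_{K(z₂)}` to `e_{K(z₁)}`. -/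
def homUnit {t : T n} (z₁ z₂ : FibT t) : (detLine (K t z₂.z)).hom (detLine (K t z₁.z)) :=
  ((detLine (K t z₂.z)).coord (eD (K_eq t z₂.z))).smulRight (eD (K_eq t z₁.z))

theorem homUnit_smul {t : T n} (z₁ z₂ : FibT t) (c : ℂ) :
    (show detLine (K t z₂.z) →ₗ[ℂ] detLine (K t z₁.z) from homUnit z₁ z₂)
      (c • eD (K_eq t z₂.z)) = c • eD (K_eq t z₁.z) := by
  show (detLine (K t z₂.z)).coord _ (c • eD (K_eq t z₂.z)) • eD (K_eq t z₁.z) = _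
  rw [coord_smul_self (HLine.ne_zero (eD_mem _))]

theorem homUnit_mem {t : T n} (z₁ z₂ : FibT t) :
    homUnit z₁ z₂ ∈ ((detLine (K t z₂.z)).hom (detLine (K t z₁.z))).U := by
  intro a ha
  obtain ⟨c, rfl⟩ := exists_smul (HLine.ne_zero (eD_mem (K_eq t z₂.z))) a
  rw [smul_mem_U (eD_mem _)] at ha
  have h := homUnit_smul z₁ z₂ c
  exact h.symm ▸ (smul_mem_U (eD_mem _) c).2 ha

theorem homComp_homUnit {t : T n} (z₁ z₂ z₃ : FibT t) :
    homComp _ _ _ (homUnit z₁ z₂) (homUnit z₂ z₃) = homUnit z₁ z₃ := by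
  refine hom_ext (HLine.ne_zero (eD_mem (K_eq t z₃.z))) ?_
  have h (z w : FibT t) := homUnit_smul z w 1
  simp only [one_smul] at h
  exact (congrArg (show detLine (K t z₂.z) →ₗ[ℂ] detLine (K t z₁.z) from homUnit z₁ z₂)
    (h z₂ z₃)).trans ((h z₁ z₂).trans (h z₁ z₃).symm)

/-- The phase that makes the unit vectors of the lines of the basic bundle gerbe smooth. -/
def phase {t : T n} (z₁ z₂ : FibT t) : ℂ :=
  ∏ i, (∏ k ∈ Finset.Iio i, halfRoot k t) ^ eps i z₁ z₂

theorem norm_phase {t : T n} (z₁ z₂ : FibT t) : ‖phase z₁ z₂‖ = 1 := by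
  simp [phase, norm_prod, norm_zpow, norm_halfRoot]

/-- Only the exponents involve the `z`'s, and they add. This is why `phase` uses `halfRoot` and not
the smooth `twist`, which depends on `z₁` and `z₂`. -/
theorem phase_mul {t : T n} (z₁ z₂ z₃ : FibT t) : phase z₁ z₂ * phase z₂ z₃ = phase z₁ z₃ := by
  rw [phase, phase, phase, ← Finset.prod_mul_distrib]
  refine Finset.prod_congr rfl fun i _ => ?_
  rw [eps_add i z₁ z₂ z₃, zpow_add₀]
  exact Finset.prod_ne_zero_iff.2 fun j _ => norm_pos_iff.1 (by rw [norm_halfRoot]; exact one_pos)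

/-- A smooth family of unit vectors in the lines of the basic bundle gerbe over `T`, compatible with
the multiplication. -/
def pbUnit {t : T n} (z₁ z₂ : FibT t) : (PbT z₁ z₂).L :=
  phase z₁ z₂ • (hat z₁ z₂).e.symm (homUnit z₁ z₂)

theorem pbUnit_mem {t : T n} (z₁ z₂ : FibT t) : pbUnit z₁ z₂ ∈ (PbT z₁ z₂).L.U :=
  (smul_mem_U (((hat z₁ z₂).symm.unit _).2 (homUnit_mem z₁ z₂)) _).2 (norm_phase z₁ z₂)

theorem pbUnit_ne {t : T n} (z₁ z₂ : FibT t) : pbUnit z₁ z₂ ≠ 0 := HLine.ne_zero (pbUnit_mem z₁ z₂)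

/-- Under `hat` the product is composition of the maps `e_{K(z₂)} ↦ e_{K(z₁)}`, and the phases form
a cocycle. -/
theorem mulPb_pbUnit {t : T n} (z₁ z₂ z₃ : FibT t) :
    mulPb z₁ z₂ z₃ (pbUnit z₁ z₂) (pbUnit z₂ z₃) = pbUnit z₁ z₃ := by
  have h : mulPb z₁ z₂ z₃ ((hat z₁ z₂).e.symm (homUnit z₁ z₂))
      ((hat z₂ z₃).e.symm (homUnit z₂ z₃)) = (hat z₁ z₃).e.symm (homUnit z₁ z₃) := by
    show (hat z₁ z₃).e.symm (homComp _ _ _ ((hat z₁ z₂).e ((hat z₁ z₂).e.symm (homUnit z₁ z₂)))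
      ((hat z₂ z₃).e ((hat z₂ z₃).e.symm (homUnit z₂ z₃)))) = _
    rw [LinearEquiv.apply_symm_apply, LinearEquiv.apply_symm_apply, homComp_homUnit]
  show mulPb z₁ z₂ z₃ (phase z₁ z₂ • _) (phase z₂ z₃ • _) = phase z₁ z₃ • _
  rw [map_smul, map_smul, LinearMap.smul_apply, h, smul_smul, mul_comm, phase_mul]

/-- The coordinate of `pbUnit` with respect to `e_J ↦ e_I`. -/
def pbCoeff {t : T n} (z₁ z₂ : FibT t) : ℂ :=
  ∏ i, (∏ k ∈ Finset.Iio i, twist k z₁ z₂) ^ eps i z₁ z₂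

theorem pbCoeff_ne {t : T n} (z₁ z₂ : FibT t) : pbCoeff z₁ z₂ ≠ 0 :=
  Finset.prod_ne_zero_iff.2 fun _ _ => zpow_ne_zero _ <|
    Finset.prod_ne_zero_iff.2 fun _ _ => twist_ne _ _ _

/-- Splits the smooth coefficient into the multiplicative phase and the sign produced by `hat`,
neither of which need be smooth alone. -/
theorem pbCoeff_eq {t : T n} (z₁ z₂ : FibT t) : pbCoeff z₁ z₂ = phase z₁ z₂ *
    ∏ i, crossSign (below t z₁.z ∩ below t z₂.z) i ^ eps i z₁ z₂ := by
  rw [pbCoeff, phase, ← Finset.prod_mul_distrib]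
  refine Finset.prod_congr rfl fun i _ => ?_
  rw [← mul_zpow, crossSign, ← Finset.prod_mul_distrib]
  simp only [twist, mul_comm]

/-- Write `f(e_J) = x e_I` and evaluate `f̂(e_J ∧ e_K) = f(e_J) ∧ e_K`, where `K` indexes the
eigenvalues below both `z₁` and `z₂`. Comparing coefficients of `e_{I ∪ K}` gives `sgn J K = x * sgn
I K`, which determines `x` because the signs square to one. -/
theorem hat_symm_homUnit {t : T n} (z₁ z₂ : FibT t) :
    (show detLine (L t.1.1 z₂.z z₁.z) →ₗ[ℂ] detLine (L t.1.1 z₁.z z₂.z) from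
      (hat z₁ z₂).e.symm (homUnit z₁ z₂)) (eD (L_eq z₂ z₁)) =
      (∏ i, crossSign (below t z₁.z ∩ below t z₂.z) i ^ eps i z₁ z₂) • eD (L_eq z₁ z₂) := by
  set f : detLine (L t.1.1 z₂.z z₁.z) →ₗ[ℂ] detLine (L t.1.1 z₁.z z₂.z) :=
    (hat z₁ z₂).e.symm (homUnit z₁ z₂) with hf
  obtain ⟨x, hx⟩ := exists_smul (HLine.ne_zero (eD_mem (L_eq z₁ z₂))) (f (eD (L_eq z₂ z₁)))
  have h := homTwist_apply
    (wedge (L_eq z₂ z₁) (K₂_eq t z₁.z z₂.z) (K_eq₂ t z₁.z z₂.z) (disj₂ _ _))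
    (wedge (L_eq z₁ z₂) (K₂_eq t z₁.z z₂.z) (K_eq₁ t z₁.z z₂.z) (disj₁ _ _))
    (wedge_unit _ _ _ _) (wedge_unit _ _ _ _) f (eD (L_eq z₂ z₁)) (eD (K₂_eq t z₁.z z₂.z))
  have h0 : (hat z₁ z₂).e f = homUnit z₁ z₂ := LinearEquiv.apply_symm_apply _ _
  rw [hx, map_smul, LinearMap.smul_apply, wedge_eD, wedge_eD,
    eD_congr (K_eq₂ t z₁.z z₂.z) (K_eq t z₂.z) (by
      rw [Finset.inter_comm, Finset.sdiff_union_inter]),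
    eD_congr (K_eq₁ t z₁.z z₂.z) (K_eq t z₁.z) (Finset.sdiff_union_inter _ _), smul_smul] at h
  have h1 := (homUnit_smul z₁ z₂ (sgn (below t z₂.z \ below t z₁.z)
    (below t z₁.z ∩ below t z₂.z))).symm.trans ((congrArg (fun g : detLine (K t z₂.z) →ₗ[ℂ]
    detLine (K t z₁.z) => g _) h0.symm).trans h)
  have h2 := congrArg (HLine.coord _ (eD (K_eq t z₁.z))) h1
  rw [coord_smul_self (HLine.ne_zero (eD_mem _)), coord_smul_self (HLine.ne_zero (eD_mem _)),
    sgn_eq (disj₁ _ _), sgn_eq (disj₂ _ _)] at h2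
  rw [hx, prod_zpow_eps, ← Finset.prod_inv_distrib]
  congr 1
  -- Each sign is its own inverse, so the exponents `-1` on `J` may be dropped.
  have h3 (i : Fin n) := crossSign_mul_self (below t z₁.z ∩ below t z₂.z) i
  simp only [fun i => inv_eq_of_mul_eq_one_left (h3 i)]
  rw [h2, mul_left_comm, ← Finset.prod_mul_distrib]
  simp only [h3, Finset.prod_const_one, mul_one]

/-- An element of the line `Hom(det L_{(z₂, z₁, t)}, det L_{(z₁, z₂, t)})` as a linear map. -/
def pbMap {t : T n} {z₁ z₂ : FibT t} (f : (PbT z₁ z₂).L) :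
    detLine (L t.1.1 z₂.z z₁.z) →ₗ[ℂ] detLine (L t.1.1 z₁.z z₂.z) := f

theorem pbMap_smul_pbUnit {t : T n} (z₁ z₂ : FibT t) (c d : ℂ) :
    (pbMap (c • pbUnit z₁ z₂) (d • eD (L_eq z₂ z₁))).1 =
      (c * d * pbCoeff z₁ z₂) • eB n (below t z₁.z \ below t z₂.z) := by
  have h : pbMap (c • pbUnit z₁ z₂) (d • eD (L_eq z₂ z₁)) =
      (c * d * pbCoeff z₁ z₂) • eD (L_eq z₁ z₂) := by
    rw [map_smul, pbCoeff_eq, mul_comm c, mul_assoc d, ← smul_smul, ← mul_assoc, ← smul_smul,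
      ← hat_symm_homUnit, ← smul_smul]
    rfl
  rw [h]
  rfl

end Induced

/-! ### Smooth families in `P_{b,T}` and the framing of the induced bundle gerbe -/

section InducedFraming

variable {n k : ℕ}

section PlotFamilies

variable {t : Eu k → T n} (ht : ∀ i, ContDiff ℝ ∞ fun r => p i (t r))
  {z₁ z₂ : ∀ r, FibT (t r)} (hz₁ : ContDiff ℝ ∞ fun r => (z₁ r).z)
  (hz₂ : ContDiff ℝ ∞ fun r => (z₂ r).z)

include ht hz₁ hz₂

theorem contDiff_pbCoeff : ContDiff ℝ ∞ fun r => pbCoeff (z₁ r) (z₂ r) := by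
  rw [contDiff_iff_contDiffAt]
  intro r₀
  refine contDiffAt_prod_zpow_eps ht hz₁ hz₂ (f := fun i r => ∏ k ∈ Finset.Iio i,
    twist k (z₁ r) (z₂ r)) (fun i => contDiffAt_prod fun j _ =>
      (contDiff_twist ht hz₁ hz₂ j).contDiffAt) fun i => ?_
  exact Finset.prod_ne_zero_iff.2 fun j _ => twist_ne _ _ _

/-- Each `below` set may jump at the eigenvalue `1`, but the difference is determined by `εᵢ`.
Consequently `e_I` and `e_J` are locally constant vectors. -/
theorem eventually_sdiff_below_eq (r₀ : Eu k) : ∀ᶠ r in 𝓝 r₀,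
    below (t r) (z₁ r).z \ below (t r) (z₂ r).z =
      below (t r₀) (z₁ r₀).z \ below (t r₀) (z₂ r₀).z := by
  filter_upwards [eventually_eps_eq ht hz₁ hz₂ r₀] with r hr
  ext i
  rw [mem_sdiff_below, mem_sdiff_below, hr]

/-- A family `α e_I`, where `I` is the index set of the eigenvalues between `z₁ > z₂`, is smooth iff `α` is. -/
theorem smooth_smul_eB {α : Eu k → ℂ} : SmoothMap (vecD (Ext n))
    (fun r => α r • eB n (below (t r) (z₁ r).z \ below (t r) (z₂ r).z)) ↔ ContDiff ℝ ∞ α := by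
  rw [smooth_vecD_iff (eB n)]
  constructor
  · intro h
    rw [contDiff_iff_contDiffAt]
    intro r₀
    refine (h (below (t r₀) (z₁ r₀).z \ below (t r₀) (z₂ r₀).z)).contDiffAt.congr_of_eventuallyEq ?_
    filter_upwards [eventually_sdiff_below_eq ht hz₁ hz₂ r₀] with r hr
    simp [hr]
  · intro h I
    rw [contDiff_iff_contDiffAt]
    intro r₀
    refine (h.contDiffAt.mul (contDiffAt_const (c := (eB n).repr
      (eB n (below (t r₀) (z₁ r₀).z \ below (t r₀) (z₂ r₀).z)) I))).congr_of_eventuallyEq ?_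
    filter_upwards [eventually_sdiff_below_eq ht hz₁ hz₂ r₀] with r hr
    rw [hr, map_smul, Finsupp.smul_apply, smul_eq_mul]

/-- A smooth family in the source line is `α e_J` with `α` smooth, and its image is `c α pbCoeff`
times `e_I`. -/
theorem smooth_pbMap {c : Eu k → ℂ} (hc : ContDiff ℝ ∞ c)
    (a : ∀ r, detLine (L (t r).1.1 (z₂ r).z (z₁ r).z))
    (ha : SmoothMap (vecD (Ext n)) fun r => ((a r).1 : Ext n)) : SmoothMap (vecD (Ext n)) fun r =>
      ((pbMap (c r • pbUnit (z₁ r) (z₂ r)) (a r)).1 : Ext n) := by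
  choose α hα using fun r => exists_smul (HLine.ne_zero (eD_mem (L_eq (z₂ r) (z₁ r)))) (a r)
  obtain rfl : a = fun r => α r • eD (L_eq (z₂ r) (z₁ r)) := funext hα
  have hαs : ContDiff ℝ ∞ α := (smooth_smul_eB ht hz₂ hz₁).1 ha
  simp only [pbMap_smul_pbUnit]
  exact (smooth_smul_eB ht hz₁ hz₂).2 ((hc.mul hαs).mul (contDiff_pbCoeff ht hz₁ hz₂))

end PlotFamilies

theorem smooth_totalT {v : Eu k → TotalT n} : SmoothMap inferInstance v ↔
    SmoothMap (sqD inferInstance) (fun r => (v r).1) ∧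
    ∀ (l : ℕ) (φ : Eu l → Eu k), ContDiff ℝ ∞ φ →
      ∀ a : ∀ x, detLine (L (v (φ x)).1.1.1.1 (v (φ x)).1.2.2.z (v (φ x)).1.2.1.z),
        SmoothMap (vecD (Ext n)) (fun x => ((a x).1 : Ext n)) →
          SmoothMap (vecD (Ext n)) (fun x => (pbMap (v (φ x)).2 (a x)).1) :=
  Iff.rfl

theorem smooth_smul_pbUnit {u : Eu k → Sq (fun t : T n => FibT t)} {c : Eu k → ℂ}
    (hu : SmoothMap (sqD inferInstance) u) :
    SmoothMap (inferInstance : DiffeologicalSpace (TotalT n))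
      (fun r => ⟨u r, c r • pbUnit (u r).2.1 (u r).2.2⟩) ↔ ContDiff ℝ ∞ c := by
  have key : ∀ {l : ℕ} (φ : Eu l → Eu k), ContDiff ℝ ∞ φ →
      (∀ i, ContDiff ℝ ∞ fun x => p i (u (φ x)).1) ∧ (ContDiff ℝ ∞ fun x => (u (φ x)).2.1.z) ∧
        ContDiff ℝ ∞ fun x => (u (φ x)).2.2.z := by
    intro l φ hφ
    have h := smooth_sq.1 hu
    exact ⟨fun i => (smooth_p h.1 i).comp hφ, h.2.1.comp hφ, h.2.2.comp hφ⟩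
  constructor
  · intro h
    obtain ⟨ht, hz₁, hz₂⟩ := key id contDiff_id
    -- Testing on the smooth family `e_J` shows that `c * pbCoeff` is smooth; the nowhere vanishing
    -- smooth factor `pbCoeff` is then divided out.
    have h1 := (smooth_totalT.1 h).2 k id contDiff_id (fun x => (1 : ℂ) • eD (L_eq (u x).2.2 (u x).2.1))
      ((smooth_smul_eB ht hz₂ hz₁).2 contDiff_const)
    have h2 : SmoothMap (vecD (Ext n)) fun x => (c x * 1 * pbCoeff (u x).2.1 (u x).2.2) •
        eB n (below (u x).1 (u x).2.1.z \ below (u x).1 (u x).2.2.z) := by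
      simp only [← pbMap_smul_pbUnit]
      exact h1
    have h3 := (smooth_smul_eB ht hz₁ hz₂).1 h2
    simp only [mul_one] at h3
    have h4 := contDiff_pbCoeff ht hz₁ hz₂
    have : c = fun x => c x * pbCoeff (u x).2.1 (u x).2.2 * (pbCoeff (u x).2.1 (u x).2.2)⁻¹ := by
      funext x
      rw [mul_inv_cancel_right₀ (pbCoeff_ne _ _)]
    rw [this]
    exact h3.mul (h4.inv fun x => pbCoeff_ne _ _)
  · intro hc
    refine smooth_totalT.2 ⟨hu, fun l φ hφ a ha => ?_⟩
    exact smooth_pbMap (key φ hφ).1 (key φ hφ).2.1 (key φ hφ).2.2 (hc.comp hφ) a ha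

/-- The unit vector `[pbUnit, g]` of the induced line. -/
def inducedUnit (m : Base n) (g : SU n) (hg : (g : SU n ⧸ T n) = m.x) (z₁ z₂ : FibT m.t) :
    assocFib (PbT z₁ z₂) m.x :=
  (assocFrame (PbT z₁ z₂) g hg).e (pbUnit z₁ z₂)

theorem inducedUnit_mem (m : Base n) (g : SU n) (hg : (g : SU n ⧸ T n) = m.x) (z₁ z₂ : FibT m.t) :
    inducedUnit m g hg z₁ z₂ ∈ (assocFib (PbT z₁ z₂) m.x).U :=
  ((assocFrame (PbT z₁ z₂) g hg).unit _).2 (pbUnit_mem z₁ z₂)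

theorem inducedUnit_mul (m : Base n) (g : SU n) (hg : (g : SU n ⧸ T n) = m.x) (s : T n)
    (hgs : ((g * s : SU n) : SU n ⧸ T n) = m.x) (z₁ z₂ : FibT m.t) :
    inducedUnit m (g * s) hgs z₁ z₂ = epsChar z₁ z₂ s • inducedUnit m g hg z₁ z₂ := by
  rw [inducedUnit, inducedUnit, assocFrame_mul _ g hg, pbT_act, map_smul]

theorem bilin_smul_smul {A B C : HLine} (m : A →ₗ[ℂ] B →ₗ[ℂ] C) (a b : ℂ) (v : A) (w : B) :
    m (a • v) (b • w) = (a * b) • m v w := by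
  rw [map_smul, map_smul, LinearMap.smul_apply, smul_smul, mul_comm]

/-- `T` acts by scalars whose characters multiply, since `εᵢ` is additive; bilinearity does the
rest. -/
theorem mulPb_act {t : T n} (z₁ z₂ z₃ : FibT t) (s : T n) (v : (PbT z₁ z₂).L)
    (w : (PbT z₂ z₃).L) : mulPb z₁ z₂ z₃ ((PbT z₁ z₂).act s v) ((PbT z₂ z₃).act s w) =
      (PbT z₁ z₃).act s (mulPb z₁ z₂ z₃ v w) := by
  have h : epsChar z₁ z₃ s = epsChar z₁ z₂ s * epsChar z₂ z₃ s := by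
    rw [epsChar, epsChar, epsChar, ← Finset.prod_mul_distrib]
    refine Finset.prod_congr rfl fun i _ => ?_
    rw [eps_add i z₁ z₂ z₃, zpow_add₀ (norm_pos_iff.1 (by rw [norm_p]; exact one_pos))]
  rw [pbT_act, pbT_act]
  refine Eq.trans ?_ (pbT_act z₁ z₃ s _).symm
  rw [h]
  exact bilin_smul_smul (mulPb z₁ z₂ z₃) _ _ v w

/-- For a presentation `[d u, g s]` with `u` the vector `pbUnit`, moving `s ∈ T` across gives
`epsChar s` times `[d u, g]`. The character is written in diagonal entries of `g⁻¹ g'`, which are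
defined and smooth along any lift. -/
theorem coeff_of_inducedMk {a : TotalT n × SU n} {q : Sq (weylSubmersion n).Y} {g : SU n}
    {hg : (g : SU n ⧸ T n) = q.1.x} {c : ℂ}
    (h : (⟨q, c • inducedUnit q.1 g hg q.2.1 q.2.2⟩ :
      Σ q : Sq (weylSubmersion n).Y, assocFib (PbT q.2.1 q.2.2) q.1.x) = inducedMk a) :
    c = (PbT a.1.1.2.1 a.1.1.2.2).L.coord (pbUnit a.1.1.2.1 a.1.1.2.2) a.1.2 *
      ∏ i, (g⁻¹ * a.2).1 i i ^ eps i (t := q.1.t) q.2.1 q.2.2 := by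
  obtain ⟨⟨⟨t, z₁, z₂⟩, f⟩, g'⟩ := a
  obtain ⟨hq, h⟩ := Sigma.mk.inj h
  dsimp only at hq
  subst hq
  obtain ⟨d, rfl⟩ := exists_smul (pbUnit_ne z₁ z₂) f
  have hm : g⁻¹ * g' ∈ T n := QuotientGroup.eq.1 hg
  obtain ⟨s, rfl⟩ : ∃ s : T n, g' = g * s := ⟨⟨_, hm⟩, by simp⟩
  have h := eq_of_heq h
  have hne := HLine.ne_zero (inducedUnit_mem ⟨t, ((g * s : SU n) : SU n ⧸ T n)⟩ g hg z₁ z₂)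
  have h1 := congrArg (HLine.coord _ (inducedUnit ⟨t, _⟩ g hg z₁ z₂)) h
  rw [coord_smul_self hne] at h1
  have h2 : (assocFrame (PbT z₁ z₂) (g * s) rfl).e (d • pbUnit z₁ z₂) =
      (d * epsChar z₁ z₂ s) • inducedUnit ⟨t, ((g * s : SU n) : SU n ⧸ T n)⟩ g hg z₁ z₂ := by
    rw [map_smul, ← smul_smul, ← inducedUnit_mul _ g hg s rfl]
    rfl
  rw [coord_smul_self (pbUnit_ne z₁ z₂), inv_mul_cancel_left]
  exact h1.trans ((congrArg _ h2).trans (coord_smul_self hne _))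

theorem smooth_inducedMk {a : Eu k → TotalT n × SU n}
    (ha : SmoothMap (prodD inferInstance inferInstance) a) :
    SmoothMap (sqD (weylSubmersion n).dY) fun r => (inducedMk (a r)).1 := by
  obtain ⟨h1, h2⟩ := smooth_inf.1 ha
  obtain ⟨ht, hz₁, hz₂⟩ := smooth_sq.1 h1.1
  exact smooth_sq_weyl.2 ⟨smooth_base.2 ⟨ht, fun r₀ =>
    ⟨_, h2, Eventually.of_forall fun r => rfl⟩⟩, hz₁, hz₂⟩

/-- The framing of the induced bundle gerbe by the `[pbUnit, g]`. -/
def inducedFraming (n : ℕ) : Framing (inducedGerbe n) where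
  σ := inducedUnit
  unit := inducedUnit_mem
  mul m g hg z₁ z₂ z₃ := by
    refine (assocMul_frame (E := PbT z₁ z₂) (E' := PbT z₂ z₃) (E'' := PbT z₁ z₃)
      (mulPb z₁ z₂ z₃) (mulPb_act z₁ z₂ z₃) g hg _ _).trans ?_
    exact congrArg _ (mulPb_pbUnit z₁ z₂ z₃)
  act h m g hg z₁ z₂ := assocAct_frame (PbT z₁ z₂) h g hg (smul_base_x h hg) _
  weight m g hg s hgs z₁ z₂ := inducedUnit_mul m g hg s hgs z₁ z₂
  smooth_proj {k v} hv := by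
    refine smooth_of_eventuallyEq _ fun r₀ => ?_
    obtain ⟨a, ha, hva⟩ := hv r₀
    exact ⟨_, smooth_inducedMk ha, hva.mono fun r hr => congrArg Sigma.fst hr⟩
  smooth {k} q g hg c hq hgs := by
    constructor
    · intro h
      rw [contDiff_iff_contDiffAt]
      intro r₀
      obtain ⟨a, ha, hva⟩ := h r₀
      obtain ⟨h1, h2⟩ := smooth_inf.1 ha
      -- The `P_{b,T}` component of the lift is its coordinate times `pbUnit`, so
      -- `smooth_smul_pbUnit` applies.
      have hd : ContDiff ℝ ∞ fun r => (PbT (a r).1.1.2.1 (a r).1.1.2.2).L.coord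
          (pbUnit (a r).1.1.2.1 (a r).1.1.2.2) (a r).1.2 := by
        refine (smooth_smul_pbUnit (u := fun r => (a r).1.1) h1.1).1 ?_
        have e : (fun r => (⟨(a r).1.1, (PbT (a r).1.1.2.1 (a r).1.1.2.2).L.coord
            (pbUnit (a r).1.1.2.1 (a r).1.1.2.2) (a r).1.2 •
              pbUnit (a r).1.1.2.1 (a r).1.1.2.2⟩ : TotalT n)) = fun r => (a r).1 :=
          funext fun r => congrArg (Sigma.mk _) (coord_smul (pbUnit_ne _ _) _)
        rw [e]
        exact h1
      have hβ (i : Fin n) : ContDiff ℝ ∞ fun r => ((g r)⁻¹ * (a r).2).1 i i :=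
        smooth_SU.1 (SU.smooth_mul (SU.smooth_inv hgs) h2) i i
      obtain ⟨hqb, hz₁, hz₂⟩ := smooth_sq_weyl.1 hq
      -- The two representatives differ by an element of `T` at `r₀`, so the diagonal entries have
      -- norm one there, as needed for negative powers.
      have hx : (g r₀ : SU n ⧸ T n) = ((a r₀).2 : SU n ⧸ T n) :=
        (hg r₀).trans (congrArg (fun v => v.1.1.x) hva.self_of_nhds)
      refine ContDiffAt.congr_of_eventuallyEq (hd.contDiffAt.mul (contDiffAt_prod_zpow_eps
        (smooth_p (smooth_base.1 hqb).1) hz₁ hz₂ (fun i => (hβ i).contDiffAt) fun i => ?_))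
        (hva.mono fun r hr => coeff_of_inducedMk hr)
      exact norm_pos_iff.1 ((norm_p i ⟨_, QuotientGroup.eq.1 hx⟩).symm ▸ one_pos)
    · intro hc r₀
      obtain ⟨hqb, hz₁, hz₂⟩ := smooth_sq_weyl.1 hq
      have hu : SmoothMap (sqD inferInstance)
          fun r => (⟨(q r).1.t, (q r).2⟩ : Sq (fun t : T n => FibT t)) :=
        smooth_sq.2 ⟨(smooth_base.1 hqb).1, hz₁, hz₂⟩
      refine ⟨fun r => (⟨⟨(q r).1.t, (q r).2⟩, c r • pbUnit (t := (q r).1.t) (q r).2.1 (q r).2.2⟩,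
        g r), smooth_inf.2 ⟨(smooth_smul_pbUnit hu).2 hc, hgs⟩, Eventually.of_forall fun r => ?_⟩
      -- `inducedMk` lands over the coset of `g` itself, so the coset equality must be substituted
      -- before the two sides can be compared.
      have key : ∀ (q : Sq (weylSubmersion n).Y) (g : SU n) (hg : (g : SU n ⧸ T n) = q.1.x) (c : ℂ),
          (⟨q, c • inducedUnit q.1 g hg q.2.1 q.2.2⟩ :
            Σ q : Sq (weylSubmersion n).Y, assocFib (PbT q.2.1 q.2.2) q.1.x) =
          inducedMk (⟨⟨q.1.t, q.2⟩, c • pbUnit (t := q.1.t) q.2.1 q.2.2⟩, g) := by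
        rintro ⟨⟨t, x⟩, z₁, z₂⟩ g hg c
        dsimp only at hg
        subst hg
        rw [inducedMk]
        dsimp only
        rw [map_smul]
        rfl
      exact key _ _ _ _

end InducedFraming

/-! ### The isomorphism -/

section Weights

variable {n : ℕ}

/-- The unit vector `⊗ᵢ 1^{εᵢ}` of `⊗ᵢ ℂ_{pᵢ}^{εᵢ}`. -/
def weightUnit {t : T n} (z₁ z₂ : FibT t) : HLine.tensor fun i => (weight i).L.pow (eps i z₁ z₂) :=
  PiTensorProduct.tprod ℂ fun i => gen (wt i 1) (eps i z₁ z₂)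

theorem weightUnit_mem {t : T n} (z₁ z₂ : FibT t) :
    weightUnit z₁ z₂ ∈ (HLine.tensor fun i => (weight i).L.pow (eps i z₁ z₂)).U :=
  tprod_mem_U fun i => gen_mem_U (wt_mem i) _

theorem weightAct_weightUnit {t : T n} (z₁ z₂ : FibT t) (s : T n) :
    (weightAct z₁ z₂ s).e (weightUnit z₁ z₂) = epsChar z₁ z₂ s • weightUnit z₁ z₂ := by
  refine (HIso.tensor_tprod _ _).trans (Eq.trans ?_
    (tprod_gen_smul (fun i => p i s) (fun i => wt i 1) fun i => eps i z₁ z₂))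
  congr 1
  funext i
  exact HIso.pow_gen _ (HLine.ne_zero (wt_mem i)) _

theorem weightFrame_weightUnit {t : T n} (z₁ z₂ : FibT t) (g : SU n) :
    (weightFrame z₁ z₂ g).e (weightUnit z₁ z₂) = cupUnit ⟨t, (g : SU n ⧸ T n)⟩ g rfl z₁ z₂ := by
  refine (HIso.tensor_tprod _ _).trans ?_
  show PiTensorProduct.tprod ℂ _ = PiTensorProduct.tprod ℂ _
  congr 1
  funext i
  exact HIso.pow_gen _ (HLine.ne_zero (wt_mem i)) _

/-- The isomorphism `(P_{b,T})_{(z₁, z₂, t)} ≅ ⊗ᵢ ℂ_{pᵢ}^{εᵢ}`. -/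
def weightIso {t : T n} (z₁ z₂ : FibT t) :
    HIso (PbT z₁ z₂).L (HLine.tensor fun i => (weight i).L.pow (eps i z₁ z₂)) :=
  HIso.ofGen (pbUnit_mem z₁ z₂) (weightUnit_mem z₁ z₂)

theorem weightIso_pbUnit {t : T n} (z₁ z₂ : FibT t) :
    (weightIso z₁ z₂).e (pbUnit z₁ z₂) = weightUnit z₁ z₂ :=
  HIso.ofGen_gen _ _

theorem weightIso_act {t : T n} (z₁ z₂ : FibT t) (s : T n) (f : (PbT z₁ z₂).L) :
    (weightIso z₁ z₂).e ((PbT z₁ z₂).act s f) =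
      (weightAct z₁ z₂ s).e ((weightIso z₁ z₂).e f) := by
  obtain ⟨c, rfl⟩ := exists_smul (pbUnit_ne z₁ z₂) f
  rw [pbT_act, map_smul, map_smul, map_smul, weightIso_pbUnit, weightAct_weightUnit, smul_comm]

/-- Both routes are linear and send `pbUnit` to `⊗ᵢ [1, g]^{εᵢ}`; by `iso_σ` this holds for every
representative `g`. -/
theorem iso_assocFrame {t : T n} (z₁ z₂ : FibT t) (f : (PbT z₁ z₂).L) (g : SU n) :
    ((inducedFraming n).iso (cupFraming n) (m := ⟨t, (g : SU n ⧸ T n)⟩) z₁ z₂).e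
      ((assocFrame (PbT z₁ z₂) g rfl).e f) =
      (weightFrame z₁ z₂ g).e ((weightIso z₁ z₂).e f) := by
  obtain ⟨c, rfl⟩ := exists_smul (pbUnit_ne z₁ z₂) f
  rw [map_smul (weightIso z₁ z₂).e, weightIso_pbUnit, map_smul (weightFrame z₁ z₂ g).e,
    weightFrame_weightUnit, map_smul (assocFrame (PbT z₁ z₂) g rfl).e]
  exact (map_smul _ _ _).trans (congrArg (c • ·) ((inducedFraming n).iso_σ (cupFraming n)
    (m := ⟨t, (g : SU n ⧸ T n)⟩) (g := g) rfl z₁ z₂))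

end Weights

end WeylGerbe

end

open WeylGerbe

theorem proposition5p9 (n : ℕ) :
    (inducedGerbe n).IsEquivariantBundleGerbe inferInstance inferInstance ∧
    (cupGerbe n).IsEquivariantBundleGerbe inferInstance inferInstance ∧
    ∃ (Φ : GerbeIso (inducedGerbe n) (cupGerbe n))
      (Ψ : ∀ {t : T n} (z₁ z₂ : FibT t),
        HIso (PbT z₁ z₂).L (HLine.tensor fun i => (weight i).L.pow (eps i z₁ z₂))),
      (∀ {t : T n} (z₁ z₂ : FibT t) (s : T n) (f : (PbT z₁ z₂).L),
        (Ψ z₁ z₂).e ((PbT z₁ z₂).act s f) = (weightAct z₁ z₂ s).e ((Ψ z₁ z₂).e f)) ∧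
      ∀ {t : T n} (z₁ z₂ : FibT t) (f : (PbT z₁ z₂).L) (g : SU n),
        (Φ.iso (m := ⟨t, (g : SU n ⧸ T n)⟩) z₁ z₂).e ((assocFrame (PbT z₁ z₂) g rfl).e f) =
          (weightFrame z₁ z₂ g).e ((Ψ z₁ z₂).e f) := by
  exact ⟨(inducedFraming n).isEquivariantBundleGerbe, (cupFraming n).isEquivariantBundleGerbe,
    (inducedFraming n).gerbeIso (cupFraming n), weightIso, weightIso_act, iso_assocFrame⟩
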